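/- Let $E$ be a locally compact Polish space with a $\sigma$-finite Borel measure $\mu$; call a set bounded if it has compact closure, and write $\chi_B$ for multiplication by the indicator of $B$. Let $\mathscr I_1(E,\mu)$ be the trace class of the complex Hilbert space $L_2(E,\mu)$, with norm $\|A\|_1=\operatorname{tr}|A|$. Let $\mathscr I_{1,\mathrm{loc}}(E,\mu)$ be the space of bounded operators $K$ on $L_2(E,\mu)$ with $\chi_BK\chi_B\in\mathscr I_1(E,\mu)$ for every bounded Borel set $B$, where $K_n\to K$ means $\|\chi_B(K_n-K)\chi_B\|_1\to 0$ for every such $B$. Let $\mathrm{Conf}(E)$ be the space of locally finite configurations on $E$ (multiplicities allowed) with the vague topology. For $K\in\mathscr I_{1,\mathrm{loc}}(E,\mu)$, the determinantal measure $\mathbb P_K$, when it exists, is the Borel probability measure on $\mathrm{Conf}(E)$ such that, for every bounded Borel function $h:E\to\mathbb C$ with $h-1$ supported in a bounded Borel set $B$, the function $X\mapsto\prod_{x\in X}h(x)$ is $\mathbb P_K$-integrable and $$\int_{\mathrm{Conf}(E)}\prod_{x\in X}h(x)\,d\mathbb P_K(X)=\det\bigl(1+(h-1)K\chi_B\bigr)\quad\text{(Fredholm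 determinant)}.$$ Let $\Pi_n$ $(n\in\mathbb N)$ and $\Pi$ in $\mathscr I_{1,\mathrm{loc}}(E,\mu)$ be orthogonal projections, and let $g:E\to[0,1]$ be a measurable function such that $\sqrt{1-g}\,\Pi\sqrt{1-g}$ and all $\sqrt{1-g}\,\Pi_n\sqrt{1-g}$ are in $\mathscr I_1(E,\mu)$ (functions act by multiplication). Assume that 1. $\Pi_n\to\Pi$ in $\mathscr I_{1,\mathrm{loc}}(E,\mu)$ as $n\to\infty$; 2. $\lim_{n\to\infty}\operatorname{tr}\sqrt{1-g}\,\Pi_n\sqrt{1-g}=\operatorname{tr}\sqrt{1-g}\,\Pi\sqrt{1-g}$; 3. the operator $1+(g-1)\Pi$ is invertible. Then $1+(g-1)\Pi_n$ is invertible for all sufficiently large $n$, and with $$\tilde{\mathfrak B}(g,\Pi)=\sqrt g\,\Pi\,(1+(g-1)\Pi)^{-1}\sqrt g,\qquad \tilde{\mathfrak B}(g,\Pi_n)=\sqrt g\,\Pi_n(1+(g-1)\Pi_n)^{-1}\sqrt g,$$ the operators $\tilde{\mathfrak B}(g,\Pi)$ and, for large $n$, $\tilde{\mathfrak B}(g,\Pi_n)$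 are in $\mathscr I_{1,\mathrm{loc}}(E,\mu)$, and $$\tilde{\mathfrak B}(g,\Pi_n)\to\tilde{\mathfrak B}(g,\Pi)\quad\text{in }\mathscr I_{1,\mathrm{loc}}(E,\mu).$$ Consequently, the determinantal measures $\mathbb P_{\tilde{\mathfrak B}(g,\Pi)}$ and, for large $n$, $\mathbb P_{\tilde{\mathfrak B}(g,\Pi_n)}$ exist and are unique, and $\mathbb P_{\tilde{\mathfrak B}(g,\Pi_n)}\to\mathbb P_{\tilde{\mathfrak B}(g,\Pi)}$ weakly (against bounded continuous functions on $\mathrm{Conf}(E)$) as $n\to\infty$. -/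

import Mathlib

open MeasureTheory Filter Topology
open scoped ENNReal CompactlySupported

noncomputable section

namespace DetConv

section TraceClass

variable {H : Type*} [NormedAddCommGroup H] [InnerProductSpace ℂ H] [CompleteSpace H]

/-- Index set of a fixed orthonormal basis of the Hilbert space `H`. -/
def BasisIndex (H : Type*) [NormedAddCommGroup H] [InnerProductSpace ℂ H] [CompleteSpace H] :
    Set H :=
  Classical.choose (exists_hilbertBasis ℂ H)

/-- A fixed orthonormal basis of the Hilbert space `H`. The trace norm of an operator, and the trace
and the Fredholm determinant of a trace-class operator, do not depend on its choice. -/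
def basis (H : Type*) [NormedAddCommGroup H] [InnerProductSpace ℂ H] [CompleteSpace H] :
    HilbertBasis (BasisIndex H) ℂ H :=
  Classical.choose (Classical.choose_spec (exists_hilbertBasis ℂ H))

/-- The trace norm `tr |A| = ∑ i, ⟨e i, |A| e i⟩ ∈ [0, ∞]`, where `|A| = (A* A) ^ (1 / 2)`. -/
def traceNorm (A : H →L[ℂ] H) : ℝ≥0∞ :=
  ∑' i, ENNReal.ofReal (inner ℂ (basis H i) (CFC.abs A (basis H i))).re

/-- The trace class `I₁`. -/
def IsTraceClass (A : H →L[ℂ] H) : Prop :=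
  traceNorm A < ∞

/-- The trace `tr A = ∑ i, ⟨e i, A e i⟩` of a trace-class operator. -/
def trace (A : H →L[ℂ] H) : ℂ :=
  ∑' i, inner ℂ (basis H i) (A (basis H i))

open scoped Classical in
/-- The Fredholm determinant `det (1 + A) = ∑ k, tr (Λᵏ A)` of a trace-class operator. In an
orthonormal basis, `tr (Λᵏ A)` is the sum of the principal minors of order `k` of the matrix
of `A`, and the sum of all principal minors converges absolutely. -/
def fredholmDet (A : H →L[ℂ] H) : ℂ :=
  ∑' S : Finset (BasisIndex H),
    (Matrix.of fun i j : S => inner ℂ (basis H i) (A (basis H j))).det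

end TraceClass

section Multiplication

variable {E : Type*} [MeasurableSpace E]

/-- The complex Hilbert space `L₂(E, μ)`. -/
abbrev L2 (μ : Measure E) : Type _ := Lp ℂ 2 μ

open scoped Classical in
/-- The operator of multiplication by `f` on `L₂(E, μ)`, for `f` essentially bounded (and measurable);
it is only used for such `f`. -/
def mulOp (μ : Measure E) (f : E → ℂ) : L2 μ →L[ℂ] L2 μ :=
  if hf : MemLp f ∞ μ then
    (ContinuousLinearMap.mul ℂ ℂ).holderL μ ∞ 2 2 (hf.toLp f)
  else 0

theorem coeFn_mulOp (μ : Measure E) {f : E → ℂ} (hf : MemLp f ∞ μ) (φ : L2 μ) :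
    mulOp μ f φ =ᵐ[μ] fun x => f x * φ x := by
  have h1 := (ContinuousLinearMap.mul ℂ ℂ).coeFn_holder (r := 2) (hf.toLp f) φ
  have h2 := hf.coeFn_toLp
  simp only [mulOp, dif_pos hf, ContinuousLinearMap.holderL_apply_apply]
  filter_upwards [h1, h2] with x hx1 hx2
  rw [hx1, hx2]
  rfl

/-- Multiplication by the characteristic function of `B`. -/
def chi (μ : Measure E) (B : Set E) : L2 μ →L[ℂ] L2 μ :=
  mulOp μ (B.indicator fun _ => 1)

/-- Multiplication by a real function. -/
def mulReal (μ : Measure E) (f : E → ℝ) : L2 μ →L[ℂ] L2 μ :=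
  mulOp μ fun x => (f x : ℂ)

/-- The kernel `√g Π (1 + (g - 1) Π)⁻¹ √g` of the induced process (used only if
`1 + (g - 1) Π` is invertible). -/
def inducedOp (μ : Measure E) (g : E → ℝ) (P : L2 μ →L[ℂ] L2 μ) : L2 μ →L[ℂ] L2 μ :=
  mulReal μ (fun x => √(g x)) * P * Ring.inverse (1 + mulReal μ (fun x => g x - 1) * P) *
    mulReal μ (fun x => √(g x))

end Multiplication

section Local

variable {E : Type*} [TopologicalSpace E] [MeasurableSpace E]

/-- Bounded Borel subsets of the locally compact phase space: those with compact closure. -/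
def IsBddBorel (B : Set E) : Prop :=
  MeasurableSet B ∧ IsCompact (closure B)

/-- The space `I_{1,loc}(E, μ)` of locally trace-class operators. -/
def IsLocTraceClass (μ : Measure E) (K : L2 μ →L[ℂ] L2 μ) : Prop :=
  ∀ B : Set E, IsBddBorel B → IsTraceClass (chi μ B * K * chi μ B)

/-- Convergence in `I_{1,loc}(E, μ)`: convergence in all the seminorms `K ↦ ‖χ_B K χ_B‖₁`. -/
def TendstoLocTrace (μ : Measure E) (K : ℕ → L2 μ →L[ℂ] L2 μ) (K' : L2 μ →L[ℂ] L2 μ) : Prop :=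
  ∀ B : Set E, IsBddBorel B →
    Tendsto (fun n => traceNorm (chi μ B * (K n - K') * chi μ B)) atTop (𝓝 0)

end Local

/-- A configuration on `E`: a collection of particles considered without regard to order, every
bounded set containing only finitely many of them; `mult x` is the number of particles at `x`. -/
@[ext]
structure Conf (E : Type*) [TopologicalSpace E] where
  mult : E → ℕ
  finite_inter : ∀ C : Set E, IsCompact C → (Function.support mult ∩ C).Finite

namespace Conf

variable {E : Type*} [TopologicalSpace E]

/-- The linear statistic `∑_{x ∈ X} φ(x)`, particles being counted with multiplicity
(a finite sum for `φ` with compact support). -/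
def linStat (φ : C_c(E, ℝ)) (X : Conf E) : ℝ :=
  ∑ᶠ x, (X.mult x : ℝ) * φ x

/-- The topology of the space of configurations: the vague topology, generated by the linear
statistics of continuous functions with compact support. -/
instance : TopologicalSpace (Conf E) :=
  TopologicalSpace.induced (fun X (φ : C_c(E, ℝ)) => linStat φ X) inferInstance

instance : MeasurableSpace (Conf E) := borel (Conf E)

instance : BorelSpace (Conf E) := ⟨rfl⟩

/-- The multiplicative functional `Ψ_g(X) = ∏_{x ∈ X} g(x)` (a finite product if `g = 1`
outside a bounded set). -/
def mulFunctional (g : E → ℂ) (X : Conf E) : ℂ :=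
  ∏ᶠ x, g x ^ X.mult x

end Conf

/-- `P` is the determinantal measure induced by the locally trace-class operator `K`:
`E_P Ψ_g = det (1 + (g - 1) K χ_B)` for all bounded Borel functions `g` such that `g - 1` is
supported in a bounded Borel set `B`. -/
structure IsDeterminantal {E : Type*} [TopologicalSpace E] [MeasurableSpace E] (μ : Measure E)
    (K : L2 μ →L[ℂ] L2 μ) (P : ProbabilityMeasure (Conf E)) : Prop where
  locTraceClass : IsLocTraceClass μ K
  integrable : ∀ (g : E → ℂ) (B : Set E), Measurable g → (∃ C : ℝ, ∀ x, ‖g x‖ ≤ C) →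
    IsBddBorel B → (∀ x ∉ B, g x = 1) →
    Integrable (Conf.mulFunctional g) (P : Measure (Conf E))
  integral_eq : ∀ (g : E → ℂ) (B : Set E), Measurable g → (∃ C : ℝ, ∀ x, ‖g x‖ ≤ C) →
    IsBddBorel B → (∀ x ∉ B, g x = 1) →
    ∫ X, Conf.mulFunctional g X ∂(P : Measure (Conf E)) =
      fredholmDet (mulOp μ (fun x => g x - 1) * K * chi μ B)

end DetConv

end

/-! For an orthogonal projection Π and self-adjoint S, the trace of S Π S is the squared
Hilbert–Schmidt norm of Π S. Convergence of such traces together with strong convergence Π_n → Π is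
therefore a Radon–Riesz situation, and Π_n S → Π S in Hilbert–Schmidt norm
(`tendsto_hsSq_of_trace`). Strong convergence comes from local trace convergence by cutting off
vectors (`TendstoLocTrace.tendsto_apply`), because weak convergence of projections is strong.

This is used twice. With S = √(1-g) it shows that 1 + Π_n (g-1) Π_n = 1 - (Π_n S)(Π_n S)* converges
in operator norm (`tendsto_one_add_compression`). Invertibility is an open condition and passes
between 1 + (g-1)Π and 1 + Π(g-1)Π, which settles large n. With S = χ_B it controls the factor Y = Π
χ_B √g in the identity χ_B 𝔅̃ χ_B = Y* T Y, where T is the inverse of 1 + Π(g-1)Π. Both copies of Y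
converge in Hilbert–Schmidt norm and T converges in operator norm, so the product converges in trace
norm (`tendstoLocTrace_inducedOp`).

For the measures, the induced kernel is again an orthogonal projection (`isStarProjection_induced`),
so only locally trace class projections K matter. The Fredholm determinant of X* Y is a sum of mixed
Gram minors of the vectors X e_i and Y e_j. By Hadamard's inequality the minor over S is at most ∏
‖X e_i‖ ‖Y e_i‖, which makes the determinant continuous in the Hilbert–Schmidt norms
(`tendsto_fredholmDet`).

Existence (`exists_isDeterminantal`): finite orthonormal families in the range of K define Slater
densities, whose Laplace functionals are finite determinants by Andréief's identity. These converge
to the Fredholm determinant and stay bounded, so exponential moments are bounded, the laws are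
tight, and a limit point has the right Laplace functional on exponentials of test functions. A Baire
class argument reaches all bounded measurable functions.

Uniqueness and weak convergence: characteristic functions of linear statistics determine the law and
its limits, by Cramér–Wold and the portmanteau theorem (`Conf.tendsto_of_tendsto_charFun`). For
determinantal measures they are Fredholm determinants, to which the continuity above applies. -/

noncomputable section

set_option linter.unusedSectionVars false

namespace DetConv

/-! ### Hadamard's inequality and sums of mixed Gram minors. -/

section GramMinors

variable {H : Type*} [NormedAddCommGroup H] [InnerProductSpace ℂ H]

/-- **Hadamard's inequality** for the determinant in an orthonormal basis. -/
theorem norm_det_orthonormalBasis_le {ι : Type*} [Fintype ι] [DecidableEq ι]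
    (b : OrthonormalBasis ι ℂ H) (v : ι → H) : ‖b.toBasis.det v‖ ≤ ∏ i, ‖v i‖ := by
  have key : ∀ (n : ℕ) (b : OrthonormalBasis (Fin n) ℂ H) (v : Fin n → H),
      ‖b.toBasis.det v‖ ≤ ∏ i, ‖v i‖ := by
    intro n b v
    have : FiniteDimensional ℂ H := b.toBasis.finiteDimensional_of_finite
    have hd : Module.finrank ℂ H = Fintype.card (Fin n) :=
      Module.finrank_eq_card_basis b.toBasis
    -- In the Gram–Schmidt basis of `v` the determinant is a product of diagonal inner products, and
    -- a change of orthonormal basis has determinant of modulus one.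
    set b' := InnerProductSpace.gramSchmidtOrthonormalBasis hd v with hb'
    have h1 := b.toBasis.det.eq_smul_basis_det b'.toBasis
    have h2 : b'.toBasis.det v = ∏ i, inner ℂ (b' i) (v i) :=
      InnerProductSpace.gramSchmidtOrthonormalBasis_det hd v
    rw [h1, AlternatingMap.smul_apply, norm_smul, h2, OrthonormalBasis.coe_toBasis,
      b.det_to_matrix_orthonormalBasis b', one_mul, norm_prod]
    refine Finset.prod_le_prod (fun _ _ => norm_nonneg _) fun i _ => ?_
    calc ‖inner ℂ (b' i) (v i)‖ ≤ ‖b' i‖ * ‖v i‖ := norm_inner_le_norm _ _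
      _ = ‖v i‖ := by rw [b'.orthonormal.1 i, one_mul]
  let e := Fintype.equivFin ι
  have h := key _ (b.reindex e) (v ∘ e.symm)
  rw [OrthonormalBasis.reindex_toBasis, Module.Basis.det_reindex] at h
  convert h using 1
  · simp [Function.comp_assoc]
  · exact (Equiv.prod_comp e.symm fun i => ‖v i‖).symm

/-- A mixed Gram determinant is bounded by the product of the norms of the vectors. -/
theorem norm_det_inner_le {ι : Type*} [Fintype ι] [DecidableEq ι] (a b : ι → H) :
    ‖(Matrix.of fun i j => inner ℂ (a i) (b j)).det‖ ≤ ∏ i, ‖a i‖ * ‖b i‖ := by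
  by_cases hdet : (Matrix.of fun i j => inner ℂ (a i) (b j)).det = 0
  · rw [hdet, norm_zero]
    positivity
  -- A linear relation among the `b j` would be a null vector of the matrix. Independence makes the
  -- span of `b` of dimension exactly `card ι`, so the matrix factors into square ones.
  have hli : LinearIndependent ℂ b := by
    rw [Fintype.linearIndependent_iff]
    intro c hc
    by_contra! hne
    apply hdet
    rw [← Matrix.exists_mulVec_eq_zero_iff]
    obtain ⟨i, hi⟩ := hne
    refine ⟨c, fun h => hi (congrFun h i), ?_⟩
    ext i
    have := congrArg (fun x => inner ℂ (a i) x) hc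
    simpa [inner_sum, inner_smul_right, Matrix.mulVec, dotProduct, mul_comm] using this
  let W := Submodule.span ℂ (Set.range b)
  have : FiniteDimensional ℂ W := FiniteDimensional.span_of_finite ℂ (Set.finite_range b)
  have hfin : Module.finrank ℂ W = Fintype.card ι := finrank_span_eq_card hli
  let u : OrthonormalBasis ι ℂ W :=
    (stdOrthonormalBasis ℂ W).reindex (Fintype.equivOfCardEq (by simp [hfin]))
  -- Projecting `a` to the span of `b` keeps all inner products and does not increase the norms.
  let a' : ι → W := fun i => W.orthogonalProjectionOnto (a i)
  let b' : ι → W := fun i => ⟨b i, Submodule.subset_span ⟨i, rfl⟩⟩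
  have hab : ∀ i j, inner ℂ (a i) (b j) = inner ℂ (a' i) (b' j) := fun i j => by
    simp [a', b']
  have hM : (Matrix.of fun i j => inner ℂ (a i) (b j)) =
      (u.toBasis.toMatrix a').conjTranspose * u.toBasis.toMatrix b' := by
    ext i j
    rw [Matrix.of_apply, hab, ← u.sum_inner_mul_inner, Matrix.mul_apply]
    refine Finset.sum_congr rfl fun l _ => ?_
    simp [Module.Basis.toMatrix_apply, OrthonormalBasis.repr_apply_apply]
  rw [hM, Matrix.det_mul, Matrix.det_conjTranspose, norm_mul, norm_star, Finset.prod_mul_distrib]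
  have h1 := norm_det_orthonormalBasis_le u a'
  have h2 := norm_det_orthonormalBasis_le u b'
  rw [Module.Basis.det_apply] at h1 h2
  refine mul_le_mul (h1.trans ?_) (h2.trans_eq ?_) (norm_nonneg _) (by positivity)
  · exact Finset.prod_le_prod (fun _ _ => norm_nonneg _) fun i _ =>
      W.norm_orthogonalProjectionOnto_apply_le (a i)
  · rfl

open scoped Classical in
/-- The principal minor with index set `S` of the matrix `⟨a i, b j⟩`. -/
def gramMinor {ι : Type*} (a b : ι → H) (S : Finset ι) : ℂ :=
  (Matrix.of fun i j : S => inner ℂ (a i) (b j)).det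

theorem norm_gramMinor_le {ι : Type*} (a b : ι → H) (S : Finset ι) :
    ‖gramMinor a b S‖ ≤ ∏ i ∈ S, ‖a i‖ * ‖b i‖ := by
  classical
  refine (norm_det_inner_le (fun i : S => a i) fun i : S => b i).trans_eq ?_
  exact Finset.prod_coe_sort S fun i => ‖a i‖ * ‖b i‖

theorem summable_gramMinor {ι : Type*} {a b : ι → H}
    (h : Summable fun i => ‖a i‖ * ‖b i‖) : Summable (gramMinor a b) :=
  .of_norm_bounded (summable_finsetProd_of_summable_nonneg (fun _ => by positivity) h)
    (norm_gramMinor_le a b)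

/-- The Hadamard majorants are the terms of the expanded product ∏ (1 + ‖a i‖ ‖b i‖), and 1 + t ≤
exp t. The explicit bound is what later stays uniform over finite rank approximations. -/
theorem norm_tsum_gramMinor_le {ι : Type*} {a b : ι → H}
    (h : Summable fun i => ‖a i‖ * ‖b i‖) :
    ‖∑' S, gramMinor a b S‖ ≤ Real.exp (∑' i, ‖a i‖ * ‖b i‖) := by
  have hs : Summable fun S : Finset ι => ∏ i ∈ S, ‖a i‖ * ‖b i‖ :=
    summable_finsetProd_of_summable_nonneg (fun _ => by positivity) h
  refine (tsum_of_norm_bounded hs.hasSum (norm_gramMinor_le a b)).trans ?_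
  refine hs.tsum_le_of_sum_le fun T => ?_
  classical
  calc ∑ S ∈ T, ∏ i ∈ S, ‖a i‖ * ‖b i‖
      ≤ ∑ S ∈ (T.biUnion id).powerset, ∏ i ∈ S, ‖a i‖ * ‖b i‖ :=
        Finset.sum_le_sum_of_subset_of_nonneg
          (fun S hS => Finset.mem_powerset.2 (Finset.subset_biUnion_of_mem id hS))
          fun _ _ _ => Finset.prod_nonneg fun _ _ => by positivity
    _ = ∏ i ∈ T.biUnion id, (1 + ‖a i‖ * ‖b i‖) := (Finset.prod_one_add _).symm
    _ ≤ Real.exp (∑ i ∈ T.biUnion id, ‖a i‖ * ‖b i‖) :=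
        Real.prod_one_add_le_exp_sum _ fun _ => by positivity
    _ ≤ Real.exp (∑' i, ‖a i‖ * ‖b i‖) :=
        Real.exp_le_exp.2 (h.sum_le_tsum _ fun _ _ => by positivity)

theorem tendsto_gramMinor {ι α : Type*} {l : Filter α} {a b : α → ι → H} {a' b' : ι → H}
    (ha : ∀ i, Tendsto (fun n => a n i) l (𝓝 (a' i)))
    (hb : ∀ i, Tendsto (fun n => b n i) l (𝓝 (b' i))) (S : Finset ι) :
    Tendsto (fun n => gramMinor (a n) (b n) S) l (𝓝 (gramMinor a' b' S)) := by
  classical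
  have hc : Continuous fun M : Matrix S S ℂ => M.det := continuous_id.matrix_det
  refine (hc.tendsto _).comp (tendsto_pi_nhds.2 fun i => tendsto_pi_nhds.2 fun j => ?_)
  exact (ha i).inner (hb j)

theorem tendsto_tsum_gramMinor {ι α : Type*} {l : Filter α} {a b : α → ι → H} {a' b' : ι → H}
    (ha : ∀ i, Tendsto (fun n => a n i) l (𝓝 (a' i)))
    (hb : ∀ i, Tendsto (fun n => b n i) l (𝓝 (b' i)))
    {c : ι → ℝ} (hc : Summable c) (hab : ∀ᶠ n in l, ∀ i, ‖a n i‖ * ‖b n i‖ ≤ c i) :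
    Tendsto (fun n => ∑' S, gramMinor (a n) (b n) S) l (𝓝 (∑' S, gramMinor a' b' S)) := by
  rcases l.eq_or_neBot with rfl | hl
  · simp
  have hc0 : ∀ i, 0 ≤ c i := fun i => by
    obtain ⟨n, hn⟩ := hab.exists
    exact le_trans (by positivity) (hn i)
  refine tendsto_tsum_of_dominated_convergence
    (summable_finsetProd_of_summable_nonneg hc0 hc) (fun S => tendsto_gramMinor ha hb S) ?_
  filter_upwards [hab] with n hn S
  exact (norm_gramMinor_le _ _ S).trans
    (Finset.prod_le_prod (fun _ _ => by positivity) fun i _ => hn i)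

/-- Sequential continuity of the sum of the mixed Gram minors in `ℓ²`. -/
theorem tendsto_tsum_gramMinor_of_l2 {ι : Type*} {a b : ℕ → ι → H} {a' b' : ι → H}
    (ha' : Summable fun i => ‖a' i‖ ^ 2) (hb' : Summable fun i => ‖b' i‖ ^ 2)
    (has : ∀ᶠ n in atTop, Summable fun i => ‖a n i - a' i‖ ^ 2)
    (hbs : ∀ᶠ n in atTop, Summable fun i => ‖b n i - b' i‖ ^ 2)
    (ha : Tendsto (fun n => ∑' i, ‖a n i - a' i‖ ^ 2) atTop (𝓝 0))
    (hb : Tendsto (fun n => ∑' i, ‖b n i - b' i‖ ^ 2) atTop (𝓝 0)) :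
    Tendsto (fun n => ∑' S, gramMinor (a n) (b n) S) atTop (𝓝 (∑' S, gramMinor a' b' S)) := by
  -- Convergence in ℓ² alone provides no common dominating sequence. Along a subsequence with
  -- squared errors below 2⁻ᵏ the errors are summable over `k` as well, and their sum over `k`
  -- dominates.
  refine tendsto_of_subseq_tendsto fun ns hns => ?_
  have hev : ∀ k : ℕ, ∀ᶠ n in atTop, (Summable fun i => ‖a (ns n) i - a' i‖ ^ 2) ∧
      (Summable fun i => ‖b (ns n) i - b' i‖ ^ 2) ∧
      ∑' i, ‖a (ns n) i - a' i‖ ^ 2 < (1 / 2 : ℝ) ^ k ∧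
      ∑' i, ‖b (ns n) i - b' i‖ ^ 2 < (1 / 2 : ℝ) ^ k := fun k => by
    filter_upwards [hns.eventually has, hns.eventually hbs,
      (ha.comp hns).eventually_lt_const (u := (1 / 2 : ℝ) ^ k) (by positivity),
      (hb.comp hns).eventually_lt_const (u := (1 / 2 : ℝ) ^ k) (by positivity)] with n h1 h2 h3 h4
    exact ⟨h1, h2, h3, h4⟩
  choose φ hφ using fun k => (hev k).exists
  refine ⟨φ, ?_⟩
  have main : ∀ (d : ℕ → ι → H) (d' : ι → H), (Summable fun i => ‖d' i‖ ^ 2) →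
      (∀ k, Summable fun i => ‖d (ns (φ k)) i - d' i‖ ^ 2) →
      (∀ k, ∑' i, ‖d (ns (φ k)) i - d' i‖ ^ 2 < (1 / 2 : ℝ) ^ k) →
      (∀ i, Tendsto (fun k => d (ns (φ k)) i) atTop (𝓝 (d' i))) ∧
      ∃ c : ι → ℝ, Summable c ∧ ∀ k i, ‖d (ns (φ k)) i‖ ^ 2 ≤ c i := by
    intro d d' hd' hs hlt
    have hle : ∀ k i, ‖d (ns (φ k)) i - d' i‖ ^ 2 ≤ (1 / 2 : ℝ) ^ k := fun k i =>
      ((hs k).le_tsum i fun _ _ => by positivity).trans (hlt k).le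
    constructor
    · intro i
      rw [tendsto_iff_norm_sub_tendsto_zero]
      have : Tendsto (fun k => ‖d (ns (φ k)) i - d' i‖ ^ 2) atTop (𝓝 0) :=
        squeeze_zero (fun _ => by positivity) (fun k => hle k i)
          (tendsto_pow_atTop_nhds_zero_of_lt_one (by norm_num) (by norm_num))
      have := this.sqrt
      simpa using this
    · have hsum : Summable fun p : ℕ × ι => ‖d (ns (φ p.1)) p.2 - d' p.2‖ ^ 2 := by
        rw [summable_prod_of_nonneg fun _ => by positivity]
        refine ⟨hs, Summable.of_nonneg_of_le (fun k => tsum_nonneg fun _ => by positivity)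
          (fun k => (hlt k).le) (summable_geometric_of_lt_one (by norm_num) (by norm_num))⟩
      have hsum' := (Equiv.prodComm ι ℕ).summable_iff.2 hsum
      have hsk : ∀ i, Summable fun k => ‖d (ns (φ k)) i - d' i‖ ^ 2 := fun i => hsum'.prod_factor i
      refine ⟨fun i => 2 * ‖d' i‖ ^ 2 + 2 * ∑' k, ‖d (ns (φ k)) i - d' i‖ ^ 2,
        (hd'.mul_left 2).add (hsum'.prod.mul_left 2), fun k i => ?_⟩
      have h1 := (hsk i).le_tsum k fun _ _ => by positivity
      have h2 : ‖d (ns (φ k)) i‖ ≤ ‖d' i‖ + ‖d (ns (φ k)) i - d' i‖ := by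
        simpa using norm_add_le (d' i) (d (ns (φ k)) i - d' i)
      nlinarith [norm_nonneg (d (ns (φ k)) i), norm_nonneg (d' i),
        norm_nonneg (d (ns (φ k)) i - d' i), sq_nonneg (‖d' i‖ - ‖d (ns (φ k)) i - d' i‖)]
  obtain ⟨hat, c, hc, hac⟩ := main a a' ha' (fun k => (hφ k).1) fun k => (hφ k).2.2.1
  obtain ⟨hbt, c', hc', hbc⟩ := main b b' hb' (fun k => (hφ k).2.1) fun k => (hφ k).2.2.2
  refine tendsto_tsum_gramMinor hat hbt (hc.add hc') (.of_forall fun k i => ?_)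
  nlinarith [hac k i, hbc k i, sq_nonneg (‖a (ns (φ k)) i‖ - ‖b (ns (φ k)) i‖)]

/-- The sum of all principal minors of `A` is `det (1 + A)`. -/
theorem det_one_add_eq_sum_minors {ι : Type*} [Fintype ι] [DecidableEq ι] (A : Matrix ι ι ℂ) :
    (1 + A).det = ∑ S : Finset ι, (A.submatrix (Subtype.val : S → ι) Subtype.val).det := by
  have h := (Matrix.detRowAlternating (R := ℂ) (n := ι)).map_add_univ A (1 : Matrix ι ι ℂ)
  rw [add_comm]
  refine Eq.trans h (Finset.sum_congr rfl fun S _ => ?_)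
  exact Matrix.det_piecewise_one_eq_submatrix_det A S

/-- The sum of the minors of a product `⟨a i, b j⟩ = ∑ l, U i l * V l j` over a finite index set
`κ` is the finite determinant of `1 + V U`. -/
theorem tsum_gramMinor_eq_det {ι κ : Type*} [Fintype κ] [DecidableEq κ] {a b : ι → H}
    (hab : Summable fun i => ‖a i‖ * ‖b i‖) (U : ι → κ → ℂ) (V : κ → ι → ℂ) (M : Matrix κ κ ℂ)
    (hUV : ∀ i j, inner ℂ (a i) (b j) = ∑ l, U i l * V l j)
    (hVU : ∀ k l, HasSum (fun i => V k i * U i l) (M k l)) :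
    ∑' S, gramMinor a b S = (1 + M).det := by
  classical
  have h1 : Tendsto (fun F : Finset ι => ∑ S ∈ F.powerset, gramMinor a b S) atTop
      (𝓝 (∑' S, gramMinor a b S)) :=
    (summable_gramMinor hab).hasSum.comp tendsto_finset_powerset_atTop_atTop
  refine tendsto_nhds_unique h1 ?_
  have h2 : ∀ F : Finset ι, ∑ S ∈ F.powerset, gramMinor a b S =
      (1 + Matrix.of fun k l => ∑ i ∈ F, V k i * U i l).det := by
    intro F
    let U' : Matrix F κ ℂ := Matrix.of fun i l => U i l
    let V' : Matrix κ F ℂ := Matrix.of fun l i => V l i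
    have h3 : (Matrix.of fun k l => ∑ i ∈ F, V k i * U i l) = V' * U' := by
      ext k l
      simp only [Matrix.of_apply, Matrix.mul_apply, U', V']
      exact (Finset.sum_coe_sort F fun i => V k i * U i l).symm
    -- Exchanging the two factors trades a determinant of size `F` for one of size `κ`, which stays
    -- fixed as `F` grows.
    rw [h3, ← Matrix.det_one_add_mul_comm, det_one_add_eq_sum_minors]
    refine (Finset.sum_bij (fun (T : Finset F) _ => T.map (Function.Embedding.subtype _))
      ?_ ?_ ?_ ?_).symm
    · intro T _
      rw [Finset.mem_powerset]
      intro x hx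
      obtain ⟨y, _, rfl⟩ := Finset.mem_map.1 hx
      exact y.2
    · intro T _ T' _ h
      exact Finset.map_injective _ h
    · intro S hS
      refine ⟨S.subtype (· ∈ F), Finset.mem_univ _, ?_⟩
      rw [Finset.subtype_map, Finset.filter_true_of_mem fun x hx => Finset.mem_powerset.1 hS hx]
    · intro T _
      let e : T ≃ (T.map (Function.Embedding.subtype (· ∈ F)) : Finset ι) :=
        Equiv.ofBijective (fun x => ⟨x.1.1, Finset.mem_map_of_mem _ x.2⟩)
          ⟨fun x y h => by
            have h' : x.1.1 = y.1.1 := congrArg (fun z : (T.map _ : Finset ι) => z.1) h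
            exact Subtype.ext (Subtype.ext h'), fun y => by
            obtain ⟨x, hx, hxy⟩ := Finset.mem_map.1 y.2
            exact ⟨⟨x, hx⟩, Subtype.ext hxy⟩⟩
      rw [gramMinor, ← Matrix.det_submatrix_equiv_self e]
      congr 1
      ext i j
      simp only [Matrix.submatrix_apply, Matrix.mul_apply, Matrix.of_apply, hUV, U', V']
      rfl
  simp_rw [h2]
  have hc : Continuous fun M : Matrix κ κ ℂ => (1 + M).det :=
    (continuous_const.add continuous_id).matrix_det
  refine (hc.tendsto M).comp (tendsto_pi_nhds.2 fun k => tendsto_pi_nhds.2 fun l => ?_)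
  exact hVU k l

end GramMinors

/-! ### Hilbert–Schmidt norm, trace norm and the Fredholm determinant. -/

section HilbertSchmidt

variable {H : Type*} [NormedAddCommGroup H] [InnerProductSpace ℂ H] [CompleteSpace H]

theorem hasSum_norm_inner_sq {ι : Type*} (b : HilbertBasis ι ℂ H) (x : H) :
    HasSum (fun i => ‖inner ℂ (b i) x‖ ^ 2) (‖x‖ ^ 2) := by
  have h := (b.hasSum_inner_mul_inner x x).mapL Complex.reCLM
  have h1 : ∀ i, Complex.reCLM (inner ℂ x (b i) * inner ℂ (b i) x) = ‖inner ℂ (b i) x‖ ^ 2 := by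
    intro i
    rw [← inner_conj_symm x (b i), RCLike.conj_mul]
    simp [← Complex.ofReal_pow]
  simp_rw [h1] at h
  convert h using 1
  exact (inner_self_eq_norm_sq (𝕜 := ℂ) x).symm

theorem enorm_sq_eq_ofReal {F : Type*} [SeminormedAddGroup F] (x : F) :
    ‖x‖ₑ ^ 2 = ENNReal.ofReal (‖x‖ ^ 2) := by
  rw [← ofReal_norm, ENNReal.ofReal_pow (norm_nonneg _)]

theorem enorm_inner_le_enorm (x y : H) : ‖inner ℂ x y‖ₑ ≤ ‖x‖ₑ * ‖y‖ₑ := by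
  rw [← ofReal_norm, ← ofReal_norm, ← ofReal_norm, ← ENNReal.ofReal_mul (norm_nonneg _)]
  exact ENNReal.ofReal_le_ofReal (norm_inner_le_norm _ _)

theorem tsum_enorm_inner_sq {ι : Type*} (b : HilbertBasis ι ℂ H) (x : H) :
    ∑' i, ‖inner ℂ (b i) x‖ₑ ^ 2 = ‖x‖ₑ ^ 2 := by
  have h := hasSum_norm_inner_sq b x
  rw [enorm_sq_eq_ofReal, ← h.tsum_eq, ENNReal.ofReal_tsum_of_nonneg (fun _ => by positivity)
    h.summable]
  simp_rw [enorm_sq_eq_ofReal]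

/-- The square of the Hilbert–Schmidt norm. -/
def hsSq (A : H →L[ℂ] H) : ℝ≥0∞ :=
  ∑' i, ‖A (basis H i)‖ₑ ^ 2

/-- Both sides are the double sum of the squared moduli of the matrix entries, summed in opposite
orders. -/
theorem hsSq_adjoint (A : H →L[ℂ] H) : hsSq (star A) = hsSq A := by
  simp only [hsSq]
  calc ∑' i, ‖star A (basis H i)‖ₑ ^ 2
      = ∑' i, ∑' j, ‖inner ℂ (basis H j) (star A (basis H i))‖ₑ ^ 2 := by
        simp_rw [tsum_enorm_inner_sq]
    _ = ∑' i, ∑' j, ‖inner ℂ (basis H i) (A (basis H j))‖ₑ ^ 2 := by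
        refine tsum_congr fun i => tsum_congr fun j => ?_
        rw [ContinuousLinearMap.star_eq_adjoint, ContinuousLinearMap.adjoint_inner_right,
          ← inner_conj_symm, ← ofReal_norm, RCLike.norm_conj, ofReal_norm]
    _ = ∑' j, ∑' i, ‖inner ℂ (basis H i) (A (basis H j))‖ₑ ^ 2 := ENNReal.tsum_comm
    _ = ∑' j, ‖A (basis H j)‖ₑ ^ 2 := by simp_rw [tsum_enorm_inner_sq]

theorem hsSq_mul_le (T A : H →L[ℂ] H) : hsSq (T * A) ≤ ‖T‖ₑ ^ 2 * hsSq A := by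
  rw [hsSq, hsSq, ← ENNReal.tsum_mul_left]
  refine ENNReal.tsum_le_tsum fun i => ?_
  rw [← mul_pow]
  gcongr
  exact T.le_opENorm _

theorem hsSq_mul_le' (A T : H →L[ℂ] H) : hsSq (A * T) ≤ ‖T‖ₑ ^ 2 * hsSq A := by
  rw [← hsSq_adjoint, star_mul]
  refine (hsSq_mul_le _ _).trans_eq ?_
  rw [hsSq_adjoint, ← ofReal_norm, norm_star, ofReal_norm]

theorem hsSq_mul_lt_top (T : H →L[ℂ] H) {A : H →L[ℂ] H} (hA : hsSq A < ∞) : hsSq (T * A) < ∞ :=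
  (hsSq_mul_le T A).trans_lt (ENNReal.mul_lt_top (by simp) hA)

theorem hsSq_mul_lt_top' (T : H →L[ℂ] H) {A : H →L[ℂ] H} (hA : hsSq A < ∞) : hsSq (A * T) < ∞ :=
  (hsSq_mul_le' A T).trans_lt (ENNReal.mul_lt_top (by simp) hA)

/-- Parseval for `A x`, with Cauchy–Schwarz applied to each coefficient ⟨A* e_i, x⟩. -/
theorem enorm_sq_le_hsSq (A : H →L[ℂ] H) : ‖A‖ₑ ^ 2 ≤ hsSq A := by
  have h : ∀ x, ‖A x‖ₑ ^ 2 ≤ hsSq A * ‖x‖ₑ ^ 2 := fun x => by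
    rw [← tsum_enorm_inner_sq (basis H), ← hsSq_adjoint, hsSq, ← ENNReal.tsum_mul_right]
    refine ENNReal.tsum_le_tsum fun i => ?_
    rw [← mul_pow, ← ContinuousLinearMap.adjoint_inner_left]
    gcongr
    exact enorm_inner_le_enorm _ _
  by_cases htop : hsSq A = ∞
  · simp [htop]
  have h2 : ‖A‖ ≤ √(hsSq A).toReal := by
    refine A.opNorm_le_bound (Real.sqrt_nonneg _) fun x => ?_
    refine Real.le_sqrt_of_sq_le ?_ |>.trans_eq (b := √((hsSq A).toReal * ‖x‖ ^ 2)) ?_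
    · have := ENNReal.toReal_mono (ENNReal.mul_ne_top htop (by simp)) (h x)
      simpa [ENNReal.toReal_mul, ENNReal.toReal_pow] using this
    · rw [Real.sqrt_mul ENNReal.toReal_nonneg, Real.sqrt_sq (norm_nonneg _)]
  rw [enorm_sq_eq_ofReal, ← ENNReal.ofReal_toReal htop]
  refine ENNReal.ofReal_le_ofReal ?_
  calc ‖A‖ ^ 2 ≤ √(hsSq A).toReal ^ 2 := by gcongr
    _ = _ := Real.sq_sqrt ENNReal.toReal_nonneg

theorem hsSq_eq_ofReal_tsum {A : H →L[ℂ] H} (h : Summable fun i => ‖A (basis H i)‖ ^ 2) :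
    hsSq A = ENNReal.ofReal (∑' i, ‖A (basis H i)‖ ^ 2) := by
  rw [ENNReal.ofReal_tsum_of_nonneg (fun _ => by positivity) h]
  simp_rw [← enorm_sq_eq_ofReal]
  rfl

theorem summable_of_hsSq_lt_top {A : H →L[ℂ] H} (h : hsSq A < ∞) :
    Summable fun i => ‖A (basis H i)‖ ^ 2 := by
  have := ENNReal.summable_toReal h.ne
  simpa [ENNReal.toReal_pow] using this

theorem toReal_hsSq {A : H →L[ℂ] H} (h : hsSq A < ∞) :
    (hsSq A).toReal = ∑' i, ‖A (basis H i)‖ ^ 2 := by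
  rw [hsSq_eq_ofReal_tsum (summable_of_hsSq_lt_top h),
    ENNReal.toReal_ofReal (tsum_nonneg fun _ => by positivity)]

theorem tsum_enorm_inner_le (A B : H →L[ℂ] H) :
    ∑' i, ‖inner ℂ (A (basis H i)) (B (basis H i))‖ₑ ≤
      hsSq A ^ (1 / 2 : ℝ) * hsSq B ^ (1 / 2 : ℝ) := by
  rw [ENNReal.tsum_eq_iSup_sum]
  refine iSup_le fun s => ?_
  calc ∑ i ∈ s, ‖inner ℂ (A (basis H i)) (B (basis H i))‖ₑ
      ≤ ∑ i ∈ s, ‖A (basis H i)‖ₑ * ‖B (basis H i)‖ₑ :=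
        Finset.sum_le_sum fun i _ => enorm_inner_le_enorm _ _
    _ ≤ (∑ i ∈ s, ‖A (basis H i)‖ₑ ^ (2 : ℝ)) ^ (1 / 2 : ℝ) *
          (∑ i ∈ s, ‖B (basis H i)‖ₑ ^ (2 : ℝ)) ^ (1 / 2 : ℝ) :=
        ENNReal.inner_le_Lp_mul_Lq s _ _ Real.HolderConjugate.two_two
    _ ≤ _ := by
        simp_rw [ENNReal.rpow_two]
        gcongr
        · exact ENNReal.sum_le_tsum _
        · exact ENNReal.sum_le_tsum _

theorem re_inner_nonneg {T : H →L[ℂ] H} (hT : 0 ≤ T) (x : H) : 0 ≤ (inner ℂ x (T x)).re :=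
  ((ContinuousLinearMap.nonneg_iff_isPositive T).1 hT).re_inner_nonneg_right x

/-- An approximate polar decomposition. -/
theorem exists_norm_abs_sub_star_mul_le {A : Type*} [CStarAlgebra A] [PartialOrder A]
    [StarOrderedRing A] (c : A) {ε : ℝ} (hε : 0 < ε) :
    ∃ u : A, ‖u‖ ≤ 1 ∧ ‖CFC.abs c - star u * c‖ ≤ ε := by
  set B := CFC.abs c with hB
  have hB0 : 0 ≤ B := CFC.abs_nonneg c
  have hBsa : IsSelfAdjoint B := hB0.isSelfAdjoint
  have hpos : ∀ t : ℝ, 0 < |t| + ε := fun t => by positivity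
  have hcont : Continuous fun t : ℝ => (|t| + ε)⁻¹ :=
    (by fun_prop : Continuous fun t : ℝ => |t| + ε).inv₀ fun t => (hpos t).ne'
  have hcont2 : Continuous fun t : ℝ => t * t := by fun_prop
  have hcont3 : Continuous fun t : ℝ => (|t| + ε)⁻¹ * (t * t) := hcont.mul hcont2
  -- A regularised inverse of `B`, which need not be invertible: t / (t + ε) ≤ 1 keeps `c * R` a
  -- contraction, and t - t² / (t + ε) ≤ ε on the spectrum of `B`.
  set R := cfc (fun t : ℝ => (|t| + ε)⁻¹) B with hR
  have hRsa : IsSelfAdjoint R := cfc_predicate _ _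
  have hBB : star c * c = cfc (fun t : ℝ => t * t) B := by
    rw [cfc_mul (fun t : ℝ => t) (fun t : ℝ => t) B continuousOn_id continuousOn_id,
      cfc_id' ℝ B, ← CFC.abs_mul_abs]
  refine ⟨c * R, ?_, ?_⟩
  · have h1 : star (c * R) * (c * R) =
        cfc (fun t : ℝ => (|t| + ε)⁻¹ * (t * t) * (|t| + ε)⁻¹) B := by
      rw [cfc_mul (fun t : ℝ => (|t| + ε)⁻¹ * (t * t)) (fun t : ℝ => (|t| + ε)⁻¹) B
          hcont3.continuousOn hcont.continuousOn,
        cfc_mul (fun t : ℝ => (|t| + ε)⁻¹) (fun t : ℝ => t * t) B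
          hcont.continuousOn hcont2.continuousOn, ← hBB, star_mul, hRsa.star_eq]
      simp only [hR, mul_assoc]
    have h2 : ‖star (c * R) * (c * R)‖ ≤ 1 := by
      rw [h1]
      refine norm_cfc_le zero_le_one fun t _ => ?_
      have : (|t| + ε)⁻¹ * (t * t) * (|t| + ε)⁻¹ = (|t| * (|t| + ε)⁻¹) ^ 2 := by
        rw [← abs_mul_abs_self t]; ring
      rw [this, Real.norm_of_nonneg (by positivity)]
      refine pow_le_one₀ (by have := hpos t; positivity) ?_
      rw [← div_eq_mul_inv, div_le_one (hpos t)]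
      linarith
    rw [CStarRing.norm_star_mul_self] at h2
    nlinarith [norm_nonneg (c * R)]
  · have h1 : B - star (c * R) * c = cfc (fun t : ℝ => t - (|t| + ε)⁻¹ * (t * t)) B := by
      rw [cfc_sub (fun t : ℝ => t) (fun t : ℝ => (|t| + ε)⁻¹ * (t * t)) B
          continuousOn_id hcont3.continuousOn,
        cfc_mul (fun t : ℝ => (|t| + ε)⁻¹) (fun t : ℝ => t * t) B
          hcont.continuousOn hcont2.continuousOn, ← hBB, star_mul,
        hRsa.star_eq, cfc_id' ℝ B, mul_assoc]
    rw [h1]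
    refine norm_cfc_le hε.le fun t ht => ?_
    have ht0 : 0 ≤ t := spectrum_nonneg_of_nonneg hB0 ht
    have := hpos t
    rw [abs_of_nonneg ht0] at this ⊢
    have h3 : t - (t + ε)⁻¹ * (t * t) = ε * (t / (t + ε)) := by
      field_simp
      ring
    rw [h3, Real.norm_of_nonneg (by positivity)]
    have : t / (t + ε) ≤ 1 := by rw [div_le_one this]; linarith
    nlinarith

/-- A variational upper bound of the trace norm. -/
theorem traceNorm_le_of_forall {C : H →L[ℂ] H} {b : ℝ≥0∞}
    (h : ∀ W : H →L[ℂ] H, ‖W‖ ≤ 1 → ∑' i, ‖inner ℂ (W (basis H i)) (C (basis H i))‖ₑ ≤ b) :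
    traceNorm C ≤ b := by
  rw [traceNorm, ENNReal.tsum_eq_iSup_sum]
  refine iSup_le fun s => ?_
  -- The polar decomposition costs at most ε per basis vector. A partial sum involves only finitely
  -- many, so the error vanishes as ε → 0.
  have key : ∀ ε : ℝ, 0 < ε →
      ∑ i ∈ s, ENNReal.ofReal (inner ℂ (basis H i) (CFC.abs C (basis H i))).re ≤
        b + ENNReal.ofReal (s.card * ε) := by
    intro ε hε
    obtain ⟨W, hW, hdiff⟩ := exists_norm_abs_sub_star_mul_le C hε
    have hterm : ∀ i, ENNReal.ofReal (inner ℂ (basis H i) (CFC.abs C (basis H i))).re ≤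
        ‖inner ℂ (W (basis H i)) (C (basis H i))‖ₑ + ENNReal.ofReal ε := by
      intro i
      rw [← ofReal_norm, ← ENNReal.ofReal_add (norm_nonneg _) hε.le]
      refine ENNReal.ofReal_le_ofReal ?_
      have h1 : inner ℂ (basis H i) (CFC.abs C (basis H i)) =
          inner ℂ (W (basis H i)) (C (basis H i)) +
            inner ℂ (basis H i) ((CFC.abs C - star W * C) (basis H i)) := by
        rw [← ContinuousLinearMap.adjoint_inner_right, ← inner_add_right]
        simp [ContinuousLinearMap.star_eq_adjoint]
      have he : ‖basis H i‖ = 1 := (basis H).orthonormal.1 i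
      have h2 : ‖inner ℂ (basis H i) ((CFC.abs C - star W * C) (basis H i))‖ ≤ ε := by
        refine (norm_inner_le_norm _ _).trans ?_
        rw [he, one_mul]
        refine ((CFC.abs C - star W * C).le_opNorm _).trans ?_
        rwa [he, mul_one]
      rw [h1, Complex.add_re]
      exact add_le_add (Complex.re_le_norm _) ((Complex.re_le_norm _).trans h2)
    calc ∑ i ∈ s, ENNReal.ofReal (inner ℂ (basis H i) (CFC.abs C (basis H i))).re
        ≤ ∑ i ∈ s, (‖inner ℂ (W (basis H i)) (C (basis H i))‖ₑ + ENNReal.ofReal ε) :=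
          Finset.sum_le_sum fun i _ => hterm i
      _ ≤ b + ENNReal.ofReal (s.card * ε) := by
          rw [Finset.sum_add_distrib]
          refine add_le_add ((ENNReal.sum_le_tsum _).trans (h _ hW)) ?_
          rw [Finset.sum_const, ENNReal.ofReal_mul (by positivity), ENNReal.ofReal_natCast,
            nsmul_eq_mul]
  have hlim : Tendsto (fun ε : ℝ => b + ENNReal.ofReal (s.card * ε)) (𝓝[>] 0) (𝓝 (b + 0)) := by
    refine tendsto_const_nhds.add ?_
    have : Tendsto (fun ε : ℝ => ENNReal.ofReal (s.card * ε)) (𝓝 0)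
        (𝓝 (ENNReal.ofReal (s.card * 0))) :=
      (ENNReal.continuous_ofReal.comp (continuous_const.mul continuous_id)).tendsto 0
    rw [mul_zero, ENNReal.ofReal_zero] at this
    exact this.mono_left nhdsWithin_le_nhds
  rw [add_zero] at hlim
  exact ge_of_tendsto hlim (eventually_nhdsWithin_of_forall fun ε hε => key ε hε)

theorem traceNorm_eq_of_nonneg {A : H →L[ℂ] H} (hA : 0 ≤ A) :
    traceNorm A = ∑' i, ENNReal.ofReal (inner ℂ (basis H i) (A (basis H i))).re := by
  rw [traceNorm, CFC.abs_of_nonneg A hA]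

theorem inner_star_mul_self (X : H →L[ℂ] H) (x : H) :
    inner ℂ x ((star X * X) x) = ((‖X x‖ ^ 2 : ℝ) : ℂ) := by
  rw [mul_apply_eq_comp, ContinuousLinearMap.star_eq_adjoint,
    ContinuousLinearMap.adjoint_inner_right, inner_self_eq_norm_sq_to_K]
  simp

theorem traceNorm_star_mul_self (X : H →L[ℂ] H) : traceNorm (star X * X) = hsSq X := by
  rw [traceNorm_eq_of_nonneg (star_mul_self_nonneg X)]
  simp_rw [inner_star_mul_self, Complex.ofReal_re, ← enorm_sq_eq_ofReal]
  rfl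

theorem trace_star_mul_self (X : H →L[ℂ] H) :
    trace (star X * X) = ((∑' i, ‖X (basis H i)‖ ^ 2 : ℝ) : ℂ) := by
  simp_rw [trace, inner_star_mul_self, Complex.ofReal_tsum]

/-- The operators |C| - C and |C| + C are twice the negative and positive parts of `C`, hence
nonnegative. -/
theorem abs_re_inner_le {C : H →L[ℂ] H} (hC : IsSelfAdjoint C) (x : H) :
    |(inner ℂ x (C x)).re| ≤ (inner ℂ x (CFC.abs C x)).re := by
  have h1 := re_inner_nonneg (smul_nonneg (zero_le_two : (0 : ℝ) ≤ 2) (CFC.negPart_nonneg C)) x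
  have h2 := re_inner_nonneg (smul_nonneg (zero_le_two : (0 : ℝ) ≤ 2) (CFC.posPart_nonneg C)) x
  have e1 : (2 : ℝ) • C⁻ = CFC.abs C - C := by rw [CFC.abs_sub_self C hC]; norm_num [two_smul]
  have e2 : (2 : ℝ) • C⁺ = CFC.abs C + C := by rw [CFC.abs_add_self C hC]; norm_num [two_smul]
  rw [e1] at h1
  rw [e2] at h2
  simp only [sub_apply, add_apply, inner_sub_right,
    inner_add_right, Complex.sub_re, Complex.add_re] at h1 h2
  rw [abs_le]
  constructor <;> linarith

/-- With T = |C|, the trace norm is the squared Hilbert–Schmidt norm of √T, while ‖C‖ = ‖√T‖². -/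
theorem enorm_le_traceNorm (C : H →L[ℂ] H) : ‖C‖ₑ ≤ traceNorm C := by
  set T := CFC.abs C with hT
  have hT0 : 0 ≤ T := CFC.abs_nonneg C
  have hs : star (CFC.sqrt T) * CFC.sqrt T = T := by
    rw [(CFC.sqrt_nonneg T).isSelfAdjoint.star_eq, CFC.sqrt_mul_sqrt_self T hT0]
  have h1 : traceNorm C = hsSq (CFC.sqrt T) := by
    rw [← traceNorm_star_mul_self, hs, traceNorm_eq_of_nonneg hT0]
    rfl
  have h2 : ‖C‖ = ‖CFC.sqrt T‖ ^ 2 := by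
    rw [← CFC.norm_abs (a := C), ← hT]
    conv_lhs => rw [← hs, CStarRing.norm_star_mul_self, ← sq]
  rw [h1, ← ofReal_norm, h2, ← enorm_sq_eq_ofReal]
  exact enorm_sq_le_hsSq _

/-- Pointwise convergence and convergence of the norms imply convergence in `ℓ²`. -/
theorem tendsto_tsum_norm_sub_sq {ι : Type*} {a : ℕ → ι → H} {a' : ι → H}
    (hs : ∀ n, Summable fun i => ‖a n i‖ ^ 2) (hs' : Summable fun i => ‖a' i‖ ^ 2)
    (h : ∀ i, Tendsto (fun n => a n i) atTop (𝓝 (a' i)))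
    (hn : Tendsto (fun n => ∑' i, ‖a n i‖ ^ 2) atTop (𝓝 (∑' i, ‖a' i‖ ^ 2))) :
    Tendsto (fun n => ∑' i, ‖a n i - a' i‖ ^ 2) atTop (𝓝 0) := by
  classical
  set T := ∑' i, ‖a' i‖ ^ 2 with hT
  rw [Metric.tendsto_atTop']
  intro ε hε
  -- The sum over `s` costs δ, the tail of `a n` at most 2·2δ and the tail of `a'` at most 2·δ,
  -- together below 10δ = ε / 2.
  set δ := ε / 20 with hδ
  have hδ0 : 0 < δ := by positivity
  obtain ⟨s, hsT⟩ := (hs'.hasSum.eventually_const_lt (show T - δ < T by linarith)).exists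
  have h1 : Tendsto (fun n => ∑ i ∈ s, ‖a n i‖ ^ 2) atTop (𝓝 (∑ i ∈ s, ‖a' i‖ ^ 2)) :=
    tendsto_finsetSum _ fun i _ => (h i).norm.pow 2
  have h2 : Tendsto (fun n => ∑ i ∈ s, ‖a n i - a' i‖ ^ 2) atTop (𝓝 0) := by
    have := tendsto_finsetSum s fun i _ => (((h i).sub_const (a' i)).norm.pow 2)
    simpa using this
  obtain ⟨N, hN⟩ := eventually_atTop.1 ((h1.eventually_const_lt hsT).and
    ((h2.eventually_lt_const hδ0).and (hn.eventually_lt_const (show T < T + δ by linarith))))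
  refine ⟨N, fun n hnN => ?_⟩
  obtain ⟨g1, g2, g3⟩ := hN n hnN.le
  have hle : ∑' i, ‖a n i - a' i‖ ^ 2 ≤ 10 * δ := by
    refine Real.tsum_le_of_sum_le (fun _ => by positivity) fun t => ?_
    have hb : ∀ i, ‖a n i - a' i‖ ^ 2 ≤ 2 * ‖a n i‖ ^ 2 + 2 * ‖a' i‖ ^ 2 := fun i => by
      have := norm_sub_le (a n i) (a' i)
      nlinarith [norm_nonneg (a n i - a' i), norm_nonneg (a n i), norm_nonneg (a' i),
        sq_nonneg (‖a n i‖ - ‖a' i‖)]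
    have hd : Disjoint s (t \ s) := Finset.disjoint_sdiff
    have k1 := (hs n).sum_le_tsum (s ∪ t \ s) fun _ _ => by positivity
    have k2 := hs'.sum_le_tsum (s ∪ t \ s) fun _ _ => by positivity
    rw [Finset.sum_union hd] at k1 k2
    have k3 : ∑ i ∈ t \ s, ‖a n i - a' i‖ ^ 2 ≤
        2 * ∑ i ∈ t \ s, ‖a n i‖ ^ 2 + 2 * ∑ i ∈ t \ s, ‖a' i‖ ^ 2 := by
      rw [Finset.mul_sum, Finset.mul_sum, ← Finset.sum_add_distrib]
      exact Finset.sum_le_sum fun i _ => hb i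
    have k4 : ∑ i ∈ t, ‖a n i - a' i‖ ^ 2 ≤ ∑ i ∈ s ∪ t \ s, ‖a n i - a' i‖ ^ 2 :=
      Finset.sum_le_sum_of_subset_of_nonneg
        (by rw [Finset.union_sdiff_self_eq_union]; exact Finset.subset_union_right)
        fun _ _ _ => by positivity
    rw [Finset.sum_union hd] at k4
    linarith
  rw [Real.dist_eq, sub_zero, abs_of_nonneg (tsum_nonneg fun _ => by positivity)]
  linarith

/-- The Radon–Riesz property, applied to the columns of the operators. -/
theorem tendsto_hsSq_sub {A : ℕ → H →L[ℂ] H} {A' : H →L[ℂ] H} (hA : ∀ n, hsSq (A n) < ∞)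
    (hA' : hsSq A' < ∞) (h : ∀ x, Tendsto (fun n => A n x) atTop (𝓝 (A' x)))
    (hn : Tendsto (fun n => (hsSq (A n)).toReal) atTop (𝓝 (hsSq A').toReal)) :
    Tendsto (fun n => hsSq (A n - A')) atTop (𝓝 0) := by
  have hs := fun n => summable_of_hsSq_lt_top (hA n)
  have hs' := summable_of_hsSq_lt_top hA'
  simp_rw [toReal_hsSq (hA _), toReal_hsSq hA'] at hn
  have hlim := ENNReal.tendsto_ofReal (tendsto_tsum_norm_sub_sq hs hs' (fun i => h _) hn)
  rw [ENNReal.ofReal_zero] at hlim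
  refine hlim.congr fun n => ?_
  refine (hsSq_eq_ofReal_tsum (A := A n - A') ?_).symm
  refine .of_nonneg_of_le (fun _ => by positivity) (fun i => ?_)
    (((hs n).mul_left 2).add (hs'.mul_left 2))
  have := norm_sub_le (A n (basis H i)) (A' (basis H i))
  rw [sub_apply]
  nlinarith [norm_nonneg (A n (basis H i) - A' (basis H i)), norm_nonneg (A n (basis H i)),
    norm_nonneg (A' (basis H i)), sq_nonneg (‖A n (basis H i)‖ - ‖A' (basis H i)‖)]

/-- Moving `star X` across the inner product turns the matrix entries into ⟨X e_i, Y e_j⟩. This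
brings Fredholm determinants under the Gram minor estimates. -/
theorem fredholmDet_star_mul (X Y : H →L[ℂ] H) :
    fredholmDet (star X * Y) =
      ∑' S, gramMinor (fun i => X (basis H i)) (fun i => Y (basis H i)) S := by
  refine tsum_congr fun S => ?_
  rw [gramMinor]
  congr 1
  ext i j
  simp [ContinuousLinearMap.star_eq_adjoint, ContinuousLinearMap.adjoint_inner_right]

theorem summable_norm_mul_norm {X Y : H →L[ℂ] H} (hX : hsSq X < ∞) (hY : hsSq Y < ∞) :
    Summable fun i => ‖X (basis H i)‖ * ‖Y (basis H i)‖ := by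
  refine .of_nonneg_of_le (fun _ => by positivity) (fun i => ?_)
    ((summable_of_hsSq_lt_top hX).add (summable_of_hsSq_lt_top hY))
  nlinarith [sq_nonneg (‖X (basis H i)‖ - ‖Y (basis H i)‖), norm_nonneg (X (basis H i)),
    norm_nonneg (Y (basis H i)), mul_nonneg (norm_nonneg (X (basis H i))) (norm_nonneg (Y (basis H i)))]

/-- Continuity of the Fredholm determinant of products of Hilbert–Schmidt operators. -/
theorem tendsto_fredholmDet {X Y : ℕ → H →L[ℂ] H} {X' Y' : H →L[ℂ] H} (hX' : hsSq X' < ∞)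
    (hY' : hsSq Y' < ∞) (hX : Tendsto (fun n => hsSq (X n - X')) atTop (𝓝 0))
    (hY : Tendsto (fun n => hsSq (Y n - Y')) atTop (𝓝 0)) :
    Tendsto (fun n => fredholmDet (star (X n) * Y n)) atTop (𝓝 (fredholmDet (star X' * Y'))) := by
  simp_rw [fredholmDet_star_mul]
  have aux : ∀ {Z : ℕ → H →L[ℂ] H} {Z' : H →L[ℂ] H},
      Tendsto (fun n => hsSq (Z n - Z')) atTop (𝓝 0) →
      (∀ᶠ n in atTop, Summable fun i => ‖Z n (basis H i) - Z' (basis H i)‖ ^ 2) ∧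
      Tendsto (fun n => ∑' i, ‖Z n (basis H i) - Z' (basis H i)‖ ^ 2) atTop (𝓝 0) := by
    intro Z Z' hZ
    have hfin : ∀ᶠ n in atTop, hsSq (Z n - Z') < ∞ := hZ.eventually_lt_const ENNReal.zero_lt_top
    refine ⟨hfin.mono fun n hn => summable_of_hsSq_lt_top (A := Z n - Z') hn, ?_⟩
    have := (ENNReal.tendsto_toReal ENNReal.zero_ne_top).comp hZ
    rw [ENNReal.toReal_zero] at this
    refine this.congr' (hfin.mono fun n hn => ?_)
    exact toReal_hsSq (A := Z n - Z') hn
  exact tendsto_tsum_gramMinor_of_l2 (summable_of_hsSq_lt_top hX') (summable_of_hsSq_lt_top hY')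
    (aux hX).1 (aux hY).1 (aux hX).2 (aux hY).2

end HilbertSchmidt

/-! ### Multiplication operators. -/

section MulOp

variable {E : Type*} [MeasurableSpace E] {μ : Measure E}

theorem memLp_top_of_measurable {f : E → ℂ} (hf : Measurable f) {C : ℝ} (hC : ∀ x, ‖f x‖ ≤ C) :
    MemLp f ∞ μ :=
  memLp_top_of_bound hf.aestronglyMeasurable C (ae_of_all _ hC)

theorem mulOp_mul {f g : E → ℂ} (hf : MemLp f ∞ μ) (hg : MemLp g ∞ μ)
    (hfg : MemLp (fun x => f x * g x) ∞ μ) :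
    mulOp μ f * mulOp μ g = mulOp μ fun x => f x * g x := by
  ext1 φ
  refine Lp.ext ?_
  filter_upwards [coeFn_mulOp μ hf (mulOp μ g φ), coeFn_mulOp μ hg φ, coeFn_mulOp μ hfg φ]
    with x h1 h2 h3
  rw [mul_apply_eq_comp, h1, h2, h3, mul_assoc]

theorem mulOp_sub {f g : E → ℂ} (hf : MemLp f ∞ μ) (hg : MemLp g ∞ μ) :
    mulOp μ f - mulOp μ g = mulOp μ fun x => f x - g x := by
  ext1 φ
  refine Lp.ext ?_
  filter_upwards [coeFn_mulOp μ hf φ, coeFn_mulOp μ hg φ, coeFn_mulOp μ (hf.sub hg) φ,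
    Lp.coeFn_sub (mulOp μ f φ) (mulOp μ g φ)] with x h1 h2 h3 h4
  rw [sub_apply, h4, Pi.sub_apply, h1, h2, ← sub_mul]
  exact h3.symm

theorem mulOp_add {f g : E → ℂ} (hf : MemLp f ∞ μ) (hg : MemLp g ∞ μ) :
    mulOp μ f + mulOp μ g = mulOp μ fun x => f x + g x := by
  ext1 φ
  refine Lp.ext ?_
  filter_upwards [coeFn_mulOp μ hf φ, coeFn_mulOp μ hg φ, coeFn_mulOp μ (hf.add hg) φ,
    Lp.coeFn_add (mulOp μ f φ) (mulOp μ g φ)] with x h1 h2 h3 h4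
  rw [add_apply, h4, Pi.add_apply, h1, h2, ← add_mul]
  exact h3.symm

theorem mulOp_one : mulOp μ (fun _ => (1 : ℂ)) = 1 := by
  have h : MemLp (fun _ : E => (1 : ℂ)) ∞ μ :=
    memLp_top_of_measurable measurable_const (C := 1) fun _ => by simp
  ext1 φ
  refine Lp.ext ?_
  filter_upwards [coeFn_mulOp μ h φ] with x h1
  simp [h1]

theorem star_mulOp {f : E → ℂ} (hf : MemLp f ∞ μ) (hf' : MemLp (fun x => star (f x)) ∞ μ) :
    star (mulOp μ f) = mulOp μ fun x => star (f x) := by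
  rw [ContinuousLinearMap.star_eq_adjoint, eq_comm, ContinuousLinearMap.eq_adjoint_iff]
  intro φ ψ
  rw [L2.inner_def, L2.inner_def]
  refine integral_congr_ae ?_
  filter_upwards [coeFn_mulOp μ hf' φ, coeFn_mulOp μ hf ψ] with x h1 h2
  rw [h1, h2]
  simp only [RCLike.inner_apply, map_mul, starRingEnd_apply, star_star]
  ring

theorem norm_mulOp_apply_le {f : E → ℂ} (hf : Measurable f) {C : ℝ} (hC : ∀ x, ‖f x‖ ≤ C)
    (φ : L2 μ) : ‖mulOp μ f φ‖ ≤ C * ‖φ‖ := by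
  refine Lp.norm_le_mul_norm_of_ae_le_mul ?_
  filter_upwards [coeFn_mulOp μ (memLp_top_of_measurable hf hC) φ] with x hx
  rw [hx, norm_mul]
  exact mul_le_mul_of_nonneg_right (hC x) (norm_nonneg _)

theorem norm_mulOp_le {f : E → ℂ} (hf : Measurable f) {C : ℝ} (hC0 : 0 ≤ C)
    (hC : ∀ x, ‖f x‖ ≤ C) : ‖mulOp μ f‖ ≤ C :=
  (mulOp μ f).opNorm_le_bound hC0 (norm_mulOp_apply_le hf hC)

/-- Bounded pointwise convergence of functions implies strong convergence of the multiplication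
operators. -/
theorem tendsto_mulOp_apply {f : ℕ → E → ℂ} {f' : E → ℂ} (hf : ∀ n, Measurable (f n))
    (hf' : Measurable f') {C : ℝ} (hC : ∀ n x, ‖f n x‖ ≤ C) (hC' : ∀ x, ‖f' x‖ ≤ C)
    (h : ∀ x, Tendsto (fun n => f n x) atTop (𝓝 (f' x))) (φ : L2 μ) :
    Tendsto (fun n => mulOp μ (f n) φ) atTop (𝓝 (mulOp μ f' φ)) := by
  have hm := fun n => memLp_top_of_measurable (μ := μ) (hf n) (hC n)
  have hm' := memLp_top_of_measurable (μ := μ) hf' hC'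
  rw [tendsto_iff_norm_sub_tendsto_zero]
  have hkey : Tendsto (fun n => inner ℂ ((mulOp μ (f n) - mulOp μ f') φ)
      ((mulOp μ (f n) - mulOp μ f') φ)) atTop (𝓝 0) := by
    simp_rw [L2.inner_def]
    rw [← integral_zero E ℂ]
    refine tendsto_integral_of_dominated_convergence (fun x => (2 * C) ^ 2 * ‖φ x‖ ^ 2)
      (fun n => (L2.integrable_inner (𝕜 := ℂ) _ _).aestronglyMeasurable) ?_ (fun n => ?_) ?_
    · exact ((memLp_two_iff_integrable_sq_norm (Lp.aestronglyMeasurable φ)).1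
        (Lp.memLp φ)).const_mul _
    · rw [mulOp_sub (hm n) hm']
      filter_upwards [coeFn_mulOp μ ((hm n).sub hm') φ] with x hx
      have hx' : (mulOp μ (fun x => f n x - f' x) φ : E → ℂ) x = (f n x - f' x) * φ x := hx
      rw [hx']
      have h1 : ‖f n x - f' x‖ ≤ 2 * C :=
        (norm_sub_le _ _).trans (by linarith [hC n x, hC' x])
      have h2 : ‖(f n x - f' x) * φ x‖ ≤ 2 * C * ‖φ x‖ := by
        rw [norm_mul]; gcongr
      calc _ ≤ ‖(f n x - f' x) * φ x‖ * ‖(f n x - f' x) * φ x‖ := norm_inner_le_norm _ _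
        _ ≤ (2 * C * ‖φ x‖) * (2 * C * ‖φ x‖) :=
          mul_le_mul h2 h2 (norm_nonneg _) ((norm_nonneg _).trans h2)
        _ = _ := by ring
    · have hall : ∀ᵐ x ∂μ, ∀ n, ((mulOp μ (f n) - mulOp μ f') φ : E → ℂ) x =
          (f n x - f' x) * φ x := by
        rw [ae_all_iff]
        intro n
        rw [mulOp_sub (hm n) hm']
        exact coeFn_mulOp μ ((hm n).sub hm') φ
      filter_upwards [hall] with x hx
      simp_rw [hx]
      have h1 : Tendsto (fun n => (f n x - f' x) * φ x) atTop (𝓝 0) := by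
        simpa using ((h x).sub_const (f' x)).mul_const (φ x)
      simpa using h1.inner (𝕜 := ℂ) h1
  have h2 : Tendsto (fun n => ‖mulOp μ (f n) φ - mulOp μ f' φ‖ ^ 2) atTop (𝓝 0) := by
    have := (Complex.continuous_re.tendsto _).comp hkey
    rw [Complex.zero_re] at this
    refine this.congr fun n => ?_
    exact inner_self_eq_norm_sq (𝕜 := ℂ) _
  simpa using h2.sqrt

theorem measurable_indicator_one {B : Set E} (hB : MeasurableSet B) :
    Measurable (B.indicator fun _ => (1 : ℂ)) :=
  measurable_const.indicator hB

theorem norm_indicator_one_le (B : Set E) (x : E) : ‖B.indicator (fun _ => (1 : ℂ)) x‖ ≤ 1 := by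
  by_cases h : x ∈ B <;> simp [h]

theorem memLp_indicator_one {B : Set E} (hB : MeasurableSet B) :
    MemLp (B.indicator fun _ => (1 : ℂ)) ∞ μ :=
  memLp_top_of_measurable (measurable_indicator_one hB) (norm_indicator_one_le B)

theorem norm_chi_le {B : Set E} (hB : MeasurableSet B) : ‖chi μ B‖ ≤ 1 :=
  norm_mulOp_le (measurable_indicator_one hB) zero_le_one (norm_indicator_one_le B)

theorem star_chi {B : Set E} (hB : MeasurableSet B) : star (chi μ B) = chi μ B := by
  have h : (fun x => star (B.indicator (fun _ => (1 : ℂ)) x)) = B.indicator fun _ => (1 : ℂ) := by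
    ext x
    by_cases hx : x ∈ B <;> simp [hx]
  rw [chi, star_mulOp (memLp_indicator_one hB) (by rw [h]; exact memLp_indicator_one hB), h]

theorem chi_mul_mulOp {B : Set E} (hB : MeasurableSet B) {f : E → ℂ} (hf : MemLp f ∞ μ)
    (h0 : ∀ x ∉ B, f x = 0) : chi μ B * mulOp μ f = mulOp μ f := by
  have h : (fun x => B.indicator (fun _ => (1 : ℂ)) x * f x) = f := by
    ext x
    by_cases hx : x ∈ B <;> simp [hx, h0]
  rw [chi, mulOp_mul (memLp_indicator_one hB) hf (by rwa [h]), h]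

theorem mulOp_comm {f g : E → ℂ} (hf : MemLp f ∞ μ) (hg : MemLp g ∞ μ)
    (hfg : MemLp (fun x => f x * g x) ∞ μ) : mulOp μ f * mulOp μ g = mulOp μ g * mulOp μ f := by
  have h : (fun x => f x * g x) = fun x => g x * f x := funext fun x => mul_comm _ _
  rw [mulOp_mul hf hg hfg, mulOp_mul hg hf (by rwa [h] at hfg), h]

theorem mulOp_mul_chi {B : Set E} (hB : MeasurableSet B) {f : E → ℂ} (hf : MemLp f ∞ μ)
    (h0 : ∀ x ∉ B, f x = 0) : mulOp μ f * chi μ B = mulOp μ f := by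
  have h : (fun x => f x * B.indicator (fun _ => (1 : ℂ)) x) = f := by
    ext x
    by_cases hx : x ∈ B <;> simp [hx, h0]
  rw [chi, mulOp_mul hf (memLp_indicator_one hB) (by rwa [h]), h]

theorem star_mulReal {f : E → ℝ} (hf : Measurable f) {C : ℝ} (hC : ∀ x, |f x| ≤ C) :
    star (mulReal μ f) = mulReal μ f := by
  have h1 : MemLp (fun x => (f x : ℂ)) ∞ μ :=
    memLp_top_of_measurable (Complex.measurable_ofReal.comp hf) (C := C) fun x => by
      simpa using hC x
  have h : (fun x => star ((f x : ℂ))) = fun x => (f x : ℂ) := by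
    ext x
    exact Complex.conj_ofReal _
  rw [mulReal, star_mulOp h1 (by rwa [h]), h]

/-- Bounded pointwise convergence of functions supported in a set on which the operator is
Hilbert–Schmidt implies convergence in the Hilbert–Schmidt norm. -/
theorem tendsto_hsSq_mulOp_mul {f : ℕ → E → ℂ} {f' : E → ℂ} (hf : ∀ n, Measurable (f n))
    (hf' : Measurable f') {C : ℝ} (hC : ∀ n x, ‖f n x‖ ≤ C) (hC' : ∀ x, ‖f' x‖ ≤ C)
    (h : ∀ x, Tendsto (fun n => f n x) atTop (𝓝 (f' x))) {B : Set E} (hB : MeasurableSet B)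
    (h0 : ∀ n, ∀ x ∉ B, f n x = 0) (h0' : ∀ x ∉ B, f' x = 0) {K : L2 μ →L[ℂ] L2 μ}
    (hK : hsSq (chi μ B * K) < ∞) :
    Tendsto (fun n => hsSq (mulOp μ (f n) * K - mulOp μ f' * K)) atTop (𝓝 0) := by
  have hm := fun n => memLp_top_of_measurable (μ := μ) (hf n) (hC n)
  have hm' := memLp_top_of_measurable (μ := μ) hf' hC'
  have hs := summable_of_hsSq_lt_top hK
  have hbound : ∀ n (x : L2 μ), ‖(mulOp μ (f n) * K - mulOp μ f' * K) x‖ ^ 2 ≤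
      (2 * C) ^ 2 * ‖(chi μ B * K) x‖ ^ 2 := by
    intro n x
    have e : mulOp μ (f n) * K - mulOp μ f' * K =
        mulOp μ (fun x => f n x - f' x) * (chi μ B * K) := by
      rw [← sub_mul, mulOp_sub (hm n) hm', ← mul_assoc,
        mulOp_mul_chi (f := fun x => f n x - f' x) hB ((hm n).sub hm')
          fun x hx => by simp [h0 n x hx, h0' x hx]]
    rw [e, ← mul_pow]
    refine pow_le_pow_left₀ (norm_nonneg _) ?_ 2
    exact norm_mulOp_apply_le ((hf n).sub hf')
      (fun y => (norm_sub_le _ _).trans (by linarith [hC n y, hC' y])) _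
  have hlim : Tendsto (fun n => ∑' i, ‖(mulOp μ (f n) * K - mulOp μ f' * K)
      (basis (L2 μ) i)‖ ^ 2) atTop (𝓝 (∑' _ : BasisIndex (L2 μ), 0)) := by
    refine tendsto_tsum_of_dominated_convergence (hs.mul_left ((2 * C) ^ 2)) (fun i => ?_)
      (.of_forall fun n i => ?_)
    · have := ((tendsto_mulOp_apply hf hf' hC hC' h (K (basis (L2 μ) i))).sub_const
        (mulOp μ f' (K (basis (L2 μ) i)))).norm.pow 2
      simpa using this
    · rw [Real.norm_of_nonneg (by positivity)]
      exact hbound n _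
  rw [tsum_zero] at hlim
  have := ENNReal.tendsto_ofReal hlim
  rw [ENNReal.ofReal_zero] at this
  refine this.congr fun n => (hsSq_eq_ofReal_tsum ?_).symm
  exact .of_nonneg_of_le (fun _ => by positivity) (fun i => hbound n _) (hs.mul_left _)

end MulOp

/-! ### Orthogonal projections, trace norm estimates and compressed inverses. -/

section Projections

variable {H : Type*} [NormedAddCommGroup H] [InnerProductSpace ℂ H] [CompleteSpace H]

theorem norm_le_one_of_isStarProjection {P : H →L[ℂ] H} (hP : IsStarProjection P) : ‖P‖ ≤ 1 := by
  have h : ‖P‖ * ‖P‖ = ‖P‖ := by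
    conv_rhs => rw [← hP.isIdempotentElem.eq]
    rw [← CStarRing.norm_star_mul_self, hP.isSelfAdjoint.star_eq]
  nlinarith [norm_nonneg P]

theorem inner_isStarProjection {P : H →L[ℂ] H} (hP : IsStarProjection P) (x y : H) :
    inner ℂ (P x) (P y) = inner ℂ x (P y) := by
  rw [← ContinuousLinearMap.adjoint_inner_right, ← ContinuousLinearMap.star_eq_adjoint,
    hP.isSelfAdjoint.star_eq, ← mul_apply_eq_comp, hP.isIdempotentElem.eq]

/-- Weak convergence of orthogonal projections implies strong convergence. -/
theorem tendsto_of_weak {Pn : ℕ → H →L[ℂ] H} {P : H →L[ℂ] H} (hPn : ∀ n, IsStarProjection (Pn n))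
    (hP : IsStarProjection P)
    (h : ∀ x y, Tendsto (fun n => inner ℂ x ((Pn n - P) y)) atTop (𝓝 0)) (x : H) :
    Tendsto (fun n => Pn n x) atTop (𝓝 (P x)) := by
  rw [tendsto_iff_norm_sub_tendsto_zero]
  -- For projections ‖Pn x‖² = ⟨x, Pn x⟩, so the square expands into matrix coefficients of Pn - P
  -- alone.
  have key : ∀ n, inner ℂ (Pn n x - P x) (Pn n x - P x) =
      inner ℂ x ((Pn n - P) x) - inner ℂ x ((Pn n - P) (P x)) -
        inner ℂ (P x) ((Pn n - P) x) := by
    intro n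
    have hPP : P (P x) = P x := by
      rw [← mul_apply_eq_comp, hP.isIdempotentElem.eq]
    have h1 : inner ℂ (Pn n x) (P x) = inner ℂ x (Pn n (P x)) := by
      rw [← ContinuousLinearMap.adjoint_inner_right, ← ContinuousLinearMap.star_eq_adjoint,
        (hPn n).isSelfAdjoint.star_eq]
    simp only [sub_apply, inner_sub_left, inner_sub_right, inner_isStarProjection (hPn n),
      inner_isStarProjection hP, h1, hPP]
    ring
  have h2 : Tendsto (fun n => inner ℂ (Pn n x - P x) (Pn n x - P x)) atTop (𝓝 0) := by
    simp_rw [key]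
    simpa using ((h x x).sub (h x (P x))).sub (h (P x) x)
  have h3 : Tendsto (fun n => ‖Pn n x - P x‖ ^ 2) atTop (𝓝 0) := by
    have := (Complex.continuous_re.tendsto _).comp h2
    rw [Complex.zero_re] at this
    exact this.congr fun n => inner_self_eq_norm_sq (𝕜 := ℂ) _
  simpa using h3.sqrt

theorem hsSq_add_le (A B : H →L[ℂ] H) : hsSq (A + B) ≤ 2 * hsSq A + 2 * hsSq B := by
  rw [hsSq, hsSq, hsSq, ← ENNReal.tsum_mul_left, ← ENNReal.tsum_mul_left, ← ENNReal.tsum_add]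
  refine ENNReal.tsum_le_tsum fun i => ?_
  have h := ENNReal.rpow_add_le_mul_rpow_add_rpow ‖A (basis H i)‖ₑ ‖B (basis H i)‖ₑ one_le_two
  norm_num [ENNReal.rpow_two, mul_add] at h
  refine le_trans ?_ h
  gcongr
  exact enorm_add_le _ _

theorem tendsto_hsSq_mul_of_tendsto {T : ℕ → H →L[ℂ] H} {T' : H →L[ℂ] H}
    {Y : ℕ → H →L[ℂ] H} {Y' : H →L[ℂ] H} (hT : Tendsto T atTop (𝓝 T')) (hY' : hsSq Y' < ∞)
    (hY : Tendsto (fun n => hsSq (Y n - Y')) atTop (𝓝 0)) :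
    Tendsto (fun n => hsSq (T n * Y n - T' * Y')) atTop (𝓝 0) := by
  have hb : ∀ n, hsSq (T n * Y n - T' * Y') ≤
      2 * (‖T n‖ₑ ^ 2 * hsSq (Y n - Y')) + 2 * (‖T n - T'‖ₑ ^ 2 * hsSq Y') := fun n => by
    have e : T n * Y n - T' * Y' = T n * (Y n - Y') + (T n - T') * Y' := by
      rw [mul_sub, sub_mul]; abel
    rw [e]
    exact (hsSq_add_le _ _).trans (by gcongr <;> exact hsSq_mul_le _ _)
  have h1 : Tendsto (fun n => 2 * (‖T n‖ₑ ^ 2 * hsSq (Y n - Y'))) atTop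
      (𝓝 (2 * (‖T'‖ₑ ^ 2 * 0))) := by
    refine ENNReal.Tendsto.const_mul (ENNReal.Tendsto.mul (ENNReal.Tendsto.pow hT.enorm)
      (.inr (by simp)) hY (.inr (by simp))) (.inr (by simp))
  have h2 : Tendsto (fun n => 2 * (‖T n - T'‖ₑ ^ 2 * hsSq Y')) atTop
      (𝓝 (2 * (‖(0 : H →L[ℂ] H)‖ₑ ^ 2 * hsSq Y'))) := by
    have h3 : Tendsto (fun n => T n - T') atTop (𝓝 0) := by simpa using hT.sub_const T'
    exact ENNReal.Tendsto.const_mul (ENNReal.Tendsto.mul_const (ENNReal.Tendsto.pow h3.enorm)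
      (.inr hY'.ne)) (.inr (by simp))
  have h4 := h1.add h2
  simp only [enorm_zero, mul_zero, ne_eq, OfNat.ofNat_ne_zero, not_false_eq_true, zero_pow,
    zero_mul, add_zero] at h4
  exact tendsto_of_tendsto_of_tendsto_of_le_of_le tendsto_const_nhds h4 (fun _ => zero_le) hb

/-- The inner products equal ⟨A W e_i, B e_i⟩. Cauchy–Schwarz applies, and a contraction on the
right does not increase the Hilbert–Schmidt norm. -/
theorem tsum_enorm_inner_star_mul_le (A B W : H →L[ℂ] H) (hW : ‖W‖ ≤ 1) :
    ∑' i, ‖inner ℂ (W (basis H i)) ((star A * B) (basis H i))‖ₑ ≤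
      hsSq A ^ (1 / 2 : ℝ) * hsSq B ^ (1 / 2 : ℝ) := by
  have h1 : ∀ i, inner ℂ (W (basis H i)) ((star A * B) (basis H i)) =
      inner ℂ ((A * W) (basis H i)) (B (basis H i)) := fun i => by
    rw [mul_apply_eq_comp, ContinuousLinearMap.star_eq_adjoint,
      ContinuousLinearMap.adjoint_inner_right]
    rfl
  simp_rw [h1]
  refine (tsum_enorm_inner_le _ _).trans ?_
  gcongr
  refine (hsSq_mul_le' A W).trans (mul_le_of_le_one_left' ?_)
  refine pow_le_one₀ zero_le ?_
  rw [← ofReal_norm]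
  exact ENNReal.ofReal_le_one.2 hW

theorem traceNorm_star_mul_le (A B : H →L[ℂ] H) :
    traceNorm (star A * B) ≤ hsSq A ^ (1 / 2 : ℝ) * hsSq B ^ (1 / 2 : ℝ) :=
  traceNorm_le_of_forall fun W hW => tsum_enorm_inner_star_mul_le A B W hW

/-- Convergence of the factors in the Hilbert–Schmidt norm implies convergence of the product in
the trace norm. -/
theorem tendsto_traceNorm_sub {Y Z : ℕ → H →L[ℂ] H} {Y' Z' : H →L[ℂ] H} (hY' : hsSq Y' < ∞)
    (hZ' : hsSq Z' < ∞) (hY : Tendsto (fun n => hsSq (Y n - Y')) atTop (𝓝 0))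
    (hZ : Tendsto (fun n => hsSq (Z n - Z')) atTop (𝓝 0)) :
    Tendsto (fun n => traceNorm (star (Y n) * Z n - star Y' * Z')) atTop (𝓝 0) := by
  have hb : ∀ n, traceNorm (star (Y n) * Z n - star Y' * Z') ≤
      (2 * hsSq (Y n - Y') + 2 * hsSq Y') ^ (1 / 2 : ℝ) * hsSq (Z n - Z') ^ (1 / 2 : ℝ) +
        hsSq (Y n - Y') ^ (1 / 2 : ℝ) * hsSq Z' ^ (1 / 2 : ℝ) := by
    intro n
    have e : star (Y n) * Z n - star Y' * Z' =
        star (Y n) * (Z n - Z') + star (Y n - Y') * Z' := by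
      rw [mul_sub, star_sub, sub_mul]; abel
    rw [e]
    refine traceNorm_le_of_forall fun W hW => ?_
    calc ∑' i, ‖inner ℂ (W (basis H i))
          ((star (Y n) * (Z n - Z') + star (Y n - Y') * Z') (basis H i))‖ₑ
        ≤ ∑' i, (‖inner ℂ (W (basis H i)) ((star (Y n) * (Z n - Z')) (basis H i))‖ₑ +
            ‖inner ℂ (W (basis H i)) ((star (Y n - Y') * Z') (basis H i))‖ₑ) := by
          refine ENNReal.tsum_le_tsum fun i => ?_
          rw [add_apply, inner_add_right]
          exact enorm_add_le _ _
      _ ≤ hsSq (Y n) ^ (1 / 2 : ℝ) * hsSq (Z n - Z') ^ (1 / 2 : ℝ) +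
            hsSq (Y n - Y') ^ (1 / 2 : ℝ) * hsSq Z' ^ (1 / 2 : ℝ) := by
          rw [ENNReal.tsum_add]
          exact add_le_add (tsum_enorm_inner_star_mul_le _ _ _ hW)
            (tsum_enorm_inner_star_mul_le _ _ _ hW)
      _ ≤ _ := by
          gcongr
          simpa using hsSq_add_le (Y n - Y') Y'
  have hr : ∀ {u : ℕ → ℝ≥0∞} {c : ℝ≥0∞}, Tendsto u atTop (𝓝 c) →
      Tendsto (fun n => u n ^ (1 / 2 : ℝ)) atTop (𝓝 (c ^ (1 / 2 : ℝ))) := fun h =>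
    (ENNReal.continuous_rpow_const.tendsto _).comp h
  have h1 : Tendsto (fun n => 2 * hsSq (Y n - Y') + 2 * hsSq Y') atTop (𝓝 (2 * 0 + 2 * hsSq Y')) :=
    (ENNReal.Tendsto.const_mul hY (.inr (by simp))).add tendsto_const_nhds
  have hfin : (2 * 0 + 2 * hsSq Y') ^ (1 / 2 : ℝ) ≠ ∞ :=
    ENNReal.rpow_ne_top_of_nonneg (by norm_num)
      (by simpa using ENNReal.mul_ne_top ENNReal.ofNat_ne_top hY'.ne)
  have hfin' : hsSq Z' ^ (1 / 2 : ℝ) ≠ ∞ := ENNReal.rpow_ne_top_of_nonneg (by norm_num) hZ'.ne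
  have h2 := (ENNReal.Tendsto.mul (hr h1) (.inr (by simp)) (hr hZ) (.inr hfin)).add
    (ENNReal.Tendsto.mul_const (hr hY) (.inr hfin'))
  rw [ENNReal.zero_rpow_of_pos (by norm_num), mul_zero, zero_mul, add_zero] at h2
  exact tendsto_of_tendsto_of_tendsto_of_le_of_le tendsto_const_nhds h2 (fun _ => zero_le) hb

/-- For self-adjoint `S` and projections, convergence of the trace of `S Pₙ S` and strong
convergence imply Hilbert–Schmidt convergence of `Pₙ S`. -/
theorem mul_mul_eq_star_mul {P S : H →L[ℂ] H} (hP : IsStarProjection P) (hS : star S = S) :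
    S * P * S = star (P * S) * (P * S) := by
  rw [star_mul, hS, hP.isSelfAdjoint.star_eq, mul_assoc, mul_assoc, ← mul_assoc P P,
    hP.isIdempotentElem.eq]

theorem hsSq_lt_top_of_isTraceClass {P S : H →L[ℂ] H} (hP : IsStarProjection P)
    (hS : star S = S) (h : IsTraceClass (S * P * S)) : hsSq (P * S) < ∞ := by
  rwa [IsTraceClass, mul_mul_eq_star_mul hP hS, traceNorm_star_mul_self] at h

/-- The trace of S P S is the squared Hilbert–Schmidt norm of P S, so `htr` is convergence of norms,
`hlim` is convergence of columns, and Radon–Riesz combines them. -/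
theorem tendsto_hsSq_of_trace {Pn : ℕ → H →L[ℂ] H} {P S : H →L[ℂ] H}
    (hPn : ∀ n, IsStarProjection (Pn n)) (hP : IsStarProjection P) (hS : star S = S)
    (hn : ∀ n, hsSq (Pn n * S) < ∞) (h : hsSq (P * S) < ∞)
    (hlim : ∀ x, Tendsto (fun n => Pn n x) atTop (𝓝 (P x)))
    (htr : Tendsto (fun n => trace (S * Pn n * S)) atTop (𝓝 (trace (S * P * S)))) :
    Tendsto (fun n => hsSq (Pn n * S - P * S)) atTop (𝓝 0) := by
  refine tendsto_hsSq_sub hn h (fun x => hlim (S x)) ?_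
  simp_rw [mul_mul_eq_star_mul (hPn _) hS, mul_mul_eq_star_mul hP hS, trace_star_mul_self] at htr
  simp_rw [toReal_hsSq (hn _), toReal_hsSq h]
  have := (Complex.continuous_re.tendsto _).comp htr
  rw [Complex.ofReal_re] at this
  exact this.congr fun n => Complex.ofReal_re _

/-- The diagonal entries of the self-adjoint operator S (P - Q) S are dominated by those of its
absolute value. This converts trace norm convergence into convergence of traces. -/
theorem norm_trace_sub_le {P Q S : H →L[ℂ] H} (hP : IsStarProjection P) (hQ : IsStarProjection Q)
    (hS : star S = S) (hPS : hsSq (P * S) < ∞) (hQS : hsSq (Q * S) < ∞) :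
    ‖trace (S * P * S) - trace (S * Q * S)‖ₑ ≤ traceNorm (S * (P - Q) * S) := by
  have hsP := summable_of_hsSq_lt_top hPS
  have hsQ := summable_of_hsSq_lt_top hQS
  rw [mul_mul_eq_star_mul hP hS, mul_mul_eq_star_mul hQ hS, trace_star_mul_self,
    trace_star_mul_self, ← Complex.ofReal_sub, ← hsP.tsum_sub hsQ]
  have hsa : IsSelfAdjoint (S * (P - Q) * S) := by
    rw [IsSelfAdjoint, star_mul, star_mul, hS, (hP.isSelfAdjoint.sub hQ.isSelfAdjoint).star_eq,
      mul_assoc]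
  have hterm : ∀ i, (inner ℂ (basis H i) ((S * (P - Q) * S) (basis H i))).re =
      ‖(P * S) (basis H i)‖ ^ 2 - ‖(Q * S) (basis H i)‖ ^ 2 := by
    intro i
    rw [mul_sub, sub_mul, sub_apply, inner_sub_right, mul_mul_eq_star_mul hP hS,
      mul_mul_eq_star_mul hQ hS, inner_star_mul_self, inner_star_mul_self, ← Complex.ofReal_sub,
      Complex.ofReal_re]
  rw [← ofReal_norm, Complex.norm_real]
  calc ENNReal.ofReal ‖∑' i, (‖(P * S) (basis H i)‖ ^ 2 - ‖(Q * S) (basis H i)‖ ^ 2)‖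
      ≤ ENNReal.ofReal (∑' i, ‖‖(P * S) (basis H i)‖ ^ 2 - ‖(Q * S) (basis H i)‖ ^ 2‖) :=
        ENNReal.ofReal_le_ofReal (norm_tsum_le_tsum_norm (hsP.sub hsQ).norm)
    _ = ∑' i, ENNReal.ofReal ‖‖(P * S) (basis H i)‖ ^ 2 - ‖(Q * S) (basis H i)‖ ^ 2‖ :=
        ENNReal.ofReal_tsum_of_nonneg (fun _ => norm_nonneg _) (hsP.sub hsQ).norm
    _ ≤ _ := by
        refine ENNReal.tsum_le_tsum fun i => ENNReal.ofReal_le_ofReal ?_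
        rw [← hterm i, Real.norm_eq_abs]
        exact abs_re_inner_le hsa _

/-- Jacobson's identity: the inverse of 1 + ba is 1 - b (1 + ab)⁻¹ a. -/
theorem isUnit_one_add_mul_swap {R : Type*} [Ring R] {a b : R} (h : IsUnit (1 + a * b)) :
    IsUnit (1 + b * a) := by
  obtain ⟨u, hu⟩ := h
  have h1 : (1 + a * b) * (↑u⁻¹ : R) = 1 := by rw [← hu, Units.mul_inv]
  have h2 : (↑u⁻¹ : R) * (1 + a * b) = 1 := by rw [← hu, Units.inv_mul]
  refine ⟨⟨1 + b * a, 1 - b * (↑u⁻¹ : R) * a, ?_, ?_⟩, rfl⟩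
  · have : b * ((1 + a * b) * (↑u⁻¹ : R)) * a = b * a := by rw [h1, mul_one]
    calc (1 + b * a) * (1 - b * (↑u⁻¹ : R) * a)
        = 1 + b * a - b * ((1 + a * b) * (↑u⁻¹ : R)) * a := by noncomm_ring
      _ = 1 := by rw [this]; abel
  · have : b * ((↑u⁻¹ : R) * (1 + a * b)) * a = b * a := by rw [h2, mul_one]
    calc (1 - b * (↑u⁻¹ : R) * a) * (1 + b * a)
        = 1 + b * a - b * ((↑u⁻¹ : R) * (1 + a * b)) * a := by noncomm_ring
      _ = 1 := by rw [this]; abel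

/-- The inverse of `1 + P M P`. -/
def compressedInv (M P : H →L[ℂ] H) : H →L[ℂ] H :=
  Ring.inverse (1 + P * M * P)

/-- Since M P = (M P) P, the two operators differ by exchanging the factors M P and P. -/
theorem isUnit_one_add_compression {M P : H →L[ℂ] H} (hP : IsStarProjection P) :
    IsUnit (1 + M * P) ↔ IsUnit (1 + P * M * P) := by
  have e : M * P * P = M * P := by rw [mul_assoc, hP.isIdempotentElem.eq]
  constructor
  · intro h
    rw [← e] at h
    simpa [mul_assoc] using isUnit_one_add_mul_swap h
  · intro h
    rw [mul_assoc] at h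
    have := isUnit_one_add_mul_swap h
    rwa [e] at this

/-- `P` commutes with 1 + P M P, both products being P + P M P, and hence with the inverse. In the
singular case `Ring.inverse` is zero. -/
theorem commute_compressedInv (M : H →L[ℂ] H) {P : H →L[ℂ] H} (hP : IsStarProjection P) :
    P * compressedInv M P = compressedInv M P * P := by
  have hc : Commute P (1 + P * M * P) := by
    refine (Commute.one_right P).add_right ?_
    rw [Commute, SemiconjBy, ← mul_assoc, ← mul_assoc, hP.isIdempotentElem.eq, mul_assoc (P * M),
      hP.isIdempotentElem.eq]
  by_cases h : IsUnit (1 + P * M * P)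
  · calc P * compressedInv M P
        = compressedInv M P * ((1 + P * M * P) * P) * compressedInv M P := by
          rw [compressedInv, ← mul_assoc (Ring.inverse _), Ring.inverse_mul_cancel _ h, one_mul]
      _ = compressedInv M P * P := by
          rw [← hc.eq, compressedInv, mul_assoc _ _ (Ring.inverse (1 + P * M * P)),
            mul_assoc _ _ (Ring.inverse (1 + P * M * P)), Ring.mul_inverse_cancel _ h, mul_one]
  · rw [compressedInv, Ring.inverse_non_unit _ h, mul_zero, zero_mul]

/-- The intertwining relation P (1 + M P) = (1 + P M P) P, multiplied by the inverses on both sides.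
-/
theorem mul_inverse_eq {M P : H →L[ℂ] H} (hP : IsStarProjection P) (h : IsUnit (1 + M * P)) :
    P * Ring.inverse (1 + M * P) = compressedInv M P * P := by
  have h' := (isUnit_one_add_compression hP).1 h
  have e : P * (1 + M * P) = (1 + P * M * P) * P := by
    rw [mul_add, add_mul, mul_one, one_mul, mul_assoc (P * M), hP.isIdempotentElem.eq, mul_assoc]
  calc P * Ring.inverse (1 + M * P)
      = compressedInv M P * ((1 + P * M * P) * P) * Ring.inverse (1 + M * P) := by
        rw [compressedInv, ← mul_assoc, Ring.inverse_mul_cancel _ h', one_mul]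
    _ = compressedInv M P * P := by
        rw [← e, mul_assoc, mul_assoc, Ring.mul_inverse_cancel _ h, mul_one]

theorem mul_mul_inverse_eq {G M P : H →L[ℂ] H} (hP : IsStarProjection P)
    (h : IsUnit (1 + M * P)) :
    G * P * Ring.inverse (1 + M * P) * G = G * P * compressedInv M P * (P * G) := by
  rw [mul_assoc G P, mul_inverse_eq hP h, mul_assoc G P (compressedInv M P),
    commute_compressedInv M hP]
  calc G * (compressedInv M P * P) * G = G * (compressedInv M P * (P * P)) * G := by
        rw [hP.isIdempotentElem.eq]
    _ = _ := by simp only [mul_assoc]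

/-- Because G² = 1 + M, the middle factor P G · G P of the square is (1 + P M P) P, which cancels
one of the two inverses. Thanks to this, only measures of projection kernels have to be constructed.
-/
theorem isStarProjection_induced {G M P : H →L[ℂ] H} (hP : IsStarProjection P)
    (hG : star G = G) (hM : star M = M) (hGM : G * G = 1 + M) (h : IsUnit (1 + M * P)) :
    IsStarProjection (G * P * Ring.inverse (1 + M * P) * G) := by
  have h' := (isUnit_one_add_compression hP).1 h
  have hPP := hP.isIdempotentElem.eq
  have hTP := commute_compressedInv M hP
  rw [mul_mul_inverse_eq hP h]
  set T := compressedInv M P with hT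
  have hTs : star T = T := by
    rw [hT, compressedInv, ← Ring.inverse_star, star_add, star_one, star_mul, star_mul, hM,
      hP.isSelfAdjoint.star_eq, mul_assoc]
  have hPGGP : P * G * (G * P) = (1 + P * M * P) * P := by
    rw [mul_assoc, ← mul_assoc G G, hGM, add_mul, one_mul, mul_add, hPP, add_mul, one_mul,
      mul_assoc (P * M), hPP, mul_assoc]
  refine ⟨?_, ?_⟩
  · rw [IsIdempotentElem]
    calc G * P * T * (P * G) * (G * P * T * (P * G))
        = G * P * T * (P * G * (G * P)) * T * (P * G) := by simp only [mul_assoc]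
      _ = G * P * (T * (1 + P * M * P)) * (P * T) * (P * G) := by
          rw [hPGGP]; simp only [mul_assoc]
      _ = G * (P * P) * T * (P * G) := by
          rw [hT, compressedInv, Ring.inverse_mul_cancel _ h']; simp only [mul_assoc, one_mul]
      _ = _ := by rw [hPP]
  · rw [IsSelfAdjoint, star_mul, star_mul, star_mul, star_mul, hTs, hG, hP.isSelfAdjoint.star_eq]
    simp only [mul_assoc]

end Projections

/-! ### Consequences of local trace convergence of projections. -/

section LocalProjections

variable {E : Type*} [TopologicalSpace E] [PolishSpace E] [LocallyCompactSpace E]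
    [MeasurableSpace E] [BorelSpace E] {μ : Measure E}

theorem IsLocTraceClass.hsSq_lt_top {P : L2 μ →L[ℂ] L2 μ} (h : IsLocTraceClass μ P)
    (hP : IsStarProjection P) {B : Set E} (hB : IsBddBorel B) : hsSq (P * chi μ B) < ∞ :=
  hsSq_lt_top_of_isTraceClass hP (star_chi hB.1) (h B hB)

theorem isBddBorel_of_isCompact {B : Set E} (hB : IsCompact B) : IsBddBorel B :=
  ⟨hB.measurableSet, by rwa [hB.isClosed.closure_eq]⟩

theorem tendsto_chi_compactExhaustion (K : CompactExhaustion E) (x : L2 μ) :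
    Tendsto (fun k => chi μ (K k) x) atTop (𝓝 x) := by
  have h := tendsto_mulOp_apply (μ := μ) (f := fun k => (K k).indicator fun _ => (1 : ℂ))
    (f' := fun _ => 1) (C := 1)
    (fun k => measurable_indicator_one (K.isCompact k).measurableSet) measurable_const
    (fun k => norm_indicator_one_le _) (fun _ => by simp) (fun y => ?_) x
  · rwa [mulOp_one] at h
  · obtain ⟨n, hn⟩ := K.exists_mem y
    refine tendsto_const_nhds.congr' ?_
    filter_upwards [eventually_ge_atTop n] with k hk
    rw [Set.indicator_of_mem (K.subset hk hn)]

/-- Weak convergence is enough for projections. Cutting both vectors off to a large compact set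
changes the matrix coefficient little, uniformly in `n` because ‖Pn - P‖ ≤ 2. The compressed
coefficient is bounded by the trace norm, which dominates the operator norm. -/
theorem TendstoLocTrace.tendsto_apply {Pn : ℕ → L2 μ →L[ℂ] L2 μ} {P : L2 μ →L[ℂ] L2 μ}
    (h : TendstoLocTrace μ Pn P) (hPn : ∀ n, IsStarProjection (Pn n)) (hP : IsStarProjection P)
    (x : L2 μ) : Tendsto (fun n => Pn n x) atTop (𝓝 (P x)) := by
  refine tendsto_of_weak hPn hP (fun y z => ?_) x
  obtain ⟨K⟩ : Nonempty (CompactExhaustion E) := inferInstance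
  have hD : ∀ n, ‖Pn n - P‖ ≤ 2 := fun n => (norm_sub_le _ _).trans (by
    linarith [norm_le_one_of_isStarProjection (hPn n), norm_le_one_of_isStarProjection hP])
  rw [Metric.tendsto_atTop']
  intro ε hε
  have hk : Tendsto (fun k => 2 * ‖z‖ * ‖chi μ (K k) y - y‖ + 2 * ‖y‖ * ‖chi μ (K k) z - z‖)
      atTop (𝓝 0) := by
    have h1 := (tendsto_iff_norm_sub_tendsto_zero.1 (tendsto_chi_compactExhaustion K y)).const_mul
      (2 * ‖z‖)
    have h2 := (tendsto_iff_norm_sub_tendsto_zero.1 (tendsto_chi_compactExhaustion K z)).const_mul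
      (2 * ‖y‖)
    simpa using h1.add h2
  obtain ⟨k, hk⟩ := (hk.eventually_lt_const (half_pos hε)).exists
  have hB := isBddBorel_of_isCompact (K.isCompact k)
  set c := chi μ (K k) with hc
  have hn : Tendsto (fun n => (traceNorm (c * (Pn n - P) * c)).toReal * (‖y‖ * ‖z‖)) atTop
      (𝓝 0) := by
    have := ((ENNReal.tendsto_toReal ENNReal.zero_ne_top).comp (h _ hB)).mul_const (‖y‖ * ‖z‖)
    simpa using this
  have hfin : ∀ᶠ n in atTop, traceNorm (c * (Pn n - P) * c) < ∞ :=
    (h _ hB).eventually_lt_const ENNReal.zero_lt_top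
  obtain ⟨N, hN⟩ := eventually_atTop.1 ((hn.eventually_lt_const (half_pos hε)).and hfin)
  refine ⟨N, fun n hnN => ?_⟩
  obtain ⟨h1, h2⟩ := hN n hnN.le
  rw [dist_zero_right]
  set D := Pn n - P with hDdef
  have hop : ‖c * D * c‖ ≤ (traceNorm (c * D * c)).toReal := by
    rw [← toReal_enorm]
    exact ENNReal.toReal_mono h2.ne (enorm_le_traceNorm _)
  have hcn : ‖c‖ ≤ 1 := norm_chi_le hB.1
  have e : inner ℂ y (D z) = inner ℂ y ((c * D * c) z) - inner ℂ (c y - y) (D z) -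
      inner ℂ (c y) (D (c z - z)) := by
    have : inner ℂ y ((c * D * c) z) = inner ℂ (c y) (D (c z)) := by
      rw [mul_apply_eq_comp, mul_apply_eq_comp, ← ContinuousLinearMap.adjoint_inner_left,
        ← ContinuousLinearMap.star_eq_adjoint, hc, star_chi hB.1]
    rw [this, map_sub, inner_sub_left, inner_sub_right]
    ring
  have hDz : ∀ w, ‖D w‖ ≤ 2 * ‖w‖ := fun w => (D.le_opNorm w).trans (by gcongr; exact hD n)
  have hcy : ‖c y‖ ≤ ‖y‖ := (c.le_opNorm y).trans (by nlinarith [norm_nonneg y])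
  have b1 : ‖inner ℂ y ((c * D * c) z)‖ ≤ (traceNorm (c * D * c)).toReal * (‖y‖ * ‖z‖) :=
    calc _ ≤ ‖y‖ * ‖(c * D * c) z‖ := norm_inner_le_norm _ _
      _ ≤ ‖y‖ * ((traceNorm (c * D * c)).toReal * ‖z‖) := by
        gcongr
        exact ((c * D * c).le_opNorm z).trans (by gcongr)
      _ = _ := by ring
  have b2 : ‖inner ℂ (c y - y) (D z)‖ ≤ 2 * ‖z‖ * ‖c y - y‖ :=
    calc _ ≤ ‖c y - y‖ * ‖D z‖ := norm_inner_le_norm _ _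
      _ ≤ ‖c y - y‖ * (2 * ‖z‖) := by gcongr; exact hDz z
      _ = _ := by ring
  have b3 : ‖inner ℂ (c y) (D (c z - z))‖ ≤ 2 * ‖y‖ * ‖c z - z‖ :=
    calc _ ≤ ‖c y‖ * ‖D (c z - z)‖ := norm_inner_le_norm _ _
      _ ≤ ‖y‖ * (2 * ‖c z - z‖) := by gcongr; exact hDz _
      _ = _ := by ring
  rw [e]
  calc _ ≤ ‖inner ℂ y ((c * D * c) z)‖ + ‖inner ℂ (c y - y) (D z)‖ +
        ‖inner ℂ (c y) (D (c z - z))‖ :=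
      (norm_sub_le _ _).trans (by gcongr; exact norm_sub_le _ _)
    _ < ε := by linarith

/-- The Radon–Riesz argument with S = χ_B, where the convergence of traces follows from local trace
norm convergence. -/
theorem TendstoLocTrace.tendsto_hsSq {Pn : ℕ → L2 μ →L[ℂ] L2 μ} {P : L2 μ →L[ℂ] L2 μ}
    (h : TendstoLocTrace μ Pn P) (hPn : ∀ n, IsStarProjection (Pn n)) (hP : IsStarProjection P)
    (hPn_loc : ∀ n, IsLocTraceClass μ (Pn n)) (hP_loc : IsLocTraceClass μ P)
    {B : Set E} (hB : IsBddBorel B) :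
    Tendsto (fun n => hsSq (Pn n * chi μ B - P * chi μ B)) atTop (𝓝 0) := by
  refine tendsto_hsSq_of_trace hPn hP (star_chi hB.1) (fun n => (hPn_loc n).hsSq_lt_top (hPn n) hB)
    (hP_loc.hsSq_lt_top hP hB) (h.tendsto_apply hPn hP) ?_
  rw [tendsto_iff_edist_tendsto_0]
  refine tendsto_of_tendsto_of_tendsto_of_le_of_le tendsto_const_nhds (h B hB) (fun _ => zero_le)
    fun n => ?_
  rw [edist_eq_enorm_sub]
  exact norm_trace_sub_le (hPn n) hP (star_chi hB.1) ((hPn_loc n).hsSq_lt_top (hPn n) hB)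
    (hP_loc.hsSq_lt_top hP hB)

end LocalProjections

/-! ### The induced kernel and its local trace convergence. -/

section Induced

variable {E : Type*} [TopologicalSpace E] [PolishSpace E] [LocallyCompactSpace E]
    [MeasurableSpace E] [BorelSpace E] {μ : Measure E} {g : E → ℝ}

theorem memLp_top_ofReal {f : E → ℝ} (hf : Measurable f) (hC : ∀ x, |f x| ≤ 1) :
    MemLp (fun x => (f x : ℂ)) ∞ μ :=
  memLp_top_of_measurable (Complex.measurable_ofReal.comp hf) (C := 1) fun x => by
    simpa using hC x

theorem mulReal_mul {f h : E → ℝ} (hf : Measurable f) (hh : Measurable h)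
    (hfC : ∀ x, |f x| ≤ 1) (hhC : ∀ x, |h x| ≤ 1) :
    mulReal μ f * mulReal μ h = mulReal μ fun x => f x * h x := by
  have e : (fun x => ((f x * h x : ℝ) : ℂ)) = fun x => (f x : ℂ) * (h x : ℂ) := by
    ext x; push_cast; rfl
  have hm : MemLp (fun x => ((f x * h x : ℝ) : ℂ)) ∞ μ :=
    memLp_top_ofReal (hf.mul hh) fun x => by
      rw [abs_mul]; exact mul_le_one₀ (hfC x) (abs_nonneg _) (hhC x)
  rw [mulReal, mulReal, mulReal, mulOp_mul (memLp_top_ofReal hf hfC) (memLp_top_ofReal hh hhC)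
    (by rwa [e] at hm), e]

theorem abs_sqrt_le_one {t : ℝ} (h1 : t ≤ 1) : |√t| ≤ 1 := by
  rw [abs_of_nonneg (Real.sqrt_nonneg _)]
  exact Real.sqrt_le_one.2 h1

theorem abs_sub_one_le {t : ℝ} (h : t ∈ Set.Icc (0 : ℝ) 1) : |t - 1| ≤ 1 := by
  rw [abs_le]; constructor <;> linarith [h.1, h.2]

theorem star_mulReal_sqrt (hg : Measurable g) (hg01 : ∀ x, g x ∈ Set.Icc (0 : ℝ) 1) :
    star (mulReal μ fun x => √(g x)) = mulReal μ fun x => √(g x) :=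
  star_mulReal hg.sqrt fun x => abs_sqrt_le_one (hg01 x).2

theorem star_mulReal_sub_one (hg : Measurable g) (hg01 : ∀ x, g x ∈ Set.Icc (0 : ℝ) 1) :
    star (mulReal μ fun x => g x - 1) = mulReal μ fun x => g x - 1 :=
  star_mulReal (hg.sub_const 1) fun x => abs_sub_one_le (hg01 x)

theorem one_sub_mem_Icc (hg01 : ∀ x, g x ∈ Set.Icc (0 : ℝ) 1) (x : E) :
    1 - g x ∈ Set.Icc (0 : ℝ) 1 :=
  ⟨by linarith [(hg01 x).2], by linarith [(hg01 x).1]⟩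

theorem mulReal_sqrt_mul_self (hg : Measurable g) (hg01 : ∀ x, g x ∈ Set.Icc (0 : ℝ) 1) :
    (mulReal μ fun x => √(g x)) * (mulReal μ fun x => √(g x)) =
      1 + mulReal μ fun x => g x - 1 := by
  rw [mulReal_mul hg.sqrt hg.sqrt (fun x => abs_sqrt_le_one (hg01 x).2)
    fun x => abs_sqrt_le_one (hg01 x).2, ← mulOp_one, mulReal, mulReal,
    mulOp_add (memLp_top_of_measurable measurable_const (C := 1) fun _ => by simp)
      (memLp_top_ofReal (hg.sub_const 1) fun x => abs_sub_one_le (hg01 x))]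
  congr 1
  ext x
  rw [Real.mul_self_sqrt (hg01 x).1]
  push_cast
  ring

theorem mulReal_sub_one_eq (hg : Measurable g) (hg01 : ∀ x, g x ∈ Set.Icc (0 : ℝ) 1) :
    (mulReal μ fun x => g x - 1) =
      -((mulReal μ fun x => √(1 - g x)) * (mulReal μ fun x => √(1 - g x))) := by
  have h := mulReal_sqrt_mul_self (μ := μ) (g := fun x => 1 - g x) (hg.const_sub 1)
    (one_sub_mem_Icc hg01)
  rw [h, ← mulOp_one, mulReal, mulReal,
    mulOp_add (memLp_top_of_measurable measurable_const (C := 1) fun _ => by simp)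
      (memLp_top_ofReal ((hg.const_sub 1).sub_const 1)
        fun x => abs_sub_one_le (one_sub_mem_Icc hg01 x)), ← zero_sub,
    show (0 : L2 μ →L[ℂ] L2 μ) = mulOp μ (fun _ => 1) - mulOp μ (fun _ => 1) by rw [sub_self],
    sub_sub, mulOp_add, mulOp_sub]
  · congr 1
    ext x
    push_cast
    ring
  · exact memLp_top_of_measurable measurable_const (C := 1) fun _ => by simp
  · refine memLp_top_of_measurable (C := 3) (by fun_prop) fun x => ?_
    have e : (1 : ℂ) + (1 + ((1 - g x - 1 : ℝ) : ℂ)) = ((2 - g x : ℝ) : ℂ) := by push_cast; ring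
    rw [e, Complex.norm_real, Real.norm_eq_abs, abs_le]
    constructor <;> linarith [(hg01 x).1, (hg01 x).2]
  · exact memLp_top_of_measurable measurable_const (C := 1) fun _ => by simp
  · refine memLp_top_of_measurable (C := 3) (by fun_prop) fun x => ?_
    have e : (1 + ((1 - g x - 1 : ℝ) : ℂ)) = ((1 - g x : ℝ) : ℂ) := by push_cast; ring
    rw [e, Complex.norm_real, Real.norm_eq_abs, abs_le]
    constructor <;> linarith [(hg01 x).1, (hg01 x).2]

theorem isStarProjection_inducedOp (hg : Measurable g) (hg01 : ∀ x, g x ∈ Set.Icc (0 : ℝ) 1)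
    {P : L2 μ →L[ℂ] L2 μ} (hP : IsStarProjection P)
    (h : IsUnit (1 + mulReal μ (fun x => g x - 1) * P)) :
    IsStarProjection (inducedOp μ g P) :=
  isStarProjection_induced hP (star_mulReal_sqrt hg hg01) (star_mulReal_sub_one hg hg01)
    (mulReal_sqrt_mul_self hg hg01) h

/-- The factorization `χ_B √g Π T Π √g χ_B` of the compressed induced kernel. -/
theorem chi_mul_inducedOp_mul_chi (hg : Measurable g) (hg01 : ∀ x, g x ∈ Set.Icc (0 : ℝ) 1)
    {P : L2 μ →L[ℂ] L2 μ} (hP : IsStarProjection P)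
    (h : IsUnit (1 + mulReal μ (fun x => g x - 1) * P)) {B : Set E} (hB : MeasurableSet B) :
    chi μ B * inducedOp μ g P * chi μ B =
      star (P * chi μ B * mulReal μ fun x => √(g x)) *
        (compressedInv (mulReal μ fun x => g x - 1) P *
          (P * chi μ B * mulReal μ fun x => √(g x))) := by
  have hc : chi μ B * mulReal μ (fun x => √(g x)) = mulReal μ (fun x => √(g x)) * chi μ B := by
    have h1 : MemLp (fun x => ((√(g x) : ℝ) : ℂ)) ∞ μ :=
      memLp_top_ofReal hg.sqrt fun x => abs_sqrt_le_one (hg01 x).2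
    refine mulOp_comm (memLp_indicator_one hB) h1 ?_
    refine memLp_top_of_measurable (C := 1)
      ((measurable_indicator_one hB).mul (Complex.measurable_ofReal.comp hg.sqrt)) fun x => ?_
    rw [norm_mul]
    refine mul_le_one₀ (norm_indicator_one_le B x) (norm_nonneg _) ?_
    simpa using abs_sqrt_le_one (hg01 x).2
  rw [inducedOp, mul_mul_inverse_eq hP h, star_mul, star_mul, star_chi hB,
    star_mulReal_sqrt hg hg01, hP.isSelfAdjoint.star_eq]
  set G := mulReal μ fun x => √(g x)
  set T := compressedInv (mulReal μ fun x => g x - 1) P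
  calc chi μ B * (G * P * T * (P * G)) * chi μ B
      = chi μ B * G * P * T * P * (G * chi μ B) := by simp only [mul_assoc]
    _ = G * chi μ B * P * T * P * (chi μ B * G) := by rw [hc]
    _ = _ := by simp only [mul_assoc]

theorem isLocTraceClass_inducedOp (hg : Measurable g) (hg01 : ∀ x, g x ∈ Set.Icc (0 : ℝ) 1)
    {P : L2 μ →L[ℂ] L2 μ} (hP : IsStarProjection P) (hP_loc : IsLocTraceClass μ P)
    (h : IsUnit (1 + mulReal μ (fun x => g x - 1) * P)) :
    IsLocTraceClass μ (inducedOp μ g P) := by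
  intro B hB
  rw [IsTraceClass, chi_mul_inducedOp_mul_chi hg hg01 hP h hB.1]
  have hY : hsSq (P * chi μ B * mulReal μ fun x => √(g x)) < ∞ :=
    hsSq_mul_lt_top' _ (hP_loc.hsSq_lt_top hP hB)
  refine (traceNorm_star_mul_le _ _).trans_lt (ENNReal.mul_lt_top ?_ ?_)
  · exact ENNReal.rpow_lt_top_of_nonneg (by norm_num) hY.ne
  · exact ENNReal.rpow_lt_top_of_nonneg (by norm_num) (hsSq_mul_lt_top _ hY).ne

variable {Pn : ℕ → L2 μ →L[ℂ] L2 μ} {P : L2 μ →L[ℂ] L2 μ}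

/-- With S = √(1-g), the compression of g - 1 by Q is -(Q S)(Q S)*. The trace assumption makes Q S
converge in Hilbert–Schmidt norm, hence in operator norm, although the projections themselves are
only known to converge strongly. -/
theorem tendsto_one_add_compression (hg : Measurable g) (hg01 : ∀ x, g x ∈ Set.Icc (0 : ℝ) 1)
    (hPn : ∀ n, IsStarProjection (Pn n)) (hP : IsStarProjection P)
    (hPn_tr : ∀ n, IsTraceClass
      (mulReal μ (fun x => √(1 - g x)) * Pn n * mulReal μ (fun x => √(1 - g x))))
    (hP_tr : IsTraceClass
      (mulReal μ (fun x => √(1 - g x)) * P * mulReal μ (fun x => √(1 - g x))))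
    (hlim : ∀ x, Tendsto (fun n => Pn n x) atTop (𝓝 (P x)))
    (h_tr : Tendsto (fun n => trace
        (mulReal μ (fun x => √(1 - g x)) * Pn n * mulReal μ (fun x => √(1 - g x))))
      atTop (𝓝 (trace (mulReal μ (fun x => √(1 - g x)) * P * mulReal μ (fun x => √(1 - g x)))))) :
    Tendsto (fun n => 1 + Pn n * mulReal μ (fun x => g x - 1) * Pn n) atTop
      (𝓝 (1 + P * mulReal μ (fun x => g x - 1) * P)) := by
  have hS := star_mulReal_sqrt (μ := μ) (hg.const_sub 1) (one_sub_mem_Icc hg01)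
  have hM := mulReal_sub_one_eq (μ := μ) hg hg01
  set S := mulReal μ fun x => √(1 - g x)
  have h1 := tendsto_hsSq_of_trace hPn hP hS (fun n => hsSq_lt_top_of_isTraceClass (hPn n) hS
    (hPn_tr n)) (hsSq_lt_top_of_isTraceClass hP hS hP_tr) hlim h_tr
  have h2 : Tendsto (fun n => Pn n * S) atTop (𝓝 (P * S)) := by
    rw [tendsto_iff_norm_sub_tendsto_zero]
    have h3 : Tendsto (fun n => ‖Pn n * S - P * S‖ₑ ^ 2) atTop (𝓝 0) :=
      tendsto_of_tendsto_of_tendsto_of_le_of_le tendsto_const_nhds h1 (fun _ => zero_le)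
        fun n => enorm_sq_le_hsSq _
    have h4 : Tendsto (fun n => ‖Pn n * S - P * S‖ ^ 2) atTop (𝓝 0) := by
      have := (ENNReal.tendsto_toReal ENNReal.zero_ne_top).comp h3
      simpa [Function.comp_def, ENNReal.toReal_pow] using this
    simpa using h4.sqrt
  have e : ∀ {Q : L2 μ →L[ℂ] L2 μ}, IsStarProjection Q →
      1 + Q * mulReal μ (fun x => g x - 1) * Q = 1 - Q * S * star (Q * S) := fun {Q} hQ => by
    rw [hM, star_mul, hS, hQ.isSelfAdjoint.star_eq, mul_neg, neg_mul, ← sub_eq_add_neg]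
    simp only [mul_assoc]
  simp_rw [e (hPn _), e hP]
  exact tendsto_const_nhds.sub (h2.mul h2.star)

/-- The compressed kernel is Y* (T Y) with Y = P χ_B √g. Inversion is continuous, so T converges in
operator norm, and both Y and T Y converge in Hilbert–Schmidt norm. -/
theorem tendstoLocTrace_inducedOp (hg : Measurable g) (hg01 : ∀ x, g x ∈ Set.Icc (0 : ℝ) 1)
    (hPn : ∀ n, IsStarProjection (Pn n)) (hP : IsStarProjection P)
    (hP_loc : IsLocTraceClass μ P)
    (hloc : ∀ B, IsBddBorel B →
      Tendsto (fun n => hsSq (Pn n * chi μ B - P * chi μ B)) atTop (𝓝 0))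
    (hlim : Tendsto (fun n => 1 + Pn n * mulReal μ (fun x => g x - 1) * Pn n) atTop
      (𝓝 (1 + P * mulReal μ (fun x => g x - 1) * P)))
    (hn : ∀ᶠ n in atTop, IsUnit (1 + mulReal μ (fun x => g x - 1) * Pn n))
    (h : IsUnit (1 + mulReal μ (fun x => g x - 1) * P)) :
    TendstoLocTrace μ (fun n => inducedOp μ g (Pn n)) (inducedOp μ g P) := by
  intro B hB
  set G := mulReal μ fun x => √(g x) with hG
  set M := mulReal μ fun x => g x - 1 with hM
  have hT : Tendsto (fun n => compressedInv M (Pn n)) atTop (𝓝 (compressedInv M P)) := by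
    obtain ⟨u, hu⟩ := (isUnit_one_add_compression hP).1 h
    have hc := NormedRing.inverse_continuousAt u
    rw [hu] at hc
    exact hc.tendsto.comp hlim
  have hY' : hsSq (P * chi μ B * G) < ∞ := hsSq_mul_lt_top' _ (hP_loc.hsSq_lt_top hP hB)
  have hY : Tendsto (fun n => hsSq (Pn n * chi μ B * G - P * chi μ B * G)) atTop (𝓝 0) := by
    have h1 : Tendsto (fun n => ‖G‖ₑ ^ 2 * hsSq (Pn n * chi μ B - P * chi μ B)) atTop
        (𝓝 (‖G‖ₑ ^ 2 * 0)) := ENNReal.Tendsto.const_mul (hloc B hB) (.inr (by simp))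
    rw [mul_zero] at h1
    refine tendsto_of_tendsto_of_tendsto_of_le_of_le tendsto_const_nhds h1 (fun _ => zero_le)
      fun n => ?_
    rw [← sub_mul]
    exact hsSq_mul_le' _ _
  have hZ := tendsto_hsSq_mul_of_tendsto hT hY' hY
  refine (tendsto_traceNorm_sub hY' (hsSq_mul_lt_top _ hY') hY hZ).congr' ?_
  filter_upwards [hn] with n hn
  rw [mul_sub, sub_mul, chi_mul_inducedOp_mul_chi hg hg01 (hPn n) hn hB.1,
    chi_mul_inducedOp_mul_chi hg hg01 hP h hB.1]

end Induced

/-! ### Linear statistics of configurations. -/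

namespace Conf

section Stat

variable {E : Type*} [TopologicalSpace E] {R : Type*} [CommRing R]

/-- The linear statistic of an arbitrary function. -/
def stat (f : E → R) (X : Conf E) : R :=
  ∑ᶠ x, (X.mult x : R) * f x

theorem linStat_eq_stat (φ : C_c(E, ℝ)) (X : Conf E) : linStat φ X = stat φ X := rfl

theorem stat_eq_sum {f : E → R} {C : Set E} (hC : IsCompact C) (h : ∀ x ∉ C, f x = 0)
    (X : Conf E) : stat f X = ∑ x ∈ (X.finite_inter C hC).toFinset, (X.mult x : R) * f x := by
  refine finsum_eq_sum_of_support_subset _ fun x hx => ?_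
  rw [Function.mem_support] at hx
  rw [Set.Finite.coe_toFinset]
  refine ⟨fun h0 => hx (by simp [h0]), ?_⟩
  by_contra hxC
  exact hx (by simp [h x hxC])

theorem stat_add {f g : E → R} {C : Set E} (hC : IsCompact C) (hf : ∀ x ∉ C, f x = 0)
    (hg : ∀ x ∉ C, g x = 0) (X : Conf E) :
    stat (fun x => f x + g x) X = stat f X + stat g X := by
  rw [stat_eq_sum hC hf, stat_eq_sum hC hg, stat_eq_sum hC fun x hx => by simp [hf x hx, hg x hx],
    ← Finset.sum_add_distrib]
  exact Finset.sum_congr rfl fun x _ => by ring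

theorem stat_zero (X : Conf E) : stat (fun _ => (0 : R)) X = 0 := by
  simp [stat]

theorem stat_const_mul {f : E → R} {C : Set E} (hC : IsCompact C) (hf : ∀ x ∉ C, f x = 0)
    (c : R) (X : Conf E) : stat (fun x => c * f x) X = c * stat f X := by
  rw [stat_eq_sum hC hf, stat_eq_sum hC fun x hx => by simp [hf x hx], Finset.mul_sum]
  exact Finset.sum_congr rfl fun x _ => by ring

theorem stat_map {S : Type*} [CommRing S] (F : R →+* S) {f : E → R} {C : Set E}
    (hC : IsCompact C) (hf : ∀ x ∉ C, f x = 0) (X : Conf E) :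
    stat (fun x => F (f x)) X = F (stat f X) := by
  rw [stat_eq_sum hC hf, stat_eq_sum hC fun x hx => by simp [hf x hx], map_sum]
  exact Finset.sum_congr rfl fun x _ => by simp

theorem stat_mono {f g : E → ℝ} {C : Set E} (hC : IsCompact C) (hf : ∀ x ∉ C, f x = 0)
    (hg : ∀ x ∉ C, g x = 0) (h : ∀ x, f x ≤ g x) (X : Conf E) : stat f X ≤ stat g X := by
  rw [stat_eq_sum hC hf, stat_eq_sum hC hg]
  exact Finset.sum_le_sum fun x _ => mul_le_mul_of_nonneg_left (h x) (Nat.cast_nonneg _)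

theorem exists_compact_forall_eq_zero {α : Type*} [Zero α] [TopologicalSpace α] (φ ψ : C_c(E, α)) :
    ∃ C : Set E, IsCompact C ∧ (∀ x ∉ C, φ x = 0) ∧ ∀ x ∉ C, ψ x = 0 :=
  ⟨tsupport φ ∪ tsupport ψ, φ.hasCompactSupport.isCompact.union ψ.hasCompactSupport.isCompact,
    fun _ hx => image_eq_zero_of_notMem_tsupport fun h => hx (.inl h),
    fun _ hx => image_eq_zero_of_notMem_tsupport fun h => hx (.inr h)⟩

theorem linStat_add (φ ψ : C_c(E, ℝ)) (X : Conf E) :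
    linStat (φ + ψ) X = linStat φ X + linStat ψ X := by
  obtain ⟨C, hC, h1, h2⟩ := exists_compact_forall_eq_zero φ ψ
  exact stat_add hC h1 h2 X

theorem linStat_smul (c : ℝ) (φ : C_c(E, ℝ)) (X : Conf E) :
    linStat (c • φ) X = c * linStat φ X := by
  obtain ⟨C, hC, h1, -⟩ := exists_compact_forall_eq_zero φ φ
  exact stat_const_mul hC h1 c X

theorem linStat_sum {ι : Type*} (s : Finset ι) (φ : ι → C_c(E, ℝ)) (X : Conf E) :
    linStat (∑ i ∈ s, φ i) X = ∑ i ∈ s, linStat (φ i) X := by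
  classical
  induction s using Finset.induction_on with
  | empty => exact stat_zero X
  | insert i s hi ih => rw [Finset.sum_insert hi, Finset.sum_insert hi, linStat_add, ih]

theorem continuous_linStat (φ : C_c(E, ℝ)) : Continuous (linStat φ) :=
  continuous_pi_iff.1 (continuous_induced_dom
    (f := fun (X : Conf E) (φ : C_c(E, ℝ)) => linStat φ X)) φ

/-- Particle numbers are unbounded, so closeness of test functions has to be weighted by another
test function, whose statistic counts the particles concerned. -/
theorem abs_linStat_sub_le {φ ψ χ : C_c(E, ℝ)} {ε : ℝ} (h : ∀ x, |φ x - ψ x| ≤ ε * χ x)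
    (X : Conf E) : |linStat φ X - linStat ψ X| ≤ ε * linStat χ X := by
  have e : linStat φ X - linStat ψ X = linStat (φ + (-1 : ℝ) • ψ) X := by
    rw [linStat_add, linStat_smul]; ring
  rw [e, ← linStat_smul, abs_le]
  obtain ⟨C, hC, h1, h2⟩ := exists_compact_forall_eq_zero (φ + (-1 : ℝ) • ψ) (ε • χ)
  have hb : ∀ x, |(φ + (-1 : ℝ) • ψ) x| ≤ (ε • χ) x := fun x => by
    have := h x
    simpa [← sub_eq_add_neg] using this
  constructor
  · have e2 : -linStat (ε • χ) X = linStat ((-1 : ℝ) • (ε • χ)) X := by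
      rw [linStat_smul (-1)]; ring
    rw [e2]
    refine stat_mono hC (fun x hx => ?_) h1 (fun x => ?_) X
    · simp only [CompactlySupportedContinuousMap.smul_apply, h2 x hx, smul_zero]
    · have := (abs_le.1 (hb x)).1
      simpa using this
  · exact stat_mono hC h1 h2 (fun x => (abs_le.1 (hb x)).2) X

end Stat

/-! ### The vague topology, and weak convergence through characteristic functions. -/

section Topology

variable {E : Type*} [TopologicalSpace E] [PolishSpace E] [LocallyCompactSpace E]

/-- A bump function equal to `1` on a compact set and supported in a given open neighbourhood. -/
theorem exists_bump {K V : Set E} (hK : IsCompact K) (hV : IsOpen V) (hKV : K ⊆ V) :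
    ∃ χ : C_c(E, ℝ), (∀ x ∈ K, χ x = 1) ∧ tsupport χ ⊆ V ∧ ∀ x, χ x ∈ Set.Icc (0 : ℝ) 1 := by
  obtain ⟨f, h1, h2, h3, h4⟩ := exists_continuousMap_one_of_isCompact_subset_isOpen hK hV hKV
  exact ⟨⟨f, h2⟩, fun x hx => h1 hx, h3, h4⟩

variable (E) in
/-- A countable family of test functions which is dense in `C_c` with respect to domination by its
own members. -/
theorem exists_testSeq : ∃ D : ℕ → C_c(E, ℝ), ∀ φ : C_c(E, ℝ), ∃ k, ∀ ε > 0, ∃ j,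
    ∀ x, |φ x - D j x| ≤ ε * D k x := by
  obtain ⟨K⟩ : Nonempty (CompactExhaustion E) := inferInstance
  choose χ hχ1 _ hχ01 using fun k => exists_bump (K.isCompact k) isOpen_univ (Set.subset_univ _)
  obtain ⟨ψ, hψ⟩ := TopologicalSpace.exists_dense_seq C(E, ℝ)
  -- Index 0 is the constant 1, so that each bump `χ k` is itself in the family and can serve as the
  -- dominating member.
  let ψ' : ℕ → C(E, ℝ) := fun n => Nat.casesOn n (1 : C(E, ℝ)) ψ
  let D : ℕ → C_c(E, ℝ) := fun n =>
    ⟨(χ n.unpair.1 : C(E, ℝ)) * ψ' n.unpair.2, (χ n.unpair.1).hasCompactSupport.mul_right⟩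
  have hD : ∀ n x, D n x = χ n.unpair.1 x * ψ' n.unpair.2 x := fun _ _ => rfl
  refine ⟨D, fun φ => ?_⟩
  obtain ⟨k, hk⟩ := K.exists_superset_of_isCompact φ.hasCompactSupport.isCompact
  refine ⟨Nat.pair k 0, fun ε hε => ?_⟩
  have hopen : ∀ᶠ f : C(E, ℝ) in 𝓝 (φ : C(E, ℝ)), ∀ x ∈ tsupport (χ k), dist (φ x) (f x) < ε := by
    have h := (ContinuousMap.tendsto_iff_forall_isCompact_tendstoUniformlyOn (p := 𝓝 (φ : C(E, ℝ)))
      (F := fun f : C(E, ℝ) => f) (f := (φ : C(E, ℝ)))).1 tendsto_id _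
      (χ k).hasCompactSupport.isCompact
    exact Metric.tendstoUniformlyOn_iff.1 h ε hε
  obtain ⟨_, hf, ⟨j, rfl⟩⟩ := (mem_closure_iff_nhds.1 (hψ (φ : C(E, ℝ)))) _ hopen
  refine ⟨Nat.pair k (j + 1), fun x => ?_⟩
  rw [hD, hD, Nat.unpair_pair, Nat.unpair_pair]
  have e1 : ψ' 0 x = 1 := rfl
  have e2 : ψ' (j + 1) x = ψ j x := rfl
  simp only [e1, e2, mul_one]
  have hφ : φ x = χ k x * φ x := by
    by_cases hx : x ∈ tsupport φ
    · rw [hχ1 k x (hk hx), one_mul]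
    · rw [image_eq_zero_of_notMem_tsupport hx, mul_zero]
  rw [hφ, ← mul_sub, abs_mul, abs_of_nonneg (hχ01 k x).1, mul_comm]
  by_cases hx : x ∈ tsupport (χ k)
  · exact mul_le_mul_of_nonneg_right (hf x hx).le (hχ01 k x).1
  · rw [image_eq_zero_of_notMem_tsupport hx, mul_zero, mul_zero]

variable (E) in
/-- A countable determining family of test functions. -/
def testSeq : ℕ → C_c(E, ℝ) :=
  Classical.choose (exists_testSeq E)

theorem exists_testSeq_close (φ : C_c(E, ℝ)) : ∃ k, ∀ ε > 0, ∃ j,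
    ∀ x, |φ x - testSeq E j x| ≤ ε * testSeq E k x :=
  Classical.choose_spec (exists_testSeq E) φ

/-- The vague topology is induced by countably many linear statistics. -/
theorem isInducing_testSeq :
    IsInducing fun (X : Conf E) (n : ℕ) => linStat (testSeq E n) X := by
  refine ⟨le_antisymm ?_ ?_⟩
  · rw [← continuous_iff_le_induced]
    exact continuous_pi fun n => continuous_linStat _
  · set t : TopologicalSpace (Conf E) := TopologicalSpace.induced
      (fun (X : Conf E) (n : ℕ) => linStat (testSeq E n) X) inferInstance with ht
    have hc : ∀ n, @Continuous _ _ t _ fun X : Conf E => linStat (testSeq E n) X := fun n =>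
      (@continuous_pi_iff _ _ _ t _ _).1 (continuous_induced_dom
        (f := fun (X : Conf E) (n : ℕ) => linStat (testSeq E n) X)) n
    refine continuous_iff_le_induced.1 (@continuous_pi _ _ _ t _ _ fun φ => ?_)
    obtain ⟨k, hk⟩ := exists_testSeq_close φ
    refine (@Metric.continuous_iff' _ _ _ t _).2 fun X₀ ε hε => ?_
    -- Where the `k`-th statistic moves by less than 1 it stays below `m`, so replacing φ by the
    -- `j`-th test function costs ε / 4 at `X₀` and at `X`, leaving room for the ε / 4 of the `j`-th
    -- statistic.
    set m := |linStat (testSeq E k) X₀| + 1 with hm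
    have hm0 : 0 < m := by positivity
    obtain ⟨j, hj⟩ := hk (ε / (4 * m)) (by positivity)
    have h1 := (@Metric.continuous_iff' _ _ _ t _).1 (hc j) X₀ (ε / 4) (by positivity)
    have h2 := (@Metric.continuous_iff' _ _ _ t _).1 (hc k) X₀ 1 one_pos
    filter_upwards [h1, h2] with X hX1 hX2
    rw [Real.dist_eq] at hX1 hX2 ⊢
    have hle : ∀ Y : Conf E, linStat (testSeq E k) Y ≤ m →
        |linStat φ Y - linStat (testSeq E j) Y| ≤ ε / 4 := fun Y hY => by
      refine (abs_linStat_sub_le hj Y).trans ?_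
      calc ε / (4 * m) * linStat (testSeq E k) Y ≤ ε / (4 * m) * m := by gcongr
        _ = ε / 4 := by field_simp
    have b1 := hle X₀ ((le_abs_self _).trans (by linarith))
    have b2 := hle X (by have := abs_lt.1 hX2; have := le_abs_self (linStat (testSeq E k) X₀); linarith)
    rw [abs_le] at b1 b2
    rw [abs_lt] at hX1 ⊢
    constructor <;> linarith

/-- Near x₀ both configurations have finitely many other atoms. A bump at x₀ avoiding them reads off
the multiplicity at x₀. -/
theorem linStat_injective : Function.Injective fun (X : Conf E) (φ : C_c(E, ℝ)) => linStat φ X := by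
  intro X Y h
  ext x₀
  obtain ⟨K, hK, hKx⟩ := exists_compact_mem_nhds x₀
  set F : Set E := ((Function.support X.mult ∩ K) ∪ (Function.support Y.mult ∩ K)) \ {x₀} with hF
  have hFfin : F.Finite := ((X.finite_inter K hK).union (Y.finite_inter K hK)).subset
    Set.sdiff_subset
  obtain ⟨χ, h1, h2, -⟩ := exists_bump (K := {x₀}) (V := interior K \ F) isCompact_singleton
    (isOpen_interior.sdiff hFfin.isClosed)
    (by
      rw [Set.singleton_subset_iff]
      exact ⟨mem_interior_iff_mem_nhds.2 hKx, fun hx => hx.2 rfl⟩)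
  have key : ∀ Z : Conf E, (Function.support Z.mult ∩ K) \ {x₀} ⊆ F → linStat χ Z = Z.mult x₀ := by
    intro Z hZ
    rw [linStat, finsum_eq_single _ x₀ ?_, h1 x₀ rfl, mul_one]
    intro x hx
    by_contra hne
    have hm : Z.mult x ≠ 0 := fun h0 => hne (by simp [h0])
    have hχ : χ x ≠ 0 := fun h0 => hne (by simp [h0])
    have hx2 := h2 (subset_tsupport _ hχ)
    exact hx2.2 (hZ ⟨⟨hm, interior_subset hx2.1⟩, hx⟩)
  have hXY := congrFun h χ
  simp only at hXY
  rw [key X (Set.sdiff_subset_sdiff_left Set.subset_union_left),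
    key Y (Set.sdiff_subset_sdiff_left Set.subset_union_right)] at hXY
  exact_mod_cast hXY

instance : T2Space (Conf E) :=
  ⟨fun X Y hne => by
    obtain ⟨φ, hφ⟩ := Function.ne_iff.1 (linStat_injective.ne hne)
    exact separated_by_continuous (continuous_linStat φ) hφ⟩

instance : TopologicalSpace.PseudoMetrizableSpace (Conf E) :=
  isInducing_testSeq.pseudoMetrizableSpace

/-- The vector of the first linear statistics of the determining family. -/
def statVec (E : Type*) [TopologicalSpace E] [PolishSpace E] [LocallyCompactSpace E] (k : ℕ)
    (X : Conf E) : EuclideanSpace ℝ (Fin k) :=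
  WithLp.toLp 2 fun i => linStat (testSeq E i) X

theorem continuous_statVec (k : ℕ) : Continuous (statVec E k) :=
  (PiLp.continuous_toLp 2 _).comp (continuous_pi fun _ => continuous_linStat _)

/-- Every open set of configurations is an increasing union of open cylinders. -/
theorem exists_open_cylinders {U : Set (Conf E)} (hU : IsOpen U) :
    ∃ V : (k : ℕ) → Set (EuclideanSpace ℝ (Fin k)), (∀ k, IsOpen (V k)) ∧
      Monotone (fun k => statVec E k ⁻¹' V k) ∧ ⋃ k, statVec E k ⁻¹' V k = U := by
  -- Taking the largest admissible base for each `k` makes the cylinders increase: forgetting the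
  -- last coordinate is continuous, so every base at level `k` lifts to level `k + 1`.
  refine ⟨fun k => ⋃₀ {V | IsOpen V ∧ statVec E k ⁻¹' V ⊆ U},
    fun k => isOpen_sUnion fun V hV => hV.1, ?_, ?_⟩
  · refine monotone_nat_of_le_succ fun k X hX => ?_
    obtain ⟨V, ⟨hVo, hVU⟩, hXV⟩ := hX
    let r : EuclideanSpace ℝ (Fin (k + 1)) → EuclideanSpace ℝ (Fin k) :=
      fun v => WithLp.toLp 2 fun i => v i.castSucc
    have hr : Continuous r := by
      refine (PiLp.continuous_toLp 2 _).comp (continuous_pi fun i => ?_)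
      fun_prop
    have hrs : ∀ Y, r (statVec E (k + 1) Y) = statVec E k Y := fun Y => rfl
    refine ⟨r ⁻¹' V, ⟨hVo.preimage hr, fun Y hY => hVU ?_⟩, ?_⟩
    · exact hY
    · exact hXV
  · refine Set.Subset.antisymm (Set.iUnion_subset fun k X hX => ?_) fun X hX => ?_
    · obtain ⟨V, ⟨-, hVU⟩, hXV⟩ := hX
      exact hVU hXV
    · obtain ⟨W, hW, rfl⟩ := isInducing_testSeq.isOpen_iff.1 hU
      obtain ⟨I, u, hu, hIW⟩ := isOpen_pi_iff.1 hW _ hX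
      obtain ⟨k, hk⟩ : ∃ k, ∀ i ∈ I, i < k := ⟨I.sup id + 1, fun i hi =>
        Nat.lt_succ_of_le (Finset.le_sup (f := id) hi)⟩
      refine Set.mem_iUnion.2 ⟨k, {v | ∀ i : Fin k, (i : ℕ) ∈ I → v i ∈ u i}, ⟨?_, ?_⟩, ?_⟩
      · have : {v : EuclideanSpace ℝ (Fin k) | ∀ i : Fin k, (i : ℕ) ∈ I → v i ∈ u i} =
            ⋂ i : Fin k, {v | (i : ℕ) ∈ I → v i ∈ u i} := by
          ext v; simp
        rw [this]
        refine isOpen_iInter_of_finite fun i => ?_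
        by_cases hi : (i : ℕ) ∈ I
        · simp only [hi, forall_const]
          exact (hu i hi).1.preimage (by fun_prop)
        · simp [hi]
      · intro Y hY
        exact hIW fun i hi => hY ⟨i, hk i hi⟩ hi
      · exact fun i hi => (hu i hi).2

variable [MeasurableSpace E] [BorelSpace E]

/-- Weak convergence of point processes follows from the convergence of the characteristic
functions of all linear statistics. -/
theorem tendsto_of_tendsto_charFun {Qn : ℕ → ProbabilityMeasure (Conf E)}
    {Q : ProbabilityMeasure (Conf E)}
    (h : ∀ φ : C_c(E, ℝ), Tendsto
      (fun n => ∫ X, Complex.exp (linStat φ X * Complex.I) ∂(Qn n : Measure (Conf E))) atTop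
      (𝓝 (∫ X, Complex.exp (linStat φ X * Complex.I) ∂(Q : Measure (Conf E))))) :
    Tendsto Qn atTop (𝓝 Q) := by
  have hm : ∀ k, Measurable (statVec E k) := fun k => (continuous_statVec k).measurable
  -- Cramér–Wold: a linear combination of linear statistics is the linear statistic of one test
  -- function.
  have hchar : ∀ (k : ℕ) (t : EuclideanSpace ℝ (Fin k)) (P : ProbabilityMeasure (Conf E)),
      charFun ((P.map (hm k).aemeasurable : ProbabilityMeasure _) : Measure _) t =
        ∫ X, Complex.exp (linStat (∑ i : Fin k, t i • testSeq E i) X * Complex.I)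
          ∂(P : Measure (Conf E)) := by
    intro k t P
    rw [charFun_apply, ProbabilityMeasure.toMeasure_map,
      integral_map (hm k).aemeasurable (by fun_prop)]
    refine integral_congr_ae (ae_of_all _ fun X => ?_)
    simp only
    rw [linStat_sum]
    simp_rw [linStat_smul]
    rw [PiLp.inner_apply]
    rfl
  have hk : ∀ k, Tendsto (fun n => (Qn n).map (hm k).aemeasurable) atTop
      (𝓝 (Q.map (hm k).aemeasurable)) := fun k => by
    rw [ProbabilityMeasure.tendsto_iff_tendsto_charFun]
    intro t
    simp_rw [hchar]
    exact h _
  -- The portmanteau bound on open sets needs only approximation from below, which the increasing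
  -- cylinders provide.
  refine tendsto_of_forall_isOpen_le_liminf' fun U hU => ?_
  obtain ⟨V, hVo, hmono, rfl⟩ := exists_open_cylinders hU
  have h1 := tendsto_measure_iUnion_atTop (μ := (Q : Measure (Conf E))) hmono
  refine le_of_tendsto' h1 fun k => ?_
  have h2 := ProbabilityMeasure.le_liminf_measure_open_of_tendsto (hk k) (hVo k)
  simp only [ProbabilityMeasure.toMeasure_map] at h2
  rw [Measure.map_apply (hm k) (hVo k).measurableSet] at h2
  refine h2.trans (liminf_le_liminf (.of_forall fun n => ?_))
  rw [Measure.map_apply (hm k) (hVo k).measurableSet]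
  exact measure_mono (Set.subset_iUnion (fun k => statVec E k ⁻¹' V k) k)

/-- A point process is determined by the characteristic functions of its linear statistics. -/
theorem eq_of_charFun_eq {Q Q' : ProbabilityMeasure (Conf E)}
    (h : ∀ φ : C_c(E, ℝ),
      ∫ X, Complex.exp (linStat φ X * Complex.I) ∂(Q : Measure (Conf E)) =
      ∫ X, Complex.exp (linStat φ X * Complex.I) ∂(Q' : Measure (Conf E))) : Q = Q' := by
  -- The constant sequence `Q` also converges to `Q'`.
  refine tendsto_nhds_unique (tendsto_const_nhds (f := (atTop : Filter ℕ)))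
    (tendsto_of_tendsto_charFun fun φ => ?_)
  rw [h φ]
  exact tendsto_const_nhds

end Topology

end Conf

/-! ### Configurations built from families of points. -/

namespace Conf

section OfFamily

variable {E : Type*} [TopologicalSpace E] {α : Type*}

/-- The configuration of the points of a locally finite family (`none` meaning no point). -/
def ofFamily (x : α → Option E)
    (hx : ∀ C : Set E, IsCompact C → {a | ∃ y ∈ C, x a = some y}.Finite) : Conf E where
  mult y := {a | x a = some y}.ncard
  finite_inter C hC := by
    refine (((hx C hC).image x).preimage (Option.some_injective E).injOn).subset ?_
    rintro y ⟨hy, hyC⟩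
    obtain ⟨a, ha⟩ := Set.nonempty_of_ncard_ne_zero hy
    exact ⟨a, ⟨y, hyC, ha⟩, ha⟩

/-- Double counting: multiplicities are the cardinalities of the fibres of the family. -/
theorem stat_ofFamily {R : Type*} [CommRing R] (x : α → Option E)
    (hx : ∀ C : Set E, IsCompact C → {a | ∃ y ∈ C, x a = some y}.Finite) {f : E → R} {C : Set E}
    (hC : IsCompact C) (hf : ∀ y ∉ C, f y = 0) :
    stat f (ofFamily x hx) = ∑ a ∈ (hx C hC).toFinset, (x a).elim 0 f := by
  classical
  rw [stat_eq_sum hC hf]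
  set S := (hx C hC).toFinset with hS
  set T := ((ofFamily x hx).finite_inter C hC).toFinset with hT
  have hcard : ∀ y ∈ C, {a | x a = some y} = ↑(S.filter fun a => x a = some y) := by
    intro y hy
    ext a
    simp only [Set.mem_ofPred_eq, Finset.coe_filter, hS, Set.Finite.mem_toFinset]
    exact ⟨fun h => ⟨⟨y, hy, h⟩, h⟩, fun h => h.2⟩
  have h1 : ∀ y ∈ T, (((ofFamily x hx).mult y : ℕ) : R) * f y =
      ∑ a ∈ S, if x a = some y then f y else 0 := by
    intro y hy
    have hyC : y ∈ C := ((Set.Finite.mem_toFinset _).1 hy).2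
    have hm : (ofFamily x hx).mult y = {a | x a = some y}.ncard := rfl
    rw [hm, hcard y hyC, Set.ncard_coe_finset, ← Finset.sum_filter, Finset.sum_const, nsmul_eq_mul]
  rw [Finset.sum_congr rfl h1, Finset.sum_comm]
  refine Finset.sum_congr rfl fun a ha => ?_
  obtain ⟨y, hyC, hy⟩ := (Set.Finite.mem_toFinset _).1 ha
  have hyT : y ∈ T := by
    refine (Set.Finite.mem_toFinset _).2 ⟨?_, hyC⟩
    have hm : (ofFamily x hx).mult y = {a | x a = some y}.ncard := rfl
    rw [Function.mem_support, hm, hcard y hyC, Set.ncard_coe_finset]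
    exact Finset.card_ne_zero.2 ⟨a, Finset.mem_filter.2 ⟨ha, hy⟩⟩
  rw [hy, Option.elim_some, Finset.sum_eq_single y]
  · simp
  · intro z _ hz
    rw [if_neg]
    exact fun h => hz (Option.some_injective _ h).symm
  · exact fun h => absurd hyT h

variable {κ : Type*} [Fintype κ]

/-- The configuration of finitely many points. -/
def ofFun (x : κ → E) : Conf E :=
  ofFamily (fun a => some (x a)) fun _ _ => Set.toFinite _

theorem stat_ofFun {R : Type*} [CommRing R] (x : κ → E) {f : E → R} {C : Set E}
    (hC : IsCompact C) (hf : ∀ y ∉ C, f y = 0) : stat f (ofFun x) = ∑ a, f (x a) := by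
  rw [ofFun, stat_ofFamily _ _ hC hf]
  refine Finset.sum_subset (Finset.subset_univ _) fun a _ ha => hf _ fun h => ha ?_
  exact (Set.Finite.mem_toFinset _).2 ⟨x a, h, rfl⟩

theorem continuous_ofFun : Continuous (ofFun : (κ → E) → Conf E) := by
  refine continuous_induced_rng.2 (continuous_pi fun φ => ?_)
  have h : ∀ x : κ → E, linStat φ (ofFun x) = ∑ a, φ (x a) := fun x =>
    stat_ofFun x φ.hasCompactSupport.isCompact fun _ hy => image_eq_zero_of_notMem_tsupport hy
  simp only [Function.comp_def, h]
  fun_prop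

theorem stat_eq_linStat_re_im (φ : C_c(E, ℂ)) :
    ∃ φ₁ φ₂ : C_c(E, ℝ), (∀ x, φ₁ x = (φ x).re) ∧ (∀ x, φ₂ x = (φ x).im) ∧
      ∀ X, stat φ X = linStat φ₁ X + linStat φ₂ X * Complex.I := by
  let φ₁ : C_c(E, ℝ) := ⟨⟨fun x => (φ x).re, Complex.continuous_re.comp φ.continuous⟩,
    φ.hasCompactSupport.comp_left (g := Complex.re) rfl⟩
  let φ₂ : C_c(E, ℝ) := ⟨⟨fun x => (φ x).im, Complex.continuous_im.comp φ.continuous⟩,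
    φ.hasCompactSupport.comp_left (g := Complex.im) rfl⟩
  refine ⟨φ₁, φ₂, fun _ => rfl, fun _ => rfl, fun X => ?_⟩
  have hC := φ.hasCompactSupport.isCompact
  have h0 : ∀ x ∉ tsupport φ, φ x = 0 := fun x hx => image_eq_zero_of_notMem_tsupport hx
  have h1 : linStat φ₁ X = ∑ x ∈ (X.finite_inter _ hC).toFinset, (X.mult x : ℝ) * (φ x).re :=
    stat_eq_sum (f := fun x => (φ x).re) hC (fun x hx => by simp [h0 x hx]) X
  have h2 : linStat φ₂ X = ∑ x ∈ (X.finite_inter _ hC).toFinset, (X.mult x : ℝ) * (φ x).im :=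
    stat_eq_sum (f := fun x => (φ x).im) hC (fun x hx => by simp [h0 x hx]) X
  rw [h1, h2, stat_eq_sum hC h0]
  push_cast
  rw [Finset.sum_mul, ← Finset.sum_add_distrib]
  refine Finset.sum_congr rfl fun x _ => ?_
  conv_lhs => rw [← Complex.re_add_im (φ x)]
  ring

theorem continuous_stat (φ : C_c(E, ℂ)) : Continuous (stat φ) := by
  obtain ⟨φ₁, φ₂, -, -, h⟩ := stat_eq_linStat_re_im φ
  rw [show stat φ = fun X => (linStat φ₁ X : ℂ) + linStat φ₂ X * Complex.I from funext h]
  have := continuous_linStat φ₁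
  have := continuous_linStat φ₂
  fun_prop

end OfFamily

end Conf

/-! ### Slater determinants and Andréief's identity. -/

section FiniteRank

variable {E : Type*} [MeasurableSpace E] {μ : Measure E} [SigmaFinite μ]
  {κ : Type*} [Fintype κ] [DecidableEq κ]

/-- The Slater determinant of a finite family in `L₂`. -/
def slater (u : κ → L2 μ) (x : κ → E) : ℂ :=
  (Matrix.of fun i j => (u i : E → ℂ) (x j)).det

theorem measurable_slater (u : κ → L2 μ) : Measurable (slater u) := by
  have h : ∀ i j, Measurable fun x : κ → E => (u i : E → ℂ) (x j) := fun i j =>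
    (Lp.stronglyMeasurable (u i)).measurable.comp (measurable_pi_apply j)
  have e : slater u = fun x => ∑ σ : Equiv.Perm κ, ((Equiv.Perm.sign σ : ℤ) : ℂ) *
      ∏ i, (u (σ i) : E → ℂ) (x i) := funext fun x => Matrix.det_apply' _
  rw [e]
  fun_prop

/-- Expanding both determinants leaves products of functions of one variable each, to which Fubini
applies term by term. -/
theorem prod_mul_normSq_slater (u : κ → L2 μ) (h : E → ℂ) (x : κ → E) :
    (∏ j, h (x j)) * ((‖slater u x‖ ^ 2 : ℝ) : ℂ) =
      ∑ σ : Equiv.Perm κ, ∑ τ : Equiv.Perm κ, ((Equiv.Perm.sign σ : ℤ) : ℂ) *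
        (((Equiv.Perm.sign τ : ℤ) : ℂ) *
        ∏ j, star ((u (σ j) : E → ℂ) (x j)) * (h (x j) * (u (τ j) : E → ℂ) (x j))) := by
  have e : ((‖slater u x‖ ^ 2 : ℝ) : ℂ) = star (slater u x) * slater u x := by
    rw [Complex.ofReal_pow]
    exact (RCLike.conj_mul _).symm
  rw [e, slater, Matrix.det_apply', star_sum, Finset.sum_mul_sum, Finset.mul_sum]
  refine Finset.sum_congr rfl fun σ _ => ?_
  rw [Finset.mul_sum]
  refine Finset.sum_congr rfl fun τ _ => ?_
  simp only [Matrix.of_apply, star_mul', star_prod, Finset.prod_mul_distrib]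
  have : star (((Equiv.Perm.sign σ : ℤ) : ℂ)) = ((Equiv.Perm.sign σ : ℤ) : ℂ) := by simp
  rw [this]
  ring

theorem integrable_star_mul_mul {h : E → ℂ} (hh : MemLp h ∞ μ) (u v : L2 μ) :
    Integrable (fun y => star ((u : E → ℂ) y) * (h y * (v : E → ℂ) y)) μ := by
  refine (L2.integrable_inner (𝕜 := ℂ) u (mulOp μ h v)).congr ?_
  filter_upwards [coeFn_mulOp μ hh v] with y hy
  rw [hy, RCLike.inner_apply, mul_comm]
  rfl

theorem integral_star_mul_mul {h : E → ℂ} (hh : MemLp h ∞ μ) (u v : L2 μ) :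
    ∫ y, star ((u : E → ℂ) y) * (h y * (v : E → ℂ) y) ∂μ = inner ℂ u (mulOp μ h v) := by
  rw [L2.inner_def]
  refine integral_congr_ae ?_
  filter_upwards [coeFn_mulOp μ hh v] with y hy
  rw [hy, RCLike.inner_apply, mul_comm]
  rfl

/-- **Andréief's identity.** -/
theorem integral_prod_mul_normSq_slater (u : κ → L2 μ) {h : E → ℂ} (hh : MemLp h ∞ μ) :
    ∫ x : κ → E, (∏ j, h (x j)) * ((‖slater u x‖ ^ 2 : ℝ) : ℂ) ∂(Measure.pi fun _ => μ) =
      (Fintype.card κ).factorial * (Matrix.of fun i j => inner ℂ (u i) (mulOp μ h (u j))).det := by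
  have hint : ∀ σ τ : Equiv.Perm κ, Integrable (fun x : κ → E =>
      ∏ j, star ((u (σ j) : E → ℂ) (x j)) * (h (x j) * (u (τ j) : E → ℂ) (x j)))
      (Measure.pi fun _ => μ) := fun σ τ =>
    Integrable.fintype_prod fun j => integrable_star_mul_mul hh _ _
  set M : Matrix κ κ ℂ := Matrix.of fun i j => inner ℂ (u i) (mulOp μ h (u j)) with hM
  simp_rw [prod_mul_normSq_slater]
  rw [integral_finsetSum _ fun σ _ => integrable_finsetSum _ fun τ _ =>
    ((hint σ τ).const_mul _).const_mul _]
  -- Every σ contributes the same: the sum over τ is the determinant with rows permuted by σ, so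
  -- sign σ occurs twice.
  have h1 : ∀ σ : Equiv.Perm κ, ∫ x : κ → E, ∑ τ : Equiv.Perm κ, ((Equiv.Perm.sign σ : ℤ) : ℂ) *
        (((Equiv.Perm.sign τ : ℤ) : ℂ) *
        ∏ j, star ((u (σ j) : E → ℂ) (x j)) * (h (x j) * (u (τ j) : E → ℂ) (x j)))
        ∂(Measure.pi fun _ => μ) = M.det := by
    intro σ
    rw [integral_finsetSum _ fun τ _ => ((hint σ τ).const_mul _).const_mul _]
    have h2 : ∀ τ : Equiv.Perm κ, ∫ x : κ → E, ((Equiv.Perm.sign σ : ℤ) : ℂ) *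
        (((Equiv.Perm.sign τ : ℤ) : ℂ) *
        ∏ j, star ((u (σ j) : E → ℂ) (x j)) * (h (x j) * (u (τ j) : E → ℂ) (x j)))
        ∂(Measure.pi fun _ => μ) = ((Equiv.Perm.sign σ : ℤ) : ℂ) *
        (((Equiv.Perm.sign τ : ℤ) : ℂ) * ∏ j, (M.submatrix σ id).transpose (τ j) j) := by
      intro τ
      rw [integral_const_mul, integral_const_mul, integral_fintype_prod_eq_prod (𝕜 := ℂ)
        (fun j y => star ((u (σ j) : E → ℂ) y) * (h y * (u (τ j) : E → ℂ) y))]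
      simp_rw [integral_star_mul_mul hh]
      rfl
    simp_rw [h2]
    rw [← Finset.mul_sum, ← Matrix.det_apply', Matrix.det_transpose, Matrix.det_permute,
      ← mul_assoc]
    have h3 : (((Equiv.Perm.sign σ : ℤˣ) : ℤ) : ℂ) * (((Equiv.Perm.sign σ : ℤˣ) : ℤ) : ℂ) = 1 := by
      rw [← Int.cast_mul, Int.units_coe_mul_self, Int.cast_one]
    rw [h3, one_mul]
  simp_rw [h1]
  rw [Finset.sum_const, Finset.card_univ, Fintype.card_perm, nsmul_eq_mul]

end FiniteRank

/-! ### Determinantal processes of finite rank. -/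

section FiniteProcess

variable {E : Type*} [TopologicalSpace E] [PolishSpace E] [LocallyCompactSpace E]
  [MeasurableSpace E] [BorelSpace E] {μ : Measure E} [SigmaFinite μ]
  {κ : Type*} [Fintype κ] [DecidableEq κ]

/-- The law of the points of a finite rank projection process. -/
def slaterMeasure (u : κ → L2 μ) : Measure (κ → E) :=
  (Measure.pi fun _ => μ).withDensity fun x =>
    ENNReal.ofReal (‖slater u x‖ ^ 2 / (Fintype.card κ).factorial)

theorem integral_slaterMeasure (u : κ → L2 μ) {h : E → ℂ} (hh : MemLp h ∞ μ) :
    ∫ x, ∏ j, h (x j) ∂(slaterMeasure u) =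
      (Matrix.of fun i j => inner ℂ (u i) (mulOp μ h (u j))).det := by
  have hm : Measurable fun x : κ → E =>
      ENNReal.ofReal (‖slater u x‖ ^ 2 / (Fintype.card κ).factorial) := by
    have := measurable_slater u
    fun_prop
  rw [slaterMeasure, integral_withDensity_eq_integral_toReal_smul hm
    (ae_of_all _ fun _ => ENNReal.ofReal_lt_top)]
  have e : ∀ x : κ → E, (ENNReal.ofReal (‖slater u x‖ ^ 2 / (Fintype.card κ).factorial)).toReal •
      ∏ j, h (x j) = ((Fintype.card κ).factorial : ℂ)⁻¹ *
        ((∏ j, h (x j)) * ((‖slater u x‖ ^ 2 : ℝ) : ℂ)) := by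
    intro x
    rw [ENNReal.toReal_ofReal (by positivity), Complex.real_smul]
    push_cast
    ring
  simp_rw [e]
  rw [integral_const_mul, integral_prod_mul_normSq_slater u hh, ← mul_assoc, inv_mul_cancel₀,
    one_mul]
  exact_mod_cast Nat.factorial_ne_zero _

/-- For the test function 1 the formula gives the total mass as the Gram determinant of an
orthonormal family. -/
theorem isProbabilityMeasure_slaterMeasure {u : κ → L2 μ} (hu : Orthonormal ℂ u) :
    IsProbabilityMeasure (slaterMeasure u) := by
  have h1 : MemLp (fun _ : E => (1 : ℂ)) ∞ μ :=
    memLp_top_of_measurable measurable_const (C := 1) fun _ => by simp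
  have hi := integral_slaterMeasure u h1
  have hdet : (Matrix.of fun i j => inner ℂ (u i) (mulOp μ (fun _ => 1) (u j))) = 1 := by
    ext i j
    rw [mulOp_one]
    simp [orthonormal_iff_ite.1 hu i j, Matrix.one_apply]
  rw [hdet, Matrix.det_one] at hi
  simp only [Finset.prod_const_one, integral_const, Complex.real_smul, mul_one] at hi
  refine ⟨?_⟩
  have h2 : (slaterMeasure u).real Set.univ = 1 := by exact_mod_cast hi
  rw [Measure.real] at h2
  rw [← ENNReal.ofReal_toReal (a := slaterMeasure u Set.univ), h2, ENNReal.ofReal_one]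
  intro h
  rw [h] at h2
  simp at h2

/-- The determinantal process of a finite rank projection. -/
def finiteProcess {u : κ → L2 μ} (hu : Orthonormal ℂ u) : ProbabilityMeasure (Conf E) :=
  ⟨(slaterMeasure u).map Conf.ofFun,
    haveI := isProbabilityMeasure_slaterMeasure hu
    Measure.isProbabilityMeasure_map Conf.continuous_ofFun.measurable.aemeasurable⟩

theorem toMeasure_finiteProcess {u : κ → L2 μ} (hu : Orthonormal ℂ u) :
    (finiteProcess hu : Measure (Conf E)) = (slaterMeasure u).map Conf.ofFun := rfl

theorem integral_finiteProcess {u : κ → L2 μ} (hu : Orthonormal ℂ u) (φ : C_c(E, ℂ)) :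
    ∫ X, Complex.exp (Conf.stat φ X) ∂(finiteProcess hu : Measure (Conf E)) =
      (Matrix.of fun i j => inner ℂ (u i) (mulOp μ (fun x => Complex.exp (φ x)) (u j))).det := by
  have hφ : ∀ x : κ → E, Conf.stat φ (Conf.ofFun x) = ∑ a, φ (x a) := fun x =>
    Conf.stat_ofFun x φ.hasCompactSupport.isCompact fun _ hy => image_eq_zero_of_notMem_tsupport hy
  have hc : Continuous fun X : Conf E => Complex.exp (Conf.stat φ X) :=
    Complex.continuous_exp.comp (Conf.continuous_stat φ)
  rw [toMeasure_finiteProcess, integral_map Conf.continuous_ofFun.measurable.aemeasurable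
    hc.aestronglyMeasurable]
  simp_rw [hφ, Complex.exp_sum]
  obtain ⟨C, hC⟩ := φ.hasCompactSupport.exists_bound_of_continuous φ.continuous
  refine integral_slaterMeasure u (h := fun y => Complex.exp (φ y))
    (memLp_top_of_measurable (C := Real.exp C) ?_ fun x => ?_)
  · exact (Complex.continuous_exp.comp φ.continuous).measurable
  · rw [Complex.norm_exp]
    exact Real.exp_le_exp.2 ((Complex.re_le_norm _).trans (hC x))

/-- The partial sum of the orthonormal expansion. -/
def partialProj (u : κ → L2 μ) (x : L2 μ) : L2 μ :=
  ∑ l, inner ℂ (u l) x • u l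

theorem inner_partialProj {u : κ → L2 μ} (hu : Orthonormal ℂ u) (x y : L2 μ) :
    inner ℂ (partialProj u x) (partialProj u y) = ∑ l, inner ℂ x (u l) * inner ℂ (u l) y := by
  rw [partialProj, partialProj, hu.inner_sum]
  simp [inner_conj_symm]

theorem norm_partialProj_sq {u : κ → L2 μ} (hu : Orthonormal ℂ u) (x : L2 μ) :
    ‖partialProj u x‖ ^ 2 = ∑ l, ‖inner ℂ (u l) x‖ ^ 2 := by
  have h := inner_partialProj hu x x
  rw [inner_self_eq_norm_sq_to_K] at h
  have e : ∀ l, inner ℂ x (u l) * inner ℂ (u l) x = ((‖inner ℂ (u l) x‖ ^ 2 : ℝ) : ℂ) := fun l => by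
    rw [← inner_conj_symm, RCLike.conj_mul]
    simp
  simp_rw [e] at h
  rw [← Complex.ofReal_sum] at h
  refine Complex.ofReal_injective ?_
  rw [← h, Complex.ofReal_pow]
  rfl

/-- The Laplace functional of a finite rank projection process as a sum of Gram minors. -/
theorem det_inner_mulOp_eq {u : κ → L2 μ} (hu : Orthonormal ℂ u) {f : E → ℂ} (hf : MemLp f ∞ μ)
    (hf' : MemLp (fun x => star (f x)) ∞ μ) {B : Set E} (hB : MeasurableSet B)
    (h0 : ∀ x ∉ B, f x = 0)
    (hs : Summable fun i => ‖partialProj u (mulOp μ (fun x => star (f x)) (basis (L2 μ) i))‖ *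
      ‖partialProj u (chi μ B (basis (L2 μ) i))‖) :
    (Matrix.of fun i j => inner ℂ (u i) (mulOp μ (fun x => 1 + f x) (u j))).det =
      ∑' S, gramMinor
        (fun i => partialProj u (mulOp μ (fun x => star (f x)) (basis (L2 μ) i)))
        (fun i => partialProj u (chi μ B (basis (L2 μ) i))) S := by
  have hadj : ∀ x y, inner ℂ (mulOp μ (fun x => star (f x)) x) y = inner ℂ x (mulOp μ f y) := by
    intro x y
    rw [← star_mulOp hf hf', ContinuousLinearMap.star_eq_adjoint,
      ContinuousLinearMap.adjoint_inner_left]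
  have hadj' : ∀ x y, inner ℂ (chi μ B x) y = inner ℂ x (chi μ B y) := by
    intro x y
    rw [← ContinuousLinearMap.adjoint_inner_right, ← ContinuousLinearMap.star_eq_adjoint,
      star_chi hB]
  have hone : MemLp (fun _ : E => (1 : ℂ)) ∞ μ :=
    memLp_top_of_measurable measurable_const (C := 1) fun _ => by simp
  have hM : (Matrix.of fun i j => inner ℂ (u i) (mulOp μ (fun x => 1 + f x) (u j))) =
      1 + Matrix.of fun i j => inner ℂ (u i) (mulOp μ f (u j)) := by
    ext i j
    rw [← mulOp_add hone hf, mulOp_one]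
    simp [inner_add_right, orthonormal_iff_ite.1 hu i j, Matrix.one_apply]
  rw [hM, eq_comm]
  -- By Parseval over the basis index, the product in the other order has entries ⟨χ_B u_k, f u_l⟩,
  -- and χ_B drops out because `f` vanishes off `B`.
  refine tsum_gramMinor_eq_det hs
    (fun i l => inner ℂ (basis (L2 μ) i) (mulOp μ f (u l)))
    (fun l i => inner ℂ (chi μ B (u l)) (basis (L2 μ) i)) _ (fun i j => ?_) fun k l => ?_
  · rw [inner_partialProj hu]
    refine Finset.sum_congr rfl fun l _ => ?_
    rw [hadj, hadj']
  · have h := (basis (L2 μ)).hasSum_inner_mul_inner (chi μ B (u k)) (mulOp μ f (u l))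
    rw [hadj', ← mul_apply_eq_comp, chi_mul_mulOp hB hf h0] at h
    exact h

end FiniteProcess

/-! ### Weak convergence against unbounded continuous functions. -/

section Truncation

variable {Ω : Type*} [TopologicalSpace Ω] [MeasurableSpace Ω] [BorelSpace Ω] {α : Type*}
  {l : Filter α}

/-- Fatou's lemma for weak convergence. -/
theorem lintegral_le_of_tendsto [l.NeBot] {Pa : α → ProbabilityMeasure Ω}
    {Q : ProbabilityMeasure Ω} (h : Tendsto Pa l (𝓝 Q)) {W : Ω → NNReal} (hW : Continuous W)
    {C : ℝ≥0∞} (hC : ∀ a, ∫⁻ x, W x ∂(Pa a : Measure Ω) ≤ C) :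
    ∫⁻ x, W x ∂(Q : Measure Ω) ≤ C := by
  -- Weak convergence tests only bounded functions. The truncation at level `n` is removed by
  -- monotone convergence.
  have h1 : ∀ n : ℕ, ∫⁻ x, ((min (W x) n : NNReal) : ℝ≥0∞) ∂(Q : Measure Ω) ≤ C := by
    intro n
    let w : BoundedContinuousFunction Ω NNReal :=
      BoundedContinuousFunction.mkOfBound ⟨fun x => min (W x) n, by fun_prop⟩ n fun x y => by
        rw [NNReal.dist_eq]
        have hx : ((min (W x) n : NNReal) : ℝ) ≤ n := by exact_mod_cast min_le_right (W x) n
        have hy : ((min (W y) n : NNReal) : ℝ) ≤ n := by exact_mod_cast min_le_right (W y) n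
        have hx' : 0 ≤ ((min (W x) n : NNReal) : ℝ) := NNReal.coe_nonneg _
        have hy' : 0 ≤ ((min (W y) n : NNReal) : ℝ) := NNReal.coe_nonneg _
        exact abs_le.2 ⟨by simp, by simp⟩
    have h2 := ProbabilityMeasure.tendsto_iff_forall_lintegral_tendsto.1 h w
    refine le_of_tendsto' h2 fun a => (lintegral_mono fun x => ?_).trans (hC a)
    exact ENNReal.coe_le_coe.2 (min_le_left _ _)
  have h3 : ∀ x, (W x : ℝ≥0∞) = ⨆ n : ℕ, ((min (W x) n : NNReal) : ℝ≥0∞) := by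
    intro x
    refine le_antisymm ?_ (iSup_le fun n => ENNReal.coe_le_coe.2 (min_le_left _ _))
    obtain ⟨n, hn⟩ := exists_nat_ge (W x)
    exact le_iSup_of_le n (by rw [min_eq_left hn])
  simp_rw [h3]
  rw [lintegral_iSup]
  · exact iSup_le h1
  · intro n
    have : Continuous fun x => ((min (W x) n : NNReal) : ℝ≥0∞) := by fun_prop
    exact this.measurable
  · intro m n hmn x
    exact ENNReal.coe_le_coe.2 (min_le_min le_rfl (by exact_mod_cast hmn))

theorem integrable_of_sq {Q : ProbabilityMeasure Ω} {Z : Ω → ℂ} (hZ : Continuous Z) {C : NNReal}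
    (h : ∫⁻ x, ((‖Z x‖₊ ^ 2 : NNReal) : ℝ≥0∞) ∂(Q : Measure Ω) ≤ C) :
    Integrable (fun x => ‖Z x‖ ^ 2) (Q : Measure Ω) ∧ Integrable Z (Q : Measure Ω) ∧
      ∫ x, ‖Z x‖ ^ 2 ∂(Q : Measure Ω) ≤ C := by
  have hn : ∀ x, ENNReal.ofReal (‖Z x‖ ^ 2) = ((‖Z x‖₊ ^ 2 : NNReal) : ℝ≥0∞) := fun x => by
    rw [ENNReal.ofReal_pow (norm_nonneg _), ofReal_norm, enorm_eq_nnnorm, ENNReal.coe_pow]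
  have h1 : Integrable (fun x => ‖Z x‖ ^ 2) (Q : Measure Ω) := by
    refine ⟨(hZ.norm.pow 2).aestronglyMeasurable, ?_⟩
    rw [hasFiniteIntegral_iff_ofReal (ae_of_all _ fun x => by positivity)]
    simp_rw [hn]
    exact h.trans_lt ENNReal.coe_lt_top
  refine ⟨h1, ?_, ?_⟩
  · refine (h1.add (integrable_const (1 : ℝ))).mono hZ.aestronglyMeasurable
      (ae_of_all _ fun x => ?_)
    simp only [Pi.add_apply, Real.norm_eq_abs]
    rw [abs_of_nonneg (by positivity)]
    nlinarith [sq_nonneg (‖Z x‖ - 1), norm_nonneg (Z x)]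
  · rw [integral_eq_lintegral_of_nonneg_ae (ae_of_all _ fun x => by positivity) h1.1]
    simp_rw [hn]
    exact ENNReal.toReal_le_of_le_ofReal C.2 (by simpa using h)

/-- The map z / (1 + δ²|z|²) is a continuous bounded truncation whose error is paid by a second
moment: with s = δ|z| the claim is s ≤ 1 + s². -/
theorem norm_sub_truncate_le {δ : ℝ} (hδ : 0 < δ) (z : ℂ) :
    ‖z - ((1 + δ ^ 2 * ‖z‖ ^ 2 : ℝ) : ℂ)⁻¹ * z‖ ≤ δ * ‖z‖ ^ 2 := by
  have hp : 0 < 1 + δ ^ 2 * ‖z‖ ^ 2 := by positivity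
  have e : z - ((1 + δ ^ 2 * ‖z‖ ^ 2 : ℝ) : ℂ)⁻¹ * z =
      ((δ ^ 2 * ‖z‖ ^ 2 / (1 + δ ^ 2 * ‖z‖ ^ 2) : ℝ) : ℂ) * z := by
    have : ((1 + δ ^ 2 * ‖z‖ ^ 2 : ℝ) : ℂ) ≠ 0 := by exact_mod_cast hp.ne'
    rw [Complex.ofReal_div]
    field_simp
    push_cast
    ring
  rw [e, norm_mul, Complex.norm_real, Real.norm_of_nonneg (by positivity), div_mul_eq_mul_div,
    div_le_iff₀ hp]
  have h0 := norm_nonneg z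
  nlinarith [mul_nonneg (mul_nonneg hδ.le (sq_nonneg ‖z‖)) (sq_nonneg (δ * ‖z‖ - 1)),
    mul_nonneg (mul_nonneg hδ.le (sq_nonneg ‖z‖)) (mul_nonneg hδ.le h0)]

theorem norm_truncate_le {δ : ℝ} (hδ : 0 < δ) (z : ℂ) :
    ‖((1 + δ ^ 2 * ‖z‖ ^ 2 : ℝ) : ℂ)⁻¹ * z‖ ≤ δ⁻¹ := by
  have hp : 0 < 1 + δ ^ 2 * ‖z‖ ^ 2 := by positivity
  rw [norm_mul, norm_inv, Complex.norm_real, Real.norm_of_nonneg hp.le, inv_mul_le_iff₀ hp,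
    ← div_eq_mul_inv, le_div_iff₀ hδ]
  nlinarith [sq_nonneg (δ * ‖z‖ - 1), norm_nonneg z, mul_nonneg hδ.le (norm_nonneg z)]

/-- Expectations of square-integrable continuous functions converge under weak convergence. -/
theorem tendsto_integral_of_sq_bound [l.NeBot] {Pa : α → ProbabilityMeasure Ω}
    {Q : ProbabilityMeasure Ω} (h : Tendsto Pa l (𝓝 Q)) {Z : Ω → ℂ} (hZ : Continuous Z)
    {C : NNReal} (hC : ∀ a, ∫⁻ x, ((‖Z x‖₊ ^ 2 : NNReal) : ℝ≥0∞) ∂(Pa a : Measure Ω) ≤ C) :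
    Integrable Z (Q : Measure Ω) ∧
      Tendsto (fun a => ∫ x, Z x ∂(Pa a : Measure Ω)) l (𝓝 (∫ x, Z x ∂(Q : Measure Ω))) := by
  have hQ : ∫⁻ x, ((‖Z x‖₊ ^ 2 : NNReal) : ℝ≥0∞) ∂(Q : Measure Ω) ≤ C :=
    lintegral_le_of_tendsto h (hZ.nnnorm.pow 2) hC
  refine ⟨(integrable_of_sq hZ hQ).2.1, ?_⟩
  rw [Metric.tendsto_nhds]
  intro ε hε
  obtain ⟨δ, hδ, hδC⟩ : ∃ δ : ℝ, 0 < δ ∧ δ * C < ε / 3 := by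
    refine ⟨ε / 3 / (C + 1), by positivity, ?_⟩
    rw [div_mul_eq_mul_div, div_lt_iff₀ (by positivity)]
    nlinarith [C.2]
  let w : BoundedContinuousFunction Ω ℂ :=
    BoundedContinuousFunction.ofNormedAddCommGroup
      (fun x => ((1 + δ ^ 2 * ‖Z x‖ ^ 2 : ℝ) : ℂ)⁻¹ * Z x)
      (by
        refine (Continuous.inv₀ (by fun_prop) fun x => ?_).mul hZ
        have hp : 0 < 1 + δ ^ 2 * ‖Z x‖ ^ 2 := by positivity
        exact_mod_cast hp.ne') δ⁻¹ fun x => norm_truncate_le hδ _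
  have hw : ∀ P : ProbabilityMeasure Ω,
      ∫⁻ x, ((‖Z x‖₊ ^ 2 : NNReal) : ℝ≥0∞) ∂(P : Measure Ω) ≤ C →
      dist (∫ x, Z x ∂(P : Measure Ω)) (∫ x, w x ∂(P : Measure Ω)) < ε / 3 := by
    intro P hP
    obtain ⟨i1, i2, i3⟩ := integrable_of_sq hZ hP
    rw [dist_eq_norm, ← integral_sub i2 (w.integrable _)]
    refine (norm_integral_le_of_norm_le (i1.const_mul δ)
      (ae_of_all _ fun x => norm_sub_truncate_le hδ (Z x))).trans_lt ?_
    rw [integral_const_mul]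
    exact (mul_le_mul_of_nonneg_left i3 hδ.le).trans_lt hδC
  have hlim := (ProbabilityMeasure.tendsto_iff_forall_integral_rclike_tendsto ℂ).1 h w
  filter_upwards [Metric.tendsto_nhds.1 hlim (ε / 3) (by positivity)] with a ha
  have t1 := hw _ (hC a)
  have t2 := hw Q hQ
  have t3 := dist_triangle4 (∫ x, Z x ∂(Pa a : Measure Ω)) (∫ x, w x ∂(Pa a : Measure Ω))
    (∫ x, w x ∂(Q : Measure Ω)) (∫ x, Z x ∂(Q : Measure Ω))
  rw [dist_comm (∫ x, w x ∂(Q : Measure Ω))] at t3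
  linarith

end Truncation

/-! ### Compact sets of configurations and tightness. -/

namespace Conf

section Compact

/-- A finite multiset of at most `M` points can be listed as a partially defined family. -/
theorem exists_listing {E : Type*} (s : Finset E) (m : E → ℕ) {M : ℕ} (h : ∑ y ∈ s, m y ≤ M) :
    ∃ f : Fin M → Option E, (∀ i y, f i = some y → y ∈ s) ∧
      ∀ y ∈ s, {i | f i = some y}.ncard = m y := by
  classical
  -- Particles are pairs of an atom and a copy number. They embed into the `M` slots, and slots
  -- outside the image stay `none`.
  let T := Σ y : s, Fin (m y)
  have hT : Fintype.card T ≤ Fintype.card (Fin M) := by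
    simp only [T, Fintype.card_sigma, Fintype.card_fin]
    rwa [Finset.sum_coe_sort s m]
  obtain ⟨e⟩ := Function.Embedding.nonempty_of_card_le hT
  have he := e.injective.isPartialInv
  refine ⟨fun i => (Function.partialInv e i).map fun t => (t.1 : E), ?_, ?_⟩
  · intro i y hi
    obtain ⟨t, -, rfl⟩ := Option.map_eq_some_iff.1 hi
    exact t.1.2
  · intro y hy
    have h1 : {i | (Function.partialInv e i).map (fun t => (t.1 : E)) = some y} =
        Set.range fun k : Fin (m y) => e ⟨⟨y, hy⟩, k⟩ := by
      ext i
      simp only [Set.mem_ofPred_eq, Option.map_eq_some_iff, Set.mem_range]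
      constructor
      · rintro ⟨⟨⟨z, hz⟩, k⟩, h1, rfl⟩
        exact ⟨k, (he _ _).1 h1⟩
      · rintro ⟨k, rfl⟩
        exact ⟨_, (he _ _).2 rfl, rfl⟩
    have hinj : Function.Injective fun k : Fin (m y) => e ⟨⟨y, hy⟩, k⟩ := fun k k' hk => by
      exact eq_of_heq (Sigma.mk.inj_iff.1 (e.injective hk)).2
    rw [h1, ← Set.image_univ, Set.ncard_image_of_injective _ hinj, Set.ncard_univ,
      Nat.card_eq_fintype_card, Fintype.card_fin]

variable {E : Type*} [TopologicalSpace E] [PolishSpace E] [LocallyCompactSpace E]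

/-- Annuli of a compact exhaustion. -/
def annulus (K : CompactExhaustion E) : ℕ → Set E
  | 0 => K 0
  | n + 1 => K (n + 1) \ interior (K n)

theorem isCompact_annulus (K : CompactExhaustion E) : ∀ n, IsCompact (annulus K n)
  | 0 => K.isCompact 0
  | n + 1 => (K.isCompact (n + 1)).diff isOpen_interior

theorem disjointed_subset_annulus (K : CompactExhaustion E) :
    ∀ n, disjointed (fun n => K n) n ⊆ annulus K n
  | 0 => by rw [disjointed_zero]; exact subset_rfl
  | n + 1 => by
    have hm : Monotone fun n => K n := fun _ _ h => K.subset h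
    rw [hm.disjointed_add_one]
    exact Set.sdiff_subset_sdiff_right interior_subset

theorem disjoint_annulus (K : CompactExhaustion E) {C : Set E} {N n : ℕ} (hC : C ⊆ interior (K N))
    (hn : N < n) : Disjoint C (annulus K n) := by
  obtain ⟨k, rfl⟩ : ∃ k, n = k + 1 := ⟨n - 1, by omega⟩
  rw [Set.disjoint_left]
  intro x hx hx'
  exact hx'.2 (interior_mono (K.subset (by omega : N ≤ k)) (hC hx))

theorem exists_subset_interior (K : CompactExhaustion E) {C : Set E} (hC : IsCompact C) :
    ∃ N, C ⊆ interior (K N) := by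
  obtain ⟨n, hn⟩ := K.exists_superset_of_isCompact hC
  exact ⟨n + 1, hn.trans (K.subset_interior_succ n)⟩

/-- The points of a family in the annuli. -/
def toOption {A : Set E} : A ⊕ Unit → Option E :=
  Sum.elim (fun y => some y) fun _ => none

theorem mem_of_toOption {A : Set E} {z : A ⊕ Unit} {y : E} (h : toOption z = some y) : y ∈ A := by
  rcases z with z | z
  · simp only [toOption, Sum.elim_inl, Option.some.injEq] at h
    exact h ▸ z.2
  · simp [toOption] at h

theorem finite_family (K : CompactExhaustion E) (M : ℕ → ℕ) {C : Set E} (hC : IsCompact C)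
    (z : ∀ p : Σ j, Fin (M j), annulus K p.1 ⊕ Unit) :
    {p | ∃ y ∈ C, toOption (z p) = some y}.Finite := by
  obtain ⟨N, hN⟩ := exists_subset_interior K hC
  refine ((Finset.range (N + 1)).sigma fun j =>
    (Finset.univ : Finset (Fin (M j)))).finite_toSet.subset ?_
  rintro p ⟨y, hy, hp⟩
  simp only [Finset.coe_sigma, Finset.coe_univ, Set.mem_sigma_iff, Finset.mem_coe,
    Finset.mem_range, Set.mem_univ, and_true]
  by_contra h
  exact Set.disjoint_left.1 (disjoint_annulus K hN (by omega)) hy (mem_of_toOption hp)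

/-- The configuration with at most `M j` points in the `j`-th annulus given by a family. -/
def ofAnnuli (K : CompactExhaustion E) (M : ℕ → ℕ)
    (z : ∀ p : Σ j, Fin (M j), annulus K p.1 ⊕ Unit) : Conf E :=
  ofFamily (fun p => toOption (z p)) fun _ hC => finite_family K M hC z

/-- A test function meets only finitely many annuli, so its statistic is a finite sum of continuous
functions of single coordinates. -/
theorem continuous_ofAnnuli (K : CompactExhaustion E) (M : ℕ → ℕ) :
    Continuous (ofAnnuli K M) := by
  refine continuous_induced_rng.2 (continuous_pi fun φ => ?_)
  obtain ⟨N, hN⟩ := exists_subset_interior K φ.hasCompactSupport.isCompact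
  have h0 : ∀ x ∉ tsupport φ, φ x = 0 := fun x hx => image_eq_zero_of_notMem_tsupport hx
  have h : ∀ z, linStat φ (ofAnnuli K M z) =
      ∑ p ∈ (Finset.range (N + 1)).sigma fun j => (Finset.univ : Finset (Fin (M j))),
        Sum.elim (fun y : annulus K p.1 => φ y) (fun _ => 0) (z p) := by
    intro z
    have hel : ∀ p, (toOption (z p)).elim 0 φ =
        Sum.elim (fun y : annulus K p.1 => φ y) (fun _ => 0) (z p) := by
      intro p
      rcases z p with y | y <;> rfl
    rw [linStat_eq_stat, ofAnnuli, stat_ofFamily _ _ φ.hasCompactSupport.isCompact h0]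
    simp_rw [hel]
    refine Finset.sum_subset ?_ ?_
    · intro p hp
      obtain ⟨y, hy, hpy⟩ := (Set.Finite.mem_toFinset _).1 hp
      simp only [Finset.mem_sigma, Finset.mem_range, Finset.mem_univ, and_true]
      by_contra h
      exact Set.disjoint_left.1 (disjoint_annulus K hN (by omega)) hy (mem_of_toOption hpy)
    · intro p _ hp
      rw [← hel]
      rcases hz : toOption (z p) with _ | y
      · rfl
      · exact h0 _ fun hy => hp ((Set.Finite.mem_toFinset _).2 ⟨y, hy, hz⟩)
  simp only [Function.comp_def, h]
  refine continuous_finsetSum _ fun p _ => ?_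
  exact ((φ.continuous.comp continuous_subtype_val).sumElim continuous_const).comp
    (continuous_apply p)

/-- The annuli are closed, for compactness, and may overlap along boundaries. Each atom is therefore
listed only in the disjointed shell containing it, which lies in the annulus of the same index. -/
theorem mem_range_ofAnnuli (K : CompactExhaustion E) (M : ℕ → ℕ) {X : Conf E}
    (hX : ∀ j, ∑ y ∈ (X.finite_inter _ (isCompact_annulus K j)).toFinset, X.mult y ≤ M j) :
    X ∈ Set.range (ofAnnuli K M) := by
  classical
  set D := disjointed (fun n => K n) with hD
  have hDK : ∀ j, D j ⊆ annulus K j := disjointed_subset_annulus K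
  have hDu : ∀ y, ∃ j, y ∈ D j := fun y => by
    have : y ∈ ⋃ n, D n := by
      rw [hD, iUnion_disjointed, K.iUnion_eq]
      trivial
    exact Set.mem_iUnion.1 this
  have hf : ∀ j, ∃ f : Fin (M j) → Option E,
      (∀ i y, f i = some y → y ∈ D j) ∧ ∀ y ∈ D j, {i | f i = some y}.ncard = X.mult y := by
    intro j
    set s := (X.finite_inter _ (isCompact_annulus K j)).toFinset with hs
    obtain ⟨f, hf1, hf2⟩ := exists_listing (s.filter (· ∈ D j)) X.mult
      ((Finset.sum_le_sum_of_subset (Finset.filter_subset _ _)).trans (hX j))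
    refine ⟨f, fun i y hi => (Finset.mem_filter.1 (hf1 i y hi)).2, fun y hy => ?_⟩
    by_cases hy0 : X.mult y = 0
    · rw [hy0, Set.ncard_eq_zero]
      ext i
      simp only [Set.mem_ofPred_eq, Set.mem_empty_iff_false, iff_false]
      intro hi
      have h1 := (Set.Finite.mem_toFinset _).1 (Finset.mem_filter.1 (hf1 i y hi)).1
      exact h1.1 hy0
    · exact hf2 y (Finset.mem_filter.2 ⟨(Set.Finite.mem_toFinset _).2 ⟨hy0, hDK j hy⟩, hy⟩)
  choose f hf1 hf2 using hf
  have hz : ∀ p : Σ j, Fin (M j), ∃ z : annulus K p.1 ⊕ Unit, toOption z = f p.1 p.2 := by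
    intro p
    rcases h : f p.1 p.2 with _ | y
    · exact ⟨.inr (), rfl⟩
    · exact ⟨.inl ⟨y, hDK _ (hf1 _ _ _ h)⟩, rfl⟩
  choose z hz using hz
  refine ⟨z, Conf.ext (funext fun y => ?_)⟩
  obtain ⟨j, hj⟩ := hDu y
  have hset : {p | toOption (z p) = some y} = Sigma.mk j '' {i | f j i = some y} := by
    ext ⟨k, i⟩
    simp only [Set.mem_ofPred_eq, hz, Set.mem_image]
    constructor
    · intro h
      have hkj : k = j := by
        by_contra hne
        exact Set.disjoint_left.1 (disjoint_disjointed (fun n => K n) hne) (hf1 _ _ _ h) hj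
      subst hkj
      exact ⟨i, h, rfl⟩
    · rintro ⟨i', h, heq⟩
      obtain ⟨rfl, h2⟩ := Sigma.mk.inj_iff.1 heq
      rwa [← eq_of_heq h2]
  calc (ofAnnuli K M z).mult y = {p | toOption (z p) = some y}.ncard := rfl
    _ = X.mult y := by
      rw [hset, Set.ncard_image_of_injective _ sigma_mk_injective, hf2 j y hj]

/-- Tychonoff: the domain is a product of compact annuli, each with one extra point meaning absence.
-/
theorem isCompact_range_ofAnnuli (K : CompactExhaustion E) (M : ℕ → ℕ) :
    IsCompact (Set.range (ofAnnuli K M)) := by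
  have : ∀ j, CompactSpace (annulus K j) := fun j =>
    isCompact_iff_compactSpace.1 (isCompact_annulus K j)
  exact isCompact_range (continuous_ofAnnuli K M)

variable [MeasurableSpace E] [BorelSpace E]

/-- A family of point processes with uniformly bounded exponential moments is tight. -/
theorem isTightMeasureSet_of_exp_bound {S : Set (ProbabilityMeasure (Conf E))}
    (h : ∀ φ : C_c(E, ℝ), ∃ C : NNReal, ∀ Q ∈ S,
      ∫⁻ X, ENNReal.ofReal (Real.exp (linStat φ X)) ∂(Q : Measure (Conf E)) ≤ C) :
    IsTightMeasureSet {((Q : ProbabilityMeasure (Conf E)) : Measure (Conf E)) | Q ∈ S} := by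
  rw [isTightMeasureSet_iff_exists_isCompact_measure_compl_le]
  intro ε hε
  obtain ⟨K⟩ : Nonempty (CompactExhaustion E) := inferInstance
  choose χ hχ1 _ hχ01 using fun k =>
    exists_bump (isCompact_annulus K k) isOpen_univ (Set.subset_univ _)
  choose C hC using fun k => h (χ k)
  obtain ⟨δ, hδ0, hδ⟩ := ENNReal.exists_pos_sum_of_countable hε.ne' ℕ
  -- By Markov's inequality for the exponential moment, more than `M k` particles in the `k`-th
  -- annulus then have probability at most `δ k`, and these sum to less than ε.
  have hM : ∀ k, ∃ M : ℕ, (C k : ℝ≥0∞) / ENNReal.ofReal (Real.exp M) ≤ δ k := by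
    intro k
    obtain ⟨M, hM⟩ := exists_nat_ge ((C k : ℝ) / δ k)
    refine ⟨M, ENNReal.div_le_of_le_mul ?_⟩
    have h1 : (C k : ℝ) ≤ δ k * Real.exp M := by
      have h2 : (M : ℝ) ≤ Real.exp M := by linarith [Real.add_one_le_exp (M : ℝ)]
      have h3 : (0 : ℝ) < δ k := hδ0 k
      rw [div_le_iff₀ h3] at hM
      nlinarith
    rw [← ENNReal.ofReal_coe_nnreal, ← ENNReal.ofReal_coe_nnreal (p := δ k),
      ← ENNReal.ofReal_mul (NNReal.coe_nonneg _)]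
    exact ENNReal.ofReal_le_ofReal h1
  choose M hM using hM
  refine ⟨_, isCompact_range_ofAnnuli K M, ?_⟩
  rintro _ ⟨Q, hQ, rfl⟩
  have hsub : (Set.range (ofAnnuli K M))ᶜ ⊆ ⋃ k, {X : Conf E |
      ENNReal.ofReal (Real.exp (M k)) ≤ ENNReal.ofReal (Real.exp (linStat (χ k) X))} := by
    intro X hX
    by_contra hX'
    refine hX (mem_range_ofAnnuli K M fun j => ?_)
    rw [Set.mem_iUnion, not_exists] at hX'
    have h1 : linStat (χ j) X < M j := by
      by_contra hlt
      exact hX' j (ENNReal.ofReal_le_ofReal (Real.exp_le_exp.2 (not_lt.1 hlt)))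
    have h2 : ((∑ y ∈ (X.finite_inter _ (isCompact_annulus K j)).toFinset, X.mult y : ℕ) : ℝ) ≤
        linStat (χ j) X := by
      have hc := (χ j).hasCompactSupport.isCompact.union (isCompact_annulus K j)
      rw [linStat_eq_stat, stat_eq_sum hc fun x hx => image_eq_zero_of_notMem_tsupport fun h =>
        hx (.inl h)]
      push_cast
      have e : ∀ y ∈ (X.finite_inter _ (isCompact_annulus K j)).toFinset,
          (X.mult y : ℝ) = X.mult y * χ j y := fun y hy => by
        rw [hχ1 j y ((Set.Finite.mem_toFinset _).1 hy).2, mul_one]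
      rw [Finset.sum_congr rfl e]
      refine Finset.sum_le_sum_of_subset_of_nonneg ?_ fun y _ _ =>
        mul_nonneg (Nat.cast_nonneg _) (hχ01 j y).1
      intro y hy
      have := (Set.Finite.mem_toFinset _).1 hy
      exact (Set.Finite.mem_toFinset _).2 ⟨this.1, .inr this.2⟩
    exact_mod_cast (h2.trans h1.le)
  refine (measure_mono hsub).trans ((measure_iUnion_le _).trans
    ((ENNReal.tsum_le_tsum fun k => ?_).trans hδ.le))
  have hmk := meas_ge_le_lintegral_div (μ := (Q : Measure (Conf E)))
    (f := fun X => ENNReal.ofReal (Real.exp (linStat (χ k) X)))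
    (by
      have := (Real.continuous_exp.comp (continuous_linStat (χ k))).measurable
      exact this.ennreal_ofReal.aemeasurable)
    (ε := ENNReal.ofReal (Real.exp (M k)))
    (by simpa using Real.exp_pos _) ENNReal.ofReal_ne_top
  exact hmk.trans ((ENNReal.div_le_div_right (hC k Q hQ) _).trans (hM k))

end Compact

end Conf

/-! ### Finite rank approximation of Laplace functionals. -/

theorem exists_orthonormal_expansion.{u} {H : Type u} [NormedAddCommGroup H] [InnerProductSpace ℂ H]
    [CompleteSpace H] {K : H →L[ℂ] H} (hK : IsStarProjection K) :
    ∃ (ι : Type u) (ψ : ι → H), Orthonormal ℂ ψ ∧ (∀ l, K (ψ l) = ψ l) ∧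
      ∀ x, HasSum (fun l => inner ℂ (ψ l) x • ψ l) (K x) := by
  obtain ⟨U, hU, hKU⟩ := isStarProjection_iff_eq_starProjection.1 hK
  have : CompleteSpace U := by
    have hcl : IsClosed (U : Set H) := by
      rw [← Submodule.orthogonal_orthogonal U]
      exact Submodule.isClosed_orthogonal _
    exact hcl.completeSpace_coe
  obtain ⟨w, b, -⟩ := exists_hilbertBasis ℂ U
  refine ⟨w, fun l => (b l : H), ?_, fun l => ?_, fun x => ?_⟩
  · exact b.orthonormal.comp_linearIsometry U.subtypeₗᵢ
  · rw [hKU]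
    exact Submodule.starProjection_eq_self_iff.2 (b l).2
  · have h := (b.hasSum_orthogonalProjectionOnto x).mapL U.subtypeL
    rw [hKU]
    exact h

section Laplace

variable {E : Type*} [MeasurableSpace E] {μ : Measure E}

/-- The Fredholm determinant of a compression of a projection as a sum of Gram minors. -/
theorem mulOp_mul_mul_chi_eq {K : L2 μ →L[ℂ] L2 μ} (hK : IsStarProjection K) {f : E → ℂ}
    (hf : MemLp f ∞ μ) (hf' : MemLp (fun x => star (f x)) ∞ μ) (B : Set E) :
    mulOp μ f * K * chi μ B = star (K * mulOp μ fun x => star (f x)) * (K * chi μ B) := by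
  have h := star_mulOp hf' (by simpa only [star_star] using hf)
  simp only [star_star] at h
  rw [star_mul, h, hK.isSelfAdjoint.star_eq, mul_assoc, mul_assoc, ← mul_assoc K K,
    hK.isIdempotentElem.eq]

theorem hsSq_mul_mulOp_lt_top {K : L2 μ →L[ℂ] L2 μ} {f : E → ℂ} (hf : MemLp f ∞ μ) {B : Set E}
    (hB : MeasurableSet B) (h0 : ∀ x ∉ B, f x = 0) (hKB : hsSq (K * chi μ B) < ∞) :
    hsSq (K * mulOp μ f) < ∞ := by
  rw [← chi_mul_mulOp hB hf h0, ← mul_assoc]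
  exact hsSq_mul_lt_top' _ hKB

variable [TopologicalSpace E] [PolishSpace E] [LocallyCompactSpace E] [BorelSpace E] [SigmaFinite μ]

/-- Bessel's inequality for `K x`, because ⟨ψ l, x⟩ = ⟨ψ l, K x⟩. It yields a majorant independent
of `F`. -/
theorem norm_partialProj_le {K : L2 μ →L[ℂ] L2 μ} (hK : IsStarProjection K) {ι : Type*}
    {ψ : ι → L2 μ} (hψ : Orthonormal ℂ ψ) (hKψ : ∀ l, K (ψ l) = ψ l) (F : Finset ι) (x : L2 μ) :
    ‖partialProj (fun l : F => ψ l) x‖ ≤ ‖K x‖ := by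
  classical
  refine le_of_sq_le_sq ?_ (norm_nonneg _)
  have hu : Orthonormal ℂ fun l : F => ψ l := hψ.comp _ Subtype.val_injective
  rw [norm_partialProj_sq hu]
  have h : ∀ l, inner ℂ (ψ l) x = inner ℂ (ψ l) (K x) := fun l => by
    conv_lhs => rw [← hKψ l]
    rw [← ContinuousLinearMap.adjoint_inner_right, ← ContinuousLinearMap.star_eq_adjoint,
      hK.isSelfAdjoint.star_eq]
  simp_rw [h]
  exact hu.sum_inner_products_le (s := Finset.univ) (K x)

/-- The Laplace functionals of the finite rank approximations converge, and are bounded. -/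
theorem tendsto_det_inner_mulOp {K : L2 μ →L[ℂ] L2 μ} (hK : IsStarProjection K)
    (hK_loc : IsLocTraceClass μ K) {ι : Type*} [DecidableEq ι] {ψ : ι → L2 μ}
    (hψ : Orthonormal ℂ ψ) (hKψ : ∀ l, K (ψ l) = ψ l)
    (hsum : ∀ x, HasSum (fun l => inner ℂ (ψ l) x • ψ l) (K x)) {f : E → ℂ} (hf : Measurable f)
    {C : ℝ} (hC : ∀ x, ‖f x‖ ≤ C) {B : Set E} (hB : IsBddBorel B) (h0 : ∀ x ∉ B, f x = 0) :
    Tendsto (fun F : Finset ι => (Matrix.of fun i j : F =>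
        inner ℂ (ψ i) (mulOp μ (fun x => 1 + f x) (ψ j))).det) atTop
      (𝓝 (fredholmDet (mulOp μ f * K * chi μ B))) ∧
    ∃ R : ℝ, ∀ F : Finset ι, ‖(Matrix.of fun i j : F =>
        inner ℂ (ψ i) (mulOp μ (fun x => 1 + f x) (ψ j))).det‖ ≤ R := by
  have hf1 : MemLp f ∞ μ := memLp_top_of_measurable hf hC
  have hf2 : MemLp (fun x => star (f x)) ∞ μ :=
    memLp_top_of_measurable (continuous_star.measurable.comp hf) (C := C) fun x => by simpa using hC x
  have hKB := hK_loc.hsSq_lt_top hK hB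
  have hKf : hsSq (K * mulOp μ fun x => star (f x)) < ∞ :=
    hsSq_mul_mulOp_lt_top hf2 hB.1 (fun x hx => by simp [h0 x hx]) hKB
  set e := basis (L2 μ)
  have hs := summable_norm_mul_norm hKf hKB
  have hle : ∀ (F : Finset ι) i,
      ‖partialProj (fun l : F => ψ l) (mulOp μ (fun x => star (f x)) (e i))‖ *
        ‖partialProj (fun l : F => ψ l) (chi μ B (e i))‖ ≤
      ‖(K * mulOp μ fun x => star (f x)) (e i)‖ * ‖(K * chi μ B) (e i)‖ := fun F i =>
    mul_le_mul (norm_partialProj_le hK hψ hKψ F _) (norm_partialProj_le hK hψ hKψ F _)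
      (norm_nonneg _) (norm_nonneg _)
  have hs' : ∀ F : Finset ι, Summable fun i =>
      ‖partialProj (fun l : F => ψ l) (mulOp μ (fun x => star (f x)) (e i))‖ *
        ‖partialProj (fun l : F => ψ l) (chi μ B (e i))‖ := fun F =>
    hs.of_nonneg_of_le (fun i => by positivity) (hle F)
  have hdet : ∀ F : Finset ι, (Matrix.of fun i j : F =>
        inner ℂ (ψ i) (mulOp μ (fun x => 1 + f x) (ψ j))).det =
      ∑' S, gramMinor
        (fun i => partialProj (fun l : F => ψ l) (mulOp μ (fun x => star (f x)) (e i)))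
        (fun i => partialProj (fun l : F => ψ l) (chi μ B (e i))) S :=
    fun F => det_inner_mulOp_eq (hψ.comp _ Subtype.val_injective :
    Orthonormal ℂ fun l : F => ψ l) hf1 hf2 hB.1 h0 (hs' F)
  have hlim : ∀ x, Tendsto (fun F : Finset ι => partialProj (fun l : F => ψ l) x) atTop
      (𝓝 (K x)) := fun x => by
    have h := hsum x
    rw [HasSum, SummationFilter.unconditional_filter] at h
    refine h.congr fun F => ?_
    exact (Finset.sum_coe_sort F fun l => inner ℂ (ψ l) x • ψ l).symm
  constructor
  · simp_rw [hdet]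
    rw [mulOp_mul_mul_chi_eq hK hf1 hf2, fredholmDet_star_mul]
    exact tendsto_tsum_gramMinor (fun i => hlim _) (fun i => hlim _) hs (.of_forall hle)
  · refine ⟨Real.exp (∑' i, ‖(K * mulOp μ fun x => star (f x)) (e i)‖ * ‖(K * chi μ B) (e i)‖),
      fun F => ?_⟩
    rw [hdet]
    refine (norm_tsum_gramMinor_le (hs' F)).trans (Real.exp_le_exp.2 ?_)
    exact (hs' F).tsum_le_tsum (hle F) hs

/-- The determinant does not depend on the choice of the bounded set containing the support. -/
theorem fredholmDet_eq_of_support {K : L2 μ →L[ℂ] L2 μ} (hK : IsStarProjection K)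
    (hK_loc : IsLocTraceClass μ K) {f : E → ℂ} (hf : Measurable f) {C : ℝ} (hC : ∀ x, ‖f x‖ ≤ C)
    {B B' : Set E} (hB : IsBddBorel B) (hB' : IsBddBorel B') (h0 : ∀ x ∉ B, f x = 0)
    (h0' : ∀ x ∉ B', f x = 0) :
    fredholmDet (mulOp μ f * K * chi μ B) = fredholmDet (mulOp μ f * K * chi μ B') := by
  classical
  obtain ⟨ι, ψ, hψ, hKψ, hsum⟩ := exists_orthonormal_expansion hK
  -- The approximating finite determinants do not involve the bounded set.
  exact tendsto_nhds_unique (tendsto_det_inner_mulOp hK hK_loc hψ hKψ hsum hf hC hB h0).1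
    (tendsto_det_inner_mulOp hK hK_loc hψ hKψ hsum hf hC hB' h0').1

/-- Continuity of the Laplace functional under bounded pointwise convergence. -/
theorem tendsto_fredholmDet_of_bounded {K : L2 μ →L[ℂ] L2 μ} (hK : IsStarProjection K)
    (hK_loc : IsLocTraceClass μ K) {f : ℕ → E → ℂ} {f' : E → ℂ} (hf : ∀ n, Measurable (f n))
    (hf' : Measurable f') {C : ℝ} (hC : ∀ n x, ‖f n x‖ ≤ C) (hC' : ∀ x, ‖f' x‖ ≤ C)
    (h : ∀ x, Tendsto (fun n => f n x) atTop (𝓝 (f' x))) {B : Set E} (hB : IsBddBorel B)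
    (h0 : ∀ n, ∀ x ∉ B, f n x = 0) (h0' : ∀ x ∉ B, f' x = 0) :
    Tendsto (fun n => fredholmDet (mulOp μ (f n) * K * chi μ B)) atTop
      (𝓝 (fredholmDet (mulOp μ f' * K * chi μ B))) := by
  have m1 : ∀ n, MemLp (f n) ∞ μ := fun n => memLp_top_of_measurable (hf n) (hC n)
  have m1' : MemLp f' ∞ μ := memLp_top_of_measurable hf' hC'
  have m2 : ∀ n, MemLp (fun x => star (f n x)) ∞ μ := fun n =>
    memLp_top_of_measurable (continuous_star.measurable.comp (hf n)) (C := C) fun x => by simpa using hC n x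
  have m2' : MemLp (fun x => star (f' x)) ∞ μ :=
    memLp_top_of_measurable (continuous_star.measurable.comp hf') (C := C) fun x => by simpa using hC' x
  have hKB := hK_loc.hsSq_lt_top hK hB
  have hBK : hsSq (chi μ B * K) < ∞ := by
    rw [← hsSq_adjoint, star_mul, star_chi hB.1,
      hK.isSelfAdjoint.star_eq]
    exact hKB
  simp_rw [mulOp_mul_mul_chi_eq hK (m1 _) (m2 _)]
  rw [mulOp_mul_mul_chi_eq hK m1' m2']
  refine tendsto_fredholmDet
    (hsSq_mul_mulOp_lt_top m2' hB.1 (fun x hx => by simp [h0' x hx]) hKB) hKB ?_ (by simp [hsSq])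
  -- Dominated convergence works with the multiplication on the left, so it is applied to the
  -- adjoints, which have the same Hilbert–Schmidt norm.
  refine (tendsto_hsSq_mulOp_mul hf hf' hC hC' h hB.1 h0 h0' hBK).congr fun n => ?_
  rw [← hsSq_adjoint, star_sub, star_mul, star_mul,
    star_mulOp (m1 n) (m2 n), star_mulOp m1' m2', hK.isSelfAdjoint.star_eq]

end Laplace

/-! ### A limiting process with the prescribed Laplace functional. -/

section Existence

variable {E : Type*} [TopologicalSpace E] [PolishSpace E] [LocallyCompactSpace E]
  [MeasurableSpace E] [BorelSpace E] {μ : Measure E} [SigmaFinite μ]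

theorem integrable_finiteProcess {κ : Type*} [Fintype κ] [DecidableEq κ] {u : κ → L2 μ}
    (hu : Orthonormal ℂ u) (φ : C_c(E, ℂ)) :
    Integrable (fun X => Complex.exp (Conf.stat φ X)) (finiteProcess hu : Measure (Conf E)) := by
  have hc : Continuous fun X : Conf E => Complex.exp (Conf.stat φ X) :=
    Complex.continuous_exp.comp (Conf.continuous_stat φ)
  have := isProbabilityMeasure_slaterMeasure hu
  rw [toMeasure_finiteProcess, integrable_map_measure hc.aestronglyMeasurable
    Conf.continuous_ofFun.measurable.aemeasurable]
  obtain ⟨C, hC⟩ := φ.hasCompactSupport.exists_bound_of_continuous φ.continuous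
  refine Integrable.of_bound (C := Real.exp (Fintype.card κ * C))
    (hc.comp Conf.continuous_ofFun).aestronglyMeasurable (ae_of_all _ fun x => ?_)
  rw [Function.comp_apply, Complex.norm_exp, Real.exp_le_exp,
    Conf.stat_ofFun x φ.hasCompactSupport.isCompact fun _ hy => image_eq_zero_of_notMem_tsupport hy]
  refine (Complex.re_le_norm _).trans ((norm_sum_le _ _).trans ?_)
  refine (Finset.sum_le_card_nsmul _ _ C fun a _ => hC _).trans_eq ?_
  rw [Finset.card_univ, nsmul_eq_mul]

/-- A real test function as a complex one. -/
def complexify (φ : C_c(E, ℝ)) : C_c(E, ℂ) :=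
  ⟨⟨fun x => (φ x : ℂ), Complex.continuous_ofReal.comp φ.continuous⟩,
    φ.hasCompactSupport.comp_left (g := fun t : ℝ => (t : ℂ)) rfl⟩

theorem stat_complexify (φ : C_c(E, ℝ)) (X : Conf E) :
    Conf.stat (complexify φ) X = (Conf.linStat φ X : ℂ) :=
  Conf.stat_map Complex.ofRealHom φ.hasCompactSupport.isCompact
    (fun _ hx => image_eq_zero_of_notMem_tsupport hx) X

theorem measurable_exp_sub_one (φ : C_c(E, ℂ)) : Measurable fun x => Complex.exp (φ x) - 1 :=
  ((Complex.continuous_exp.comp φ.continuous).sub continuous_const).measurable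

theorem exists_bound_exp_sub_one (φ : C_c(E, ℂ)) : ∃ C, ∀ x, ‖Complex.exp (φ x) - 1‖ ≤ C := by
  obtain ⟨C, hC⟩ := φ.hasCompactSupport.exists_bound_of_continuous φ.continuous
  refine ⟨Real.exp C + 1, fun x => (norm_sub_le _ _).trans ?_⟩
  rw [Complex.norm_exp, norm_one]
  gcongr
  exact (Complex.re_le_norm _).trans (hC x)

/-- The squared modulus is the exponential of the statistic of 2 Re φ, so exponential moment bounds
are also second moment bounds. -/
theorem nnnorm_exp_stat_sq (φ : C_c(E, ℂ)) : ∃ χ : C_c(E, ℝ), ∀ X : Conf E,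
    ((‖Complex.exp (Conf.stat φ X)‖₊ ^ 2 : NNReal) : ℝ≥0∞) =
      ENNReal.ofReal (Real.exp (Conf.linStat χ X)) := by
  obtain ⟨φ₁, φ₂, -, -, h⟩ := Conf.stat_eq_linStat_re_im φ
  refine ⟨(2 : ℝ) • φ₁, fun X => ?_⟩
  have h1 : Real.exp (Conf.linStat ((2 : ℝ) • φ₁) X) = ‖Complex.exp (Conf.stat φ X)‖ ^ 2 := by
    rw [Conf.linStat_smul, Complex.norm_exp, h, ← Real.exp_nat_mul]
    simp
  rw [h1, ENNReal.ofReal_pow (norm_nonneg _), ofReal_norm, enorm_eq_nnnorm, ENNReal.coe_pow]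

/-- There is a point process whose Laplace functional is the Fredholm determinant of a locally
trace class projection. -/
theorem exists_process {K : L2 μ →L[ℂ] L2 μ} (hK : IsStarProjection K)
    (hK_loc : IsLocTraceClass μ K) :
    ∃ Q : ProbabilityMeasure (Conf E), ∀ φ : C_c(E, ℂ), ∀ B : Set E, IsBddBorel B →
      (∀ x ∉ B, φ x = 0) →
      Integrable (fun X => Complex.exp (Conf.stat φ X)) (Q : Measure (Conf E)) ∧
      ∫ X, Complex.exp (Conf.stat φ X) ∂(Q : Measure (Conf E)) =
        fredholmDet (mulOp μ (fun x => Complex.exp (φ x) - 1) * K * chi μ B) := by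
  classical
  obtain ⟨ι, ψ, hψ, hKψ, hsum⟩ := exists_orthonormal_expansion hK
  have hu : ∀ F : Finset ι, Orthonormal ℂ fun l : F => ψ l := fun F =>
    hψ.comp _ Subtype.val_injective
  let Pa : Finset ι → ProbabilityMeasure (Conf E) := fun F => finiteProcess (hu F)
  have hPa : ∀ (φ : C_c(E, ℂ)) F, ∫ X, Complex.exp (Conf.stat φ X) ∂(Pa F : Measure (Conf E)) =
      (Matrix.of fun i j : F =>
        inner ℂ (ψ i) (mulOp μ (fun x => 1 + (Complex.exp (φ x) - 1)) (ψ j))).det := by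
    intro φ F
    simp only [add_sub_cancel]
    exact integral_finiteProcess (hu F) φ
  have hdet : ∀ (φ : C_c(E, ℂ)) (B : Set E), IsBddBorel B → (∀ x ∉ B, φ x = 0) →
      Tendsto (fun F => ∫ X, Complex.exp (Conf.stat φ X) ∂(Pa F : Measure (Conf E))) atTop
        (𝓝 (fredholmDet (mulOp μ (fun x => Complex.exp (φ x) - 1) * K * chi μ B))) ∧
      ∃ R : ℝ, ∀ F, ‖∫ X, Complex.exp (Conf.stat φ X) ∂(Pa F : Measure (Conf E))‖ ≤ R := by
    intro φ B hB h0
    simp_rw [hPa]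
    obtain ⟨C, hC⟩ := exists_bound_exp_sub_one φ
    exact tendsto_det_inner_mulOp hK hK_loc hψ hKψ hsum (measurable_exp_sub_one φ) hC hB
      fun x hx => by simp [h0 x hx]
  have hbound : ∀ φ : C_c(E, ℝ), ∃ C : NNReal, ∀ F,
      ∫⁻ X, ENNReal.ofReal (Real.exp (Conf.linStat φ X)) ∂(Pa F : Measure (Conf E)) ≤ C := by
    intro φ
    obtain ⟨R, hR⟩ := (hdet (complexify φ) (tsupport (complexify φ))
      (isBddBorel_of_isCompact (complexify φ).hasCompactSupport.isCompact)
      fun x hx => image_eq_zero_of_notMem_tsupport hx).2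
    refine ⟨R.toNNReal, fun F => ?_⟩
    have hi := integrable_finiteProcess (hu F) (complexify φ)
    have hnorm : ∀ X : Conf E, Complex.exp (Conf.stat (complexify φ) X) =
        ((Real.exp (Conf.linStat φ X) : ℝ) : ℂ) := fun X => by
      rw [stat_complexify, Complex.ofReal_exp]
    have h1 := hR F
    simp_rw [hnorm] at h1 hi
    rw [integral_complex_ofReal, Complex.norm_real] at h1
    have hi' : Integrable (fun X => Real.exp (Conf.linStat φ X)) (Pa F : Measure (Conf E)) := by
      exact hi.re.congr (ae_of_all _ fun X => Complex.ofReal_re _)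
    rw [← ofReal_integral_eq_lintegral_ofReal hi' (ae_of_all _ fun X => (Real.exp_pos _).le)]
    exact ENNReal.ofReal_le_ofReal ((le_abs_self _).trans h1)
  have htight : IsTightMeasureSet
      {((Q : ProbabilityMeasure (Conf E)) : Measure (Conf E)) | Q ∈ Set.range Pa} := by
    refine Conf.isTightMeasureSet_of_exp_bound fun φ => ?_
    obtain ⟨C, hC⟩ := hbound φ
    exact ⟨C, by rintro _ ⟨F, rfl⟩; exact hC F⟩
  -- Prokhorov's theorem. The approximations form a net over `Finset ι`, so the limit is taken along
  -- an ultrafilter finer than `atTop`, along which the determinants still converge.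
  have hcomp := isCompact_closure_of_isTightMeasureSet htight
  let 𝒰 : Ultrafilter (Finset ι) := Ultrafilter.of atTop
  have h𝒰 : (𝒰 : Filter (Finset ι)) ≤ atTop := Ultrafilter.of_le _
  obtain ⟨Q, -, hQ⟩ := hcomp.ultrafilter_le_nhds (𝒰.map Pa) (by
    rw [Filter.le_principal_iff]
    exact Filter.mem_of_superset (Ultrafilter.mem_map.2 (Filter.univ_mem' fun F =>
      subset_closure (Set.mem_range_self F))) subset_rfl)
  have hQ' : Tendsto Pa 𝒰 (𝓝 Q) := hQ
  refine ⟨Q, fun φ B hB h0 => ?_⟩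
  have hc : Continuous fun X : Conf E => Complex.exp (Conf.stat φ X) :=
    Complex.continuous_exp.comp (Conf.continuous_stat φ)
  obtain ⟨χ, hχ⟩ := nnnorm_exp_stat_sq φ
  obtain ⟨C, hC⟩ := hbound χ
  obtain ⟨h1, h2⟩ := tendsto_integral_of_sq_bound hQ' hc (C := C) fun F => by
    simp_rw [hχ]
    exact hC F
  exact ⟨h1, tendsto_nhds_unique h2 ((hdet φ B hB h0).1.mono_left h𝒰)⟩

end Existence

/-! ### Bounded measurable functions as bounded pointwise limits. -/

section Baire

variable {E : Type*} [TopologicalSpace E]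

/-- The smallest class of functions containing the continuous functions with compact support
which vanish outside `U` and closed under bounded pointwise convergence of sequences. -/
inductive BaireClass (U : Set E) : (E → ℂ) → Prop
  | cont (φ : C_c(E, ℂ)) (h : ∀ x ∉ U, φ x = 0) : BaireClass U φ
  | lim (f : ℕ → E → ℂ) (g : E → ℂ) (C : ℝ) (hf : ∀ n, BaireClass U (f n))
      (hC : ∀ n x, ‖f n x‖ ≤ C) (h : ∀ x, Tendsto (fun n => f n x) atTop (𝓝 (g x))) :
      BaireClass U g

namespace BaireClass

variable {U : Set E} {f g : E → ℂ}

theorem exists_bound (hf : BaireClass U f) : ∃ C : ℝ, ∀ x, ‖f x‖ ≤ C := by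
  induction hf with
  | cont φ h => exact φ.hasCompactSupport.exists_bound_of_continuous φ.continuous
  | lim f g C hf hC h ih => exact ⟨C, fun x => le_of_tendsto' (h x).norm fun n => hC n x⟩

theorem eq_zero (hf : BaireClass U f) : ∀ x ∉ U, f x = 0 := by
  induction hf with
  | cont φ h => exact h
  | lim f g C hf hC h ih =>
    intro x hx
    refine tendsto_nhds_unique (h x) ?_
    simp only [ih _ x hx]
    exact tendsto_const_nhds

theorem measurable [MeasurableSpace E] [BorelSpace E] (hf : BaireClass U f) : Measurable f := by
  induction hf with
  | cont φ h => exact φ.continuous.measurable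
  | lim f g C hf hC h ih => exact measurable_of_tendsto_metrizable ih (tendsto_pi_nhds.2 h)

theorem const_mul (c : ℂ) (hf : BaireClass U f) : BaireClass U fun x => c * f x := by
  induction hf with
  | cont φ h => exact cont (c • φ) fun x hx => by simp [h x hx]
  | lim f g C hf hC h ih =>
    refine lim _ _ (‖c‖ * C) ih (fun n x => ?_) fun x => (h x).const_mul c
    rw [norm_mul]
    exact mul_le_mul_of_nonneg_left (hC n x) (norm_nonneg c)

theorem add (hf : BaireClass U f) (hg : BaireClass U g) : BaireClass U fun x => f x + g x := by
  induction hf with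
  | cont φ h =>
    induction hg with
    | cont ψ h' => exact cont (φ + ψ) fun x hx => by simp [h x hx, h' x hx]
    | lim f g C hf hC h' ih =>
      obtain ⟨D, hD⟩ := (cont φ h).exists_bound
      exact lim _ _ (D + C) ih (fun n x => (norm_add_le _ _).trans (add_le_add (hD x) (hC n x)))
        fun x => (h' x).const_add _
  | lim f g' C hf hC h ih =>
    obtain ⟨D, hD⟩ := hg.exists_bound
    exact lim _ _ (C + D) ih (fun n x => (norm_add_le _ _).trans (add_le_add (hC n x) (hD x)))
      fun x => (h x).add_const _

theorem zero : BaireClass U fun _ => 0 := cont 0 fun _ _ => rfl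

variable [PolishSpace E] [MeasurableSpace E] [BorelSpace E]

/-- One minus the outer approximations of the closed complement vanishes off `O ∩ U`, and is
compactly supported because `U` is relatively compact. -/
theorem indicator_isOpen (hU : IsOpen U) (hUc : IsCompact (closure U)) {O : Set E} (hO : IsOpen O) :
    BaireClass U ((O ∩ U).indicator fun _ => 1) := by
  have hF : IsClosed (O ∩ U)ᶜ := (hO.inter hU).isClosed_compl
  have hval : ∀ n x, x ∉ O ∩ U → ((1 - (hF.apprSeq n x : ℝ) : ℝ) : ℂ) = 0 := fun n x hx => by
    rw [HasOuterApproxClosed.apprSeq_apply_eq_one hF n (Set.mem_compl hx)]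
    simp
  let φ : ℕ → C_c(E, ℂ) := fun n =>
    ⟨⟨fun x => ((1 - (hF.apprSeq n x : ℝ) : ℝ) : ℂ), by fun_prop⟩,
      HasCompactSupport.intro hUc fun x hx => hval n x fun h => hx (subset_closure h.2)⟩
  refine lim (fun n => φ n) _ 1 (fun n => cont (φ n) fun x hx => hval n x fun h => hx h.2)
    (fun n x => ?_) fun x => ?_
  · have h1 : (hF.apprSeq n x : ℝ) ≤ 1 := by exact_mod_cast HasOuterApproxClosed.apprSeq_apply_le_one hF n x
    have h0 : 0 ≤ (hF.apprSeq n x : ℝ) := NNReal.coe_nonneg _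
    change ‖((1 - (hF.apprSeq n x : ℝ) : ℝ) : ℂ)‖ ≤ 1
    rw [Complex.norm_real, Real.norm_of_nonneg (by linarith)]
    linarith
  · have h := tendsto_pi_nhds.1 (HasOuterApproxClosed.tendsto_apprSeq hF) x
    have h2 : Tendsto (fun n => ((1 - (hF.apprSeq n x : ℝ) : ℝ) : ℂ)) atTop
        (𝓝 ((1 - (((O ∩ U)ᶜ.indicator (fun _ => (1 : NNReal)) x : NNReal) : ℝ) : ℝ) : ℂ)) :=
      ((Complex.continuous_ofReal.comp (continuous_const.sub NNReal.continuous_coe)).tendsto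
        _).comp h
    refine h2.congr' .rfl |>.trans (le_of_eq ?_)
    congr 1
    by_cases hx : x ∈ O ∩ U
    · rw [Set.indicator_of_mem hx, Set.indicator_of_notMem (by simpa using hx)]
      simp
    · rw [Set.indicator_of_notMem hx, Set.indicator_of_mem (Set.mem_compl hx)]
      simp

theorem indicator_measurableSet (hU : IsOpen U) (hUc : IsCompact (closure U)) {t : Set E}
    (ht : MeasurableSet t) : BaireClass U ((t ∩ U).indicator fun _ => 1) := by
  induction t, ht using MeasurableSet.induction_on_open with
  | isOpen O hO => exact indicator_isOpen hU hUc hO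
  | compl t ht ih =>
    have h1 := (indicator_isOpen hU hUc isOpen_univ).add (ih.const_mul (-1))
    convert h1 using 1
    ext x
    by_cases hx : x ∈ U <;> by_cases hx' : x ∈ t <;> simp [hx, hx']
  | iUnion s hd hs ih =>
    have hfin : ∀ n, BaireClass U (((⋃ i < n, s i) ∩ U).indicator fun _ => 1) := by
      intro n
      induction n with
      | zero => simpa using zero (U := U)
      | succ n ihn =>
        convert ihn.add (ih n) using 1
        ext x
        have hdis : Disjoint ((⋃ i < n, s i) ∩ U) (s n ∩ U) := by
          refine Disjoint.mono Set.inter_subset_left Set.inter_subset_left ?_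
          simp only [Set.disjoint_iUnion_left]
          exact fun i hi => hd hi.ne
        rw [Set.biUnion_lt_succ, Set.union_inter_distrib_right,
          Set.indicator_union_of_disjoint hdis]
    refine lim _ _ 1 hfin (fun n x => norm_indicator_one_le _ x) fun x => ?_
    have hmono : Monotone fun n => (⋃ i < n, s i) ∩ U := fun m n hmn =>
      Set.inter_subset_inter_left _ (Set.biUnion_subset_biUnion_left fun i hi => lt_of_lt_of_le hi hmn)
    have h := (hmono.tendsto_indicator _ (fun _ => (1 : ℂ)) x).mono_right (pure_le_nhds _)
    have e : (⋃ n, (⋃ i < n, s i) ∩ U) = (⋃ i, s i) ∩ U := by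
      rw [← Set.iUnion_inter]
      congr 1
      ext y
      simp only [Set.mem_iUnion]
      exact ⟨fun ⟨_, i, _, h⟩ => ⟨i, h⟩, fun ⟨i, h⟩ => ⟨i + 1, i, i.lt_succ_self, h⟩⟩
    rwa [e] at h

theorem indicator_simpleFunc (hU : IsOpen U) (hUc : IsCompact (closure U)) (s : SimpleFunc E ℂ) :
    BaireClass U (U.indicator s) := by
  induction s using SimpleFunc.induction with
  | @const c t ht =>
    convert (indicator_measurableSet hU hUc ht).const_mul c using 1
    ext x
    by_cases hx : x ∈ U <;> by_cases hx' : x ∈ t <;> simp [hx, hx']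
  | @add f g _ hf hg =>
    convert hf.add hg using 1
    ext x
    by_cases hx : x ∈ U <;> simp [hx]

theorem of_measurable (hU : IsOpen U) (hUc : IsCompact (closure U)) (hf : Measurable f) {C : ℝ}
    (hC : ∀ x, ‖f x‖ ≤ C) (h0 : ∀ x ∉ U, f x = 0) : BaireClass U f := by
  have hsm : StronglyMeasurable f := hf.stronglyMeasurable
  rcases isEmpty_or_nonempty E with hE | ⟨⟨x₀⟩⟩
  · convert zero (U := U) using 1
  have hC0 : 0 ≤ C := (norm_nonneg _).trans (hC x₀)
  refine lim (fun n => U.indicator (hsm.approxBounded C n)) f C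
    (fun n => indicator_simpleFunc hU hUc _) (fun n x => ?_) fun x => ?_
  · exact (norm_indicator_le_norm_self _ _).trans (hsm.norm_approxBounded_le hC0 n x)
  · by_cases hx : x ∈ U
    · simp only [Set.indicator_of_mem hx]
      exact hsm.tendsto_approxBounded_of_norm_le (hC x)
    · simp only [Set.indicator_of_notMem hx, h0 x hx]
      exact tendsto_const_nhds

end BaireClass

end Baire

/-! ### Multiplicative functionals. -/

namespace Conf

variable {E : Type*} [TopologicalSpace E]

theorem mulFunctional_eq_prod {h : E → ℂ} {C : Set E} (hC : IsCompact C) (h1 : ∀ x ∉ C, h x = 1)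
    (X : Conf E) :
    mulFunctional h X = ∏ x ∈ (X.finite_inter C hC).toFinset, h x ^ X.mult x := by
  refine finprod_eq_prod_of_mulSupport_subset _ fun x hx => ?_
  rw [Function.mem_mulSupport] at hx
  rw [Set.Finite.coe_toFinset]
  refine ⟨fun h0 => hx (by simp [h0]), ?_⟩
  by_contra hxC
  exact hx (by simp [h1 x hxC])

theorem mulFunctional_exp {f : E → ℂ} {C : Set E} (hC : IsCompact C) (h0 : ∀ x ∉ C, f x = 0)
    (X : Conf E) : mulFunctional (fun x => Complex.exp (f x)) X = Complex.exp (stat f X) := by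
  rw [mulFunctional_eq_prod hC (fun x hx => by simp [h0 x hx]), stat_eq_sum hC h0, Complex.exp_sum]
  exact Finset.prod_congr rfl fun x _ => by rw [← Complex.exp_nat_mul]

/-- Each particle in `C` contributes a factor at most exp c, and the statistic of χ is at least
their number. -/
theorem norm_mulFunctional_le {h : E → ℂ} {C : Set E} (hC : IsCompact C) (h1 : ∀ x ∉ C, h x = 1)
    {c : ℝ} (hc : 0 ≤ c) (hh : ∀ x, ‖h x‖ ≤ Real.exp c) {χ : C_c(E, ℝ)} (hχ : ∀ x ∈ C, χ x = 1)
    (hχ0 : ∀ x, 0 ≤ χ x) (X : Conf E) : ‖mulFunctional h X‖ ≤ Real.exp (c * linStat χ X) := by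
  have hsum : ∑ x ∈ (X.finite_inter C hC).toFinset, (X.mult x : ℝ) ≤ linStat χ X := by
    have hc := χ.hasCompactSupport.isCompact.union hC
    rw [linStat_eq_stat, stat_eq_sum hc fun x hx => image_eq_zero_of_notMem_tsupport fun h =>
      hx (.inl h)]
    have e : ∀ y ∈ (X.finite_inter C hC).toFinset, (X.mult y : ℝ) = X.mult y * χ y :=
      fun y hy => by rw [hχ y ((Set.Finite.mem_toFinset _).1 hy).2, mul_one]
    rw [Finset.sum_congr rfl e]
    refine Finset.sum_le_sum_of_subset_of_nonneg ?_ fun y _ _ =>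
      mul_nonneg (Nat.cast_nonneg _) (hχ0 y)
    intro y hy
    have := (Set.Finite.mem_toFinset _).1 hy
    exact (Set.Finite.mem_toFinset _).2 ⟨this.1, .inr this.2⟩
  rw [mulFunctional_eq_prod hC h1, norm_prod]
  calc ∏ x ∈ (X.finite_inter C hC).toFinset, ‖h x ^ X.mult x‖
      ≤ ∏ x ∈ (X.finite_inter C hC).toFinset, Real.exp (X.mult x * c) := by
        refine Finset.prod_le_prod (fun _ _ => norm_nonneg _) fun x _ => ?_
        rw [norm_pow, Real.exp_nat_mul]
        exact pow_le_pow_left₀ (norm_nonneg _) (hh x) _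
    _ = Real.exp (c * ∑ x ∈ (X.finite_inter C hC).toFinset, (X.mult x : ℝ)) := by
        rw [← Real.exp_sum, ← Finset.sum_mul, mul_comm]
    _ ≤ _ := Real.exp_le_exp.2 (mul_le_mul_of_nonneg_left hsum hc)

theorem tendsto_mulFunctional {h : ℕ → E → ℂ} {h' : E → ℂ} {C : Set E} (hC : IsCompact C)
    (h1 : ∀ n, ∀ x ∉ C, h n x = 1) (h1' : ∀ x ∉ C, h' x = 1)
    (hlim : ∀ x, Tendsto (fun n => h n x) atTop (𝓝 (h' x))) (X : Conf E) :
    Tendsto (fun n => mulFunctional (h n) X) atTop (𝓝 (mulFunctional h' X)) := by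
  simp_rw [mulFunctional_eq_prod hC (h1 _)]
  rw [mulFunctional_eq_prod hC h1']
  exact tendsto_finsetProd _ fun x _ => (hlim x).pow _

end Conf

/-! ### Existence of determinantal measures of projections. -/

section Determinantal

variable {E : Type*} [TopologicalSpace E] [PolishSpace E] [LocallyCompactSpace E]
  [MeasurableSpace E] [BorelSpace E] {μ : Measure E} [SigmaFinite μ]

/-- The defining property of the determinantal measure for a single test function. -/
def HasDet (μ : Measure E) (K : L2 μ →L[ℂ] L2 μ) (Q : ProbabilityMeasure (Conf E)) (B : Set E)
    (h : E → ℂ) : Prop :=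
  AEStronglyMeasurable (Conf.mulFunctional h) (Q : Measure (Conf E)) ∧
    ∫ X, Conf.mulFunctional h X ∂(Q : Measure (Conf E)) =
      fredholmDet (mulOp μ (fun x => h x - 1) * K * chi μ B)

/-- The majorant depends on the bounds `B` and `C` only, not on `h`, as dominated convergence in
`HasDet.lim` requires. -/
theorem integrable_mulFunctional {Q : ProbabilityMeasure (Conf E)}
    (hQ : ∀ φ : C_c(E, ℝ), Integrable (fun X => Real.exp (Conf.linStat φ X)) (Q : Measure (Conf E)))
    {B : Set E} (hB : IsBddBorel B) {C : ℝ} : ∃ g : Conf E → ℝ, Integrable g (Q : Measure (Conf E)) ∧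
      ∀ h : E → ℂ, (∀ x, ‖h x‖ ≤ C) → (∀ x ∉ B, h x = 1) →
        ∀ X, ‖Conf.mulFunctional h X‖ ≤ g X := by
  obtain ⟨χ, hχ1, -, hχ01⟩ := Conf.exists_bump hB.2 isOpen_univ (Set.subset_univ _)
  have hc : 0 ≤ Real.log (max C 1) := Real.log_nonneg (le_max_right _ _)
  refine ⟨fun X => Real.exp (Real.log (max C 1) * Conf.linStat χ X), ?_, fun h hC h1 X =>
    Conf.norm_mulFunctional_le hB.2 (fun x hx => h1 x fun h => hx (subset_closure h)) hc
      (fun x => ?_) hχ1 (fun x => (hχ01 x).1) X⟩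
  · simpa only [Conf.linStat_smul] using hQ (Real.log (max C 1) • χ)
  · rw [Real.exp_log (lt_max_of_lt_right one_pos)]
    exact (hC x).trans (le_max_left _ _)

/-- The class of test functions is closed under bounded pointwise convergence. -/
theorem HasDet.lim {K : L2 μ →L[ℂ] L2 μ} (hK : IsStarProjection K) (hK_loc : IsLocTraceClass μ K)
    {Q : ProbabilityMeasure (Conf E)}
    (hQ : ∀ φ : C_c(E, ℝ), Integrable (fun X => Real.exp (Conf.linStat φ X)) (Q : Measure (Conf E)))
    {B : Set E} (hB : IsBddBorel B) {h : ℕ → E → ℂ} {h' : E → ℂ} (hm : ∀ n, Measurable (h n))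
    {C : ℝ} (hC : ∀ n x, ‖h n x‖ ≤ C) (h1 : ∀ n, ∀ x ∉ B, h n x = 1)
    (hlim : ∀ x, Tendsto (fun n => h n x) atTop (𝓝 (h' x))) (hd : ∀ n, HasDet μ K Q B (h n)) :
    HasDet μ K Q B h' := by
  have hm' : Measurable h' := measurable_of_tendsto_metrizable hm (tendsto_pi_nhds.2 hlim)
  have hC' : ∀ x, ‖h' x‖ ≤ C := fun x => le_of_tendsto' (hlim x).norm fun n => hC n x
  have h1' : ∀ x ∉ B, h' x = 1 := fun x hx => by
    refine tendsto_nhds_unique (hlim x) ?_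
    simp only [h1 _ x hx]
    exact tendsto_const_nhds
  have hX : ∀ X : Conf E, Tendsto (fun n => Conf.mulFunctional (h n) X) atTop
      (𝓝 (Conf.mulFunctional h' X)) := fun X =>
    Conf.tendsto_mulFunctional hB.2 (fun n x hx => h1 n x fun h => hx (subset_closure h))
      (fun x hx => h1' x fun h => hx (subset_closure h)) hlim X
  obtain ⟨g, hg, hgb⟩ := integrable_mulFunctional hQ hB (C := C)
  refine ⟨aestronglyMeasurable_of_tendsto_ae atTop (fun n => (hd n).1) (ae_of_all _ hX), ?_⟩
  have hl := tendsto_integral_of_dominated_convergence g (fun n => (hd n).1) hg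
    (fun n => ae_of_all _ (hgb (h n) (hC n) (h1 n))) (ae_of_all _ hX)
  refine tendsto_nhds_unique hl ?_
  simp_rw [fun n => (hd n).2]
  refine tendsto_fredholmDet_of_bounded hK hK_loc (fun n => (hm n).sub_const 1)
    (hm'.sub_const 1) (C := C + 1) (fun n x => ?_) (fun x => ?_)
    (fun x => (hlim x).sub_const 1) hB (fun n x hx => by simp [h1 n x hx])
    fun x hx => by simp [h1' x hx]
  · exact (norm_sub_le _ _).trans (by simpa using hC n x)
  · exact (norm_sub_le _ _).trans (by simpa using hC' x)

/-- **Existence of the determinantal measure** of a locally trace class projection. -/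
theorem exists_isDeterminantal {K : L2 μ →L[ℂ] L2 μ} (hK : IsStarProjection K)
    (hK_loc : IsLocTraceClass μ K) :
    ∃ Q : ProbabilityMeasure (Conf E), IsDeterminantal μ K Q := by
  obtain ⟨Q, hQ⟩ := exists_process hK hK_loc
  have hexp : ∀ φ : C_c(E, ℝ),
      Integrable (fun X => Real.exp (Conf.linStat φ X)) (Q : Measure (Conf E)) := by
    intro φ
    have h := (hQ (complexify φ) (tsupport (complexify φ))
      (isBddBorel_of_isCompact (complexify φ).hasCompactSupport.isCompact)
      fun x hx => image_eq_zero_of_notMem_tsupport hx).1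
    refine h.re.congr (ae_of_all _ fun X => ?_)
    simp only [stat_complexify]
    rw [← Complex.ofReal_exp]
    exact Complex.ofReal_re _
  have hmain : ∀ (h : E → ℂ) (B : Set E), Measurable h → (∃ C : ℝ, ∀ x, ‖h x‖ ≤ C) →
      IsBddBorel B → (∀ x ∉ B, h x = 1) → HasDet μ K Q B h := by
    intro h B hm ⟨C, hC⟩ hB h1
    -- An open relatively compact set is needed to host continuous test functions. The set `B`
    -- returns at the end through `fredholmDet_eq_of_support`.
    obtain ⟨U, hU, hBU, hUc⟩ := exists_isOpen_superset_and_isCompact_closure hB.2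
    have hUB : IsBddBorel U := ⟨hU.measurableSet, hUc⟩
    -- The formula is known for exponentials of test functions, so the Baire class induction runs
    -- over the exponents.
    have hlog : ∀ f : E → ℂ, BaireClass U f → HasDet μ K Q U fun x => Complex.exp (f x) := by
      intro f hf
      induction hf with
      | cont φ h0 =>
        obtain ⟨i1, i2⟩ := hQ φ U hUB h0
        have e : Conf.mulFunctional (fun x => Complex.exp (φ x)) =
            fun X => Complex.exp (Conf.stat φ X) := funext fun X =>
          Conf.mulFunctional_exp φ.hasCompactSupport.isCompact
            (fun x hx => image_eq_zero_of_notMem_tsupport hx) X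
        refine ⟨?_, ?_⟩
        · rw [e]
          exact i1.1
        · rw [e]
          exact i2
      | lim f g D hf hD hlim ih =>
        refine HasDet.lim hK hK_loc hexp hUB (C := Real.exp D)
          (fun n => Complex.measurable_exp.comp (hf n).measurable) (fun n x => ?_)
          (fun n x hx => by simp [(hf n).eq_zero x hx])
          (fun x => (Complex.continuous_exp.tendsto _).comp (hlim x)) ih
        rw [Function.comp_apply, Complex.norm_exp]
        exact Real.exp_le_exp.2 ((Complex.re_le_norm _).trans (hD n x))
    have h1U : ∀ x ∉ U, h x = 1 := fun x hx => h1 x fun h => hx (hBU (subset_closure h))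
    have hdetU : HasDet μ K Q U h := by
      -- Values near zero are replaced so that the logarithm exists and is bounded; it need only be
      -- measurable. The threshold never exceeds 1, so the value 1 off `U` is kept.
      let hn : ℕ → E → ℂ := fun n x => if ((n : ℝ) + 1)⁻¹ ≤ ‖h x‖ then h x else ((n : ℂ) + 1)⁻¹
      have hpos : ∀ n : ℕ, 0 < ((n : ℝ) + 1)⁻¹ := fun n => by positivity
      have hle1 : ∀ n : ℕ, ((n : ℝ) + 1)⁻¹ ≤ 1 := fun n => inv_le_one_of_one_le₀ (by simp)
      have hnorm : ∀ n : ℕ, ‖((n : ℂ) + 1)⁻¹‖ = ((n : ℝ) + 1)⁻¹ := fun n => by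
        rw [norm_inv]
        congr 1
        exact_mod_cast Complex.norm_natCast (n + 1)
      have hnlow : ∀ (n : ℕ) x, ((n : ℝ) + 1)⁻¹ ≤ ‖hn n x‖ := by
        intro n x
        simp only [hn]
        split_ifs with hx
        · exact hx
        · rw [hnorm]
      have hnup : ∀ n x, ‖hn n x‖ ≤ max C 1 := by
        intro n x
        simp only [hn]
        split_ifs with hx
        · exact (hC x).trans (le_max_left _ _)
        · rw [hnorm]
          exact (hle1 n).trans (le_max_right _ _)
      have hnm : ∀ n, Measurable (hn n) := fun n =>
        Measurable.ite (measurableSet_le measurable_const hm.norm) hm measurable_const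
      have hn1 : ∀ n, ∀ x ∉ U, hn n x = 1 := by
        intro n x hx
        simp only [hn, h1U x hx, norm_one, if_pos (hle1 n)]
      have hnlim : ∀ x, Tendsto (fun n => hn n x) atTop (𝓝 (h x)) := by
        intro x
        have hz : Tendsto (fun n : ℕ => ((n : ℝ) + 1)⁻¹) atTop (𝓝 0) := by
          simpa only [one_div] using tendsto_one_div_add_atTop_nhds_zero_nat (𝕜 := ℝ)
        rw [tendsto_iff_norm_sub_tendsto_zero]
        refine squeeze_zero (fun _ => norm_nonneg _) (fun n => ?_)
          (by simpa using hz.const_mul 2 : Tendsto (fun n : ℕ => 2 * ((n : ℝ) + 1)⁻¹) atTop (𝓝 0))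
        simp only [hn]
        split_ifs with hx
        · simpa using (hpos n).le
        · refine (norm_sub_le _ _).trans ?_
          rw [hnorm]
          linarith [not_le.1 hx]
      refine HasDet.lim hK hK_loc hexp hUB hnm hnup hn1 hnlim fun n => ?_
      have hn0 : ∀ x, hn n x ≠ 0 := fun x => norm_pos_iff.1 ((hpos n).trans_le (hnlow n x))
      have e : hn n = fun x => Complex.exp (Complex.log (hn n x)) := funext fun x =>
        (Complex.exp_log (hn0 x)).symm
      rw [e]
      refine hlog _ (BaireClass.of_measurable hU hUc (Complex.measurable_log.comp (hnm n))
        (C := max |Real.log ((n : ℝ) + 1)⁻¹| |Real.log (max C 1)| + Real.pi) (fun x => ?_)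
        fun x hx => by simp [hn1 n x hx])
      refine (Complex.norm_le_abs_re_add_abs_im _).trans (add_le_add ?_ ?_)
      · rw [Complex.log_re]
        exact abs_le_max_abs_abs (Real.log_le_log (hpos n) (hnlow n x))
          (Real.log_le_log ((hpos n).trans_le (hnlow n x)) (hnup n x))
      · rw [Complex.log_im]
        exact Complex.abs_arg_le_pi _
    refine ⟨hdetU.1, hdetU.2.trans ?_⟩
    refine fredholmDet_eq_of_support hK hK_loc (hm.sub_const 1) (C := C + 1) (fun x => ?_) hUB hB
      (fun x hx => by simp [h1U x hx]) fun x hx => by simp [h1 x hx]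
    exact (norm_sub_le _ _).trans (by simpa using hC x)
  refine ⟨Q, hK_loc, fun h B hm hC hB h1 => ?_, fun h B hm hC hB h1 => (hmain h B hm hC hB h1).2⟩
  obtain ⟨C, hC'⟩ := hC
  obtain ⟨g, hg, hgb⟩ := integrable_mulFunctional hexp hB (C := C)
  exact hg.mono' (hmain h B hm ⟨C, hC'⟩ hB h1).1 (ae_of_all _ (hgb h hC' h1))

end Determinantal

/-! ### Uniqueness and weak convergence of determinantal measures. -/

section Convergence

variable {E : Type*} [TopologicalSpace E] [PolishSpace E] [LocallyCompactSpace E]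
  [MeasurableSpace E] [BorelSpace E] {μ : Measure E} [SigmaFinite μ]

theorem norm_exp_mul_I_sub_one_le (t : ℝ) : ‖Complex.exp (t * Complex.I) - 1‖ ≤ 2 :=
  (norm_sub_le _ _).trans (by rw [Complex.norm_exp_ofReal_mul_I, norm_one]; norm_num)

/-- The characteristic function of a linear statistic of a determinantal process. -/
theorem IsDeterminantal.integral_exp_linStat {K : L2 μ →L[ℂ] L2 μ} {Q : ProbabilityMeasure (Conf E)}
    (hQ : IsDeterminantal μ K Q) (φ : C_c(E, ℝ)) :
    ∫ X, Complex.exp (Conf.linStat φ X * Complex.I) ∂(Q : Measure (Conf E)) =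
      fredholmDet (mulOp μ (fun x => Complex.exp (φ x * Complex.I) - 1) * K *
        chi μ (tsupport φ)) := by
  have hC := φ.hasCompactSupport.isCompact
  have h0 : ∀ x ∉ tsupport φ, φ x = 0 := fun x hx => image_eq_zero_of_notMem_tsupport hx
  have h0' : ∀ x ∉ tsupport φ, ((φ x : ℝ) : ℂ) = 0 := fun x hx => by simp [h0 x hx]
  have e : ∀ X : Conf E, Complex.exp (Conf.linStat φ X * Complex.I) =
      Conf.mulFunctional (fun x => Complex.exp (φ x * Complex.I)) X := by
    intro X
    rw [Conf.mulFunctional_exp hC (fun x hx => by simp [h0 x hx])]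
    have h1 : Conf.stat (fun x => (φ x : ℂ) * Complex.I) X =
        Complex.I * Conf.stat (fun x => (φ x : ℂ)) X := by
      simp_rw [mul_comm _ Complex.I]
      exact Conf.stat_const_mul hC h0' Complex.I X
    have h2 : Conf.stat (fun x => (φ x : ℂ)) X = (Conf.linStat φ X : ℂ) :=
      Conf.stat_map Complex.ofRealHom hC h0 X
    rw [h1, h2, mul_comm]
  simp_rw [e]
  refine hQ.integral_eq _ _ ?_ ⟨1, fun x => (Complex.norm_exp_ofReal_mul_I _).le⟩
    (isBddBorel_of_isCompact hC) fun x hx => by simp [h0 x hx]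
  have := φ.continuous
  exact (by fun_prop : Continuous fun x => Complex.exp (φ x * Complex.I)).measurable

theorem IsDeterminantal.unique {K : L2 μ →L[ℂ] L2 μ} {Q Q' : ProbabilityMeasure (Conf E)}
    (hQ : IsDeterminantal μ K Q) (hQ' : IsDeterminantal μ K Q') : Q = Q' :=
  Conf.eq_of_charFun_eq fun φ => by
    rw [hQ.integral_exp_linStat, hQ'.integral_exp_linStat]

theorem existsUnique_isDeterminantal {K : L2 μ →L[ℂ] L2 μ} (hK : IsStarProjection K)
    (hK_loc : IsLocTraceClass μ K) : ∃! Q : ProbabilityMeasure (Conf E), IsDeterminantal μ K Q := by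
  obtain ⟨Q, hQ⟩ := exists_isDeterminantal hK hK_loc
  exact ⟨Q, hQ, fun Q' hQ' => hQ'.unique hQ⟩

/-- Locally trace norm convergence of projections implies weak convergence of the determinantal
measures. -/
theorem tendsto_of_tendstoLocTrace {Kn : ℕ → L2 μ →L[ℂ] L2 μ} {K : L2 μ →L[ℂ] L2 μ}
    (hKn : ∀ n, IsStarProjection (Kn n)) (hK : IsStarProjection K)
    (h : TendstoLocTrace μ Kn K) {Qn : ℕ → ProbabilityMeasure (Conf E)}
    {Q : ProbabilityMeasure (Conf E)} (hQn : ∀ n, IsDeterminantal μ (Kn n) (Qn n))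
    (hQ : IsDeterminantal μ K Q) : Tendsto Qn atTop (𝓝 Q) := by
  refine Conf.tendsto_of_tendsto_charFun fun φ => ?_
  simp_rw [(hQn _).integral_exp_linStat, hQ.integral_exp_linStat]
  have hB := isBddBorel_of_isCompact φ.hasCompactSupport.isCompact
  set B := tsupport φ
  set f : E → ℂ := fun x => Complex.exp (φ x * Complex.I) - 1 with hf
  have hfm : Measurable f := by
    have := φ.continuous
    exact (by fun_prop : Continuous fun x => Complex.exp (φ x * Complex.I) - 1).measurable
  have h0 : ∀ x ∉ B, star (f x) = 0 := fun x hx => by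
    simp [hf, image_eq_zero_of_notMem_tsupport hx]
  have m1 : MemLp f ∞ μ := memLp_top_of_measurable hfm fun x => norm_exp_mul_I_sub_one_le (φ x)
  have m2 : MemLp (fun x => star (f x)) ∞ μ :=
    memLp_top_of_measurable (continuous_star.measurable.comp hfm) (C := 2) fun x => by
      simpa using norm_exp_mul_I_sub_one_le (φ x)
  have hY := h.tendsto_hsSq hKn hK (fun n => (hQn n).locTraceClass) hQ.locTraceClass hB
  have hKB := hQ.locTraceClass.hsSq_lt_top hK hB
  simp_rw [mulOp_mul_mul_chi_eq (hKn _) m1 m2]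
  rw [mulOp_mul_mul_chi_eq hK m1 m2]
  refine tendsto_fredholmDet (hsSq_mul_mulOp_lt_top m2 hB.1 h0 hKB) hKB ?_ hY
  -- The multiplier is supported in `B`, so the convergence of `Kn n * chi μ B` controls this factor
  -- too.
  set G := mulOp μ fun x => star (f x) with hG
  have hGB : chi μ B * G = G := chi_mul_mulOp hB.1 m2 h0
  have h1 : Tendsto (fun n => ‖G‖ₑ ^ 2 * hsSq (Kn n * chi μ B - K * chi μ B)) atTop
      (𝓝 (‖G‖ₑ ^ 2 * 0)) := ENNReal.Tendsto.const_mul hY (.inr (by simp))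
  rw [mul_zero] at h1
  refine tendsto_of_tendsto_of_tendsto_of_le_of_le tendsto_const_nhds h1 (fun _ => zero_le)
    fun n => ?_
  have e : Kn n * G - K * G = (Kn n * chi μ B - K * chi μ B) * G := by
    rw [sub_mul, mul_assoc, mul_assoc, hGB]
  simp only [e]
  exact hsSq_mul_le' _ _

end Convergence

end DetConv

end

theorem proposition2p2 {E : Type*} [TopologicalSpace E] [PolishSpace E] [LocallyCompactSpace E]
    [MeasurableSpace E] [BorelSpace E] (μ : Measure E) [SigmaFinite μ]
    (Pn : ℕ → DetConv.L2 μ →L[ℂ] DetConv.L2 μ) (P : DetConv.L2 μ →L[ℂ] DetConv.L2 μ)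
    (hPn : ∀ n, IsStarProjection (Pn n)) (hP : IsStarProjection P)
    (hPn_loc : ∀ n, DetConv.IsLocTraceClass μ (Pn n)) (hP_loc : DetConv.IsLocTraceClass μ P)
    (g : E → ℝ) (hg : Measurable g) (hg01 : ∀ x, g x ∈ Set.Icc (0 : ℝ) 1)
    (hPn_tr : ∀ n, DetConv.IsTraceClass
      (DetConv.mulReal μ (fun x => √(1 - g x)) * Pn n * DetConv.mulReal μ (fun x => √(1 - g x))))
    (hP_tr : DetConv.IsTraceClass
      (DetConv.mulReal μ (fun x => √(1 - g x)) * P * DetConv.mulReal μ (fun x => √(1 - g x))))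
    (h_lim : DetConv.TendstoLocTrace μ Pn P)
    (h_tr : Tendsto (fun n => DetConv.trace
        (DetConv.mulReal μ (fun x => √(1 - g x)) * Pn n * DetConv.mulReal μ (fun x => √(1 - g x))))
      atTop (𝓝 (DetConv.trace
        (DetConv.mulReal μ (fun x => √(1 - g x)) * P * DetConv.mulReal μ (fun x => √(1 - g x))))))
    (h_inv : IsUnit (1 + DetConv.mulReal μ (fun x => g x - 1) * P)) :
    -- invertibility for large `n`
    (∀ᶠ n in atTop, IsUnit (1 + DetConv.mulReal μ (fun x => g x - 1) * Pn n)) ∧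
    -- the induced kernels are locally trace class, and converge locally in trace norm
    (∀ᶠ n in atTop, DetConv.IsLocTraceClass μ (DetConv.inducedOp μ g (Pn n))) ∧
    DetConv.IsLocTraceClass μ (DetConv.inducedOp μ g P) ∧
    DetConv.TendstoLocTrace μ (fun n => DetConv.inducedOp μ g (Pn n)) (DetConv.inducedOp μ g P) ∧
    -- the induced determinantal measures are well defined, and converge weakly
    (∀ᶠ n in atTop, ∃! Q : ProbabilityMeasure (DetConv.Conf E),
      DetConv.IsDeterminantal μ (DetConv.inducedOp μ g (Pn n)) Q) ∧
    (∃! Q : ProbabilityMeasure (DetConv.Conf E),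
      DetConv.IsDeterminantal μ (DetConv.inducedOp μ g P) Q) ∧
    (∀ (Qn : ℕ → ProbabilityMeasure (DetConv.Conf E)) (Q : ProbabilityMeasure (DetConv.Conf E)),
      (∀ᶠ n in atTop, DetConv.IsDeterminantal μ (DetConv.inducedOp μ g (Pn n)) (Qn n)) →
      DetConv.IsDeterminantal μ (DetConv.inducedOp μ g P) Q →
      Tendsto Qn atTop (𝓝 Q)) := by
  have happly := h_lim.tendsto_apply hPn hP
  have hT := DetConv.tendsto_one_add_compression hg hg01 hPn hP hPn_tr hP_tr happly h_tr
  have hunit : ∀ᶠ n in atTop, IsUnit (1 + DetConv.mulReal μ (fun x => g x - 1) * Pn n) := by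
    have hu := (DetConv.isUnit_one_add_compression hP).1 h_inv
    filter_upwards [hT.eventually (Units.isOpen.mem_nhds hu)] with n hn
    exact (DetConv.isUnit_one_add_compression (hPn n)).2 hn
  have hloc_n : ∀ᶠ n in atTop, DetConv.IsLocTraceClass μ (DetConv.inducedOp μ g (Pn n)) :=
    hunit.mono fun n hn => DetConv.isLocTraceClass_inducedOp hg hg01 (hPn n) (hPn_loc n) hn
  have hloc := DetConv.isLocTraceClass_inducedOp hg hg01 hP hP_loc h_inv
  have hproj := DetConv.isStarProjection_inducedOp hg hg01 hP h_inv
  have hlim := DetConv.tendstoLocTrace_inducedOp hg hg01 hPn hP hP_loc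
    (fun B hB => h_lim.tendsto_hsSq hPn hP hPn_loc hP_loc hB) hT hunit h_inv
  refine ⟨hunit, hloc_n, hloc, hlim, ?_, DetConv.existsUnique_isDeterminantal hproj hloc,
    fun Qn Q hQn hQ => ?_⟩
  · filter_upwards [hunit, hloc_n] with n h1 h2
    exact DetConv.existsUnique_isDeterminantal
      (DetConv.isStarProjection_inducedOp hg hg01 (hPn n) h1) h2
  -- The convergence lemma wants projections and determinantal measures at every index, so the
  -- sequence is shifted past the exceptional ones.
  · obtain ⟨N, hN⟩ := eventually_atTop.1 (hunit.and hQn)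
    refine (tendsto_add_atTop_iff_nat N).1 ?_
    exact DetConv.tendsto_of_tendstoLocTrace
      (fun n => DetConv.isStarProjection_inducedOp hg hg01 (hPn _) (hN (n + N) (by omega)).1) hproj
      (fun B hB => (tendsto_add_atTop_iff_nat N).2 (hlim B hB))
      (fun n => (hN (n + N) (by omega)).2) hQ
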